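/- Let $G=\mathrm{SL}_2(\mathbb C)\ltimes\mathbb C^2$, $K=\mathrm{SU}(2)$, $\mathfrak g=\mathfrak k\oplus\mathfrak p$ with $\mathfrak k=\mathfrak{su}(2)$ and $\mathfrak p=\mathrm{herm}(2)\oplus\mathbb C^2$ ($\mathrm{herm}(2)$ = traceless Hermitian matrices), and identify $\mathfrak p\equiv T_o(G/K)$ by the differential of the orbit map. Let $e_1,\dots,e_7$ be the basis of $\mathfrak p$ given by $e_1=\left[\begin{smallmatrix}-1&0\\0&1\end{smallmatrix}\right]$, $e_2=\left[\begin{smallmatrix}0&-i\\i&0\end{smallmatrix}\right]$, $e_3=\left[\begin{smallmatrix}0&-1\\-1&0\end{smallmatrix}\right]$, $e_4=(1,0)$, $e_5=(i,0)$, $e_6=(0,1)$, $e_7=(0,-i)$. Then $$\varphi=e^{123}+e^{145}+e^{167}+e^{246}-e^{257}-e^{347}-e^{356}$$ and $e^{123}$ define $G$-invariant $3$-forms on $G/K$ (Bryant's example), and the following holds. (1) $\varphi$ is an extremally Ricci pinched $G_2$-structure: $d\varphi=0$ and $d\tau=\frac16|\tau|^2\varphi+\frac16*(\tau\wedge\tau)$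 for $\tau=-*d*\varphi$. The basis $e_1,\dots,e_7$ is orthonormal; at $o$ one has $\tau=6e^{45}-6e^{67}$, and, as an operator, $\tau^2=\mathrm{Diag}(0,0,0,-36,-36,-36,-36)$; moreover $\Delta\varphi=d\tau=12\varphi-12e^{123}$. (2) The symmetric operator $Q_{d\tau}$ on $\mathfrak p$ with $\theta(Q_{d\tau})\varphi=d\tau$, where $\theta(A)\varphi=-\varphi(A\cdot,\cdot,\cdot)-\varphi(\cdot,A\cdot,\cdot)-\varphi(\cdot,\cdot,A\cdot)$, is $Q_{d\tau}=\mathrm{Diag}(0,0,0,-6,-6,-6,-6)=D_{\mathfrak p}$ for the derivation $D$ of $\mathfrak g$ with $D|_{\mathfrak{sl}_2(\mathbb C)}=0$ and $D|_{\mathbb C^2}=-6I$. So $Q_{d\tau}=cI+\frac12(D_{\mathfrak p}+D_{\mathfrak p}^t)$ with $c=0$ and $D$, $D^t$ derivations of $\mathfrak g$ vanishing on $\mathfrak k$ and preserving $\mathfrak p$. Furthermore $\varphi$ is a steady Laplacian soliton: $\Delta\varphi=\mathcal L_X\varphi$ for a smooth complete vector field $X$ on $G/K$. The family $\varphi(t)=e^{12t}\varphi+(1-e^{12t})e^{123}$,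 $t\in\mathbb R$, is a $G$-invariant solution of the Laplacian flow $\frac{\partial}{\partial t}\varphi(t)=\Delta_{\varphi(t)}\varphi(t)$ on $G/K$ with $\varphi(0)=\varphi$, it is the only $G$-invariant one on any open interval containing $0$, and $\varphi(t)=f(t)^*\varphi$ for diffeomorphisms $f(t)$ of $G/K$ that are equivariant, i.e. of the form $f(t)(aK)=F_t(a)K$ for a Lie group automorphism $F_t$ of $G$ with $F_t(K)=K$. Thus $\varphi$ is an algebraic steady Laplacian soliton. (3) Let $\Gamma\subset G$ be a subgroup such that $M=\Gamma\backslash G/K$ is a smooth manifold for which $\pi:G/K\to M$ is a local diffeomorphism (e.g. $\Gamma$ discrete, acting freely and properly discontinuously on $G/K$; $M$ may be compact, but need not be). Then $\varphi$ and $e^{123}$ descend to $M$, $\varphi$ is an extremally Ricci pinched $G_2$-structure on $M$, and the Laplacian flow on $M$ has the eternal solution $\varphi(t)=e^{12t}\varphi+(1-e^{12t})e^{123}$, $t\in\mathbb R$, starting at $\varphi$. (4) The Ricci operator of the metric $g$ of $\varphi$ on $G/K$ is, at $o$, $\mathrm{Ric}=\mathrm{Diag}(-12,-12,-12,0,0,0,0)=-12I+E_{\mathfrak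 p}$ for the derivation $E$ of $\mathfrak g$ with $E|_{\mathfrak{sl}_2(\mathbb C)}=0$ and $E|_{\mathbb C^2}=12I$; and $g$ is an expanding Ricci soliton: $\mathrm{Ric}=-12g+\mathcal L_Xg$ for a smooth complete vector field $X$ on $G/K$. -/

import Mathlib

open scoped Manifold ContDiff Matrix

attribute [local instance] LieRing.ofAssociativeRing

noncomputable section

namespace G2Flow

/-! ### Linear algebra of positive 3-forms in dimension seven -/

/-- The model space of all 7-manifolds below. The tangent space `TangentSpace 𝓘(ℝ, E7) x` of a
manifold modelled on `E7` is by definition `E7`. -/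
abbrev E7 : Type := EuclideanSpace ℝ (Fin 7)

/-- Alternating `k`-forms on `E7`. -/
abbrev Alt (k : ℕ) : Type := E7 [⋀^Fin k]→L[ℝ] ℝ

/-- Covariant `k`-tensors on `E7`. -/
abbrev Ten (k : ℕ) : Type := ContinuousMultilinearMap ℝ (fun _ : Fin k => E7) ℝ

/-- `e^{J 0} ∧ ⋯ ∧ e^{J (l-1)}`, where `e^0, …, e^6` is the dual basis of `e`; its value on
`u_0, …, u_{l-1}` is the determinant of the matrix `(e^{J b}(u_a))`. -/
def dualForm {l : ℕ} (e : Module.Basis (Fin 7) ℝ E7) (J : Fin l → Fin 7) : Alt l :=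
  { (Matrix.detRowAlternating (n := Fin l) (R := ℝ)).compLinearMap
      (LinearMap.pi fun b => e.coord (J b)) with
    cont := by
      have h : Continuous fun u : Fin l → E7 =>
          (Matrix.of fun a b => e.coord (J b) (u a) : Matrix (Fin l) (Fin l) ℝ).det := by
        refine Continuous.matrix_det ?_
        refine continuous_matrix fun a b => ?_
        exact (LinearMap.continuous_of_finiteDimensional (e.coord (J b))).comp
          (continuous_apply a)
      exact h }

/-- The 3-form `e^127 + e^347 + e^567 + e^135 - e^146 - e^236 - e^245`
(indices are shifted by one, as they start at `0` here). -/
def phiCan (e : Module.Basis (Fin 7) ℝ E7) : Alt 3 :=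
  dualForm e ![0, 1, 6] + dualForm e ![2, 3, 6] + dualForm e ![4, 5, 6] + dualForm e ![0, 2, 4]
    - dualForm e ![0, 3, 5] - dualForm e ![1, 2, 5] - dualForm e ![1, 3, 4]

/-- A 3-form is positive if it is the canonical one with respect to some basis. -/
def IsPositive (φ : Alt 3) : Prop :=
  ∃ e : Module.Basis (Fin 7) ℝ E7, φ = phiCan e

open Classical in
/-- A basis adapted to the positive 3-form `φ`. Two such bases differ by an element of
`G₂ ⊆ SO(7)`, so that the metric and the orientation for which the adapted bases are orthonormal
and positively oriented depend on `φ` only. (Junk value if `φ` is not positive.) -/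
def adaptedBasis (φ : Alt 3) : Module.Basis (Fin 7) ℝ E7 :=
  if h : IsPositive φ then h.choose else (EuclideanSpace.basisFun (Fin 7) ℝ).toBasis

/-- The inner product `∑ e^a ⊗ e^a` determined by a positive 3-form. -/
def innerOf (φ : Alt 3) : Ten 2 :=
  ∑ a : Fin 7, (ContinuousMultilinearMap.mkPiAlgebra ℝ (Fin 2) ℝ).compContinuousLinearMap
    fun _ => LinearMap.toContinuousLinearMap ((adaptedBasis φ).coord a)

/-- The strictly increasing `k`-tuples of indices. -/
def increasing (k : ℕ) : Finset (Fin k → Fin 7) :=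
  Finset.univ.filter fun I => ∀ a b, a < b → I a < I b

/-- The sign of the family `(I, J)`, as a permutation of the seven indices
(`0` if it is not a permutation). -/
def epsilon {k l : ℕ} (h : k + l = 7) (I : Fin k → Fin 7) (J : Fin l → Fin 7) : ℝ :=
  (Matrix.of fun a b : Fin 7 => if Fin.append I J (Fin.cast h.symm a) = b then (1 : ℝ) else 0).det

/-- The Hodge star operator of the inner product and the orientation determined by `φ`:
`∗ e^I = ε(I, J) e^J` for complementary increasing `I`, `J` in an adapted basis, so that
`γ ∧ ∗β = ⟨γ, β⟩ e^1234567`. -/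
def starOf (φ : Alt 3) {k l : ℕ} (h : k + l = 7) (β : Alt k) : Alt l :=
  ∑ I ∈ increasing k, ∑ J ∈ increasing l,
    (epsilon h I J * β (adaptedBasis φ ∘ I)) • dualForm (adaptedBasis φ) J

/-- `|τ|²` for a 2-form `τ`, in the inner product determined by `φ`. -/
def normSqTwo (φ : Alt 3) (τ : Alt 2) : ℝ :=
  ∑ I ∈ increasing 2, (τ (adaptedBasis φ ∘ I)) ^ 2

/-- `τ ∧ τ = (1/4) ∑ τ_ab τ_cd e^abcd` (any basis `e` gives the same form). -/
def wedgeSq (e : Module.Basis (Fin 7) ℝ E7) (τ : Alt 2) : Alt 4 :=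
  (1 / 4 : ℝ) • ∑ a, ∑ b, ∑ c, ∑ d,
    (τ ![e a, e b] * τ ![e c, e d]) • dualForm e ![a, b, c, d]

/-- `ψ = θ(A)φ`, where
`θ(A)φ = -φ(A·,·,·) - φ(·,A·,·) - φ(·,·,A·)`. -/
def IsTheta (A : E7 →ₗ[ℝ] E7) (φ ψ : Alt 3) : Prop :=
  ∀ u : Fin 3 → E7, ψ u = -∑ j, φ (Function.update u j (A (u j)))

/-! ### Forms and tensors on 7-manifolds -/

section Manifold

variable {M : Type*} [TopologicalSpace M] [ChartedSpace E7 M]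
  {N : Type*} [TopologicalSpace N] [ChartedSpace E7 N]

/-- Differential `k`-forms on `M` (smoothness is a separate predicate). -/
abbrev Form (M : Type*) (k : ℕ) : Type _ := M → Alt k

/-- Covariant `k`-tensor fields on `M`. -/
abbrev TensorField (M : Type*) (k : ℕ) : Type _ := M → Ten k

/-- The differential of a map at `x`. -/
def diffAt (f : M → N) (x : M) : E7 →L[ℝ] E7 :=
  mfderiv 𝓘(ℝ, E7) 𝓘(ℝ, E7) f x

/-- The pull-back `f^*α`. -/
def pullback (f : M → N) {k : ℕ} (α : Form N k) : Form M k :=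
  fun x => (α (f x)).compContinuousLinearMap (diffAt f x)

/-- The preferred chart at `x`. -/
def chart (x : M) : PartialEquiv M E7 := extChartAt 𝓘(ℝ, E7) x

/-- The form `α` in the chart at `x`. -/
def localForm {k : ℕ} (α : Form M k) (x : M) : E7 → Alt k :=
  pullback (chart x).symm α

/-- The exterior derivative, computed in the chart at each point. -/
def extD {k : ℕ} (α : Form M k) : Form M (k + 1) :=
  fun x => (extDeriv (localForm α x) (chart x x)).compContinuousLinearMap (diffAt (chart x) x)

/-- `φ` is a `G₂`-structure: a smooth 3-form which is positive at each point. -/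
def IsG2Structure (φ : Form M 3) : Prop :=
  (∀ x, ContDiffAt ℝ ∞ (localForm φ x) (chart x x)) ∧ ∀ x, IsPositive (φ x)

/-- The metric of a `G₂`-structure. -/
def metric (φ : Form M 3) : TensorField M 2 := fun x => innerOf (φ x)

/-- The Hodge star of the metric and the orientation of `φ`. -/
def hodge (φ : Form M 3) {k l : ℕ} (h : k + l = 7) (α : Form M k) : Form M l :=
  fun x => starOf (φ x) h (α x)

/-- The codifferential `d^* = (-1)^(k+1) ∗ d ∗` from `(k+1)`-forms to `k`-forms,
where `(k + 1) + l = 7`. -/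
def codiff (φ : Form M 3) (k l : ℕ) (h : k + 1 + l = 7) (α : Form M (k + 1)) : Form M k :=
  fun x => (-1 : ℝ) ^ (k + 1) •
    hodge φ (k := l + 1) (l := k) (by omega) (extD (hodge φ h α)) x

/-- The Hodge Laplacian `d^*d + dd^*` on 3-forms for the metric of `φ`. -/
def laplacian (φ : Form M 3) (α : Form M 3) : Form M 3 :=
  codiff φ 3 3 rfl (extD α) + extD (codiff φ 2 4 rfl α)

/-- The torsion 2-form `τ = -∗d∗φ` (for closed `φ`, the only torsion form). -/
def torsion (φ : Form M 3) : Form M 2 :=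
  fun x => -hodge φ (k := 5) (l := 2) rfl (extD (hodge φ (k := 3) (l := 4) rfl φ)) x

/-- Extremally Ricci pinched: closed and `dτ = (1/6)|τ|²φ + (1/6)∗(τ ∧ τ)`. -/
def IsERP (φ : Form M 3) : Prop :=
  extD φ = 0 ∧ ∀ x, extD (torsion φ) x =
    ((1 / 6 : ℝ) * normSqTwo (φ x) (torsion φ x)) • φ x +
      (1 / 6 : ℝ) • starOf (φ x) (k := 4) (l := 3) rfl
        (wedgeSq (adaptedBasis (φ x)) (torsion φ x))

/-- The family `φ t`, `t ∈ J`, of `G₂`-structures, smooth in `t` and in the point, solves the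
Laplacian flow `∂φ/∂t = Δφ` on the open set `J` of times. -/
def IsLaplacianFlow (J : Set ℝ) (φ : ℝ → Form M 3) : Prop :=
  ∀ t ∈ J, IsG2Structure (φ t) ∧
    (∀ x, ContDiffAt ℝ ∞ (fun p : ℝ × E7 => localForm (φ p.1) x p.2) (t, chart x x)) ∧
    ∀ x, HasDerivAt (fun s => φ s x) (laplacian (φ t) (φ t) x) t

/-- A smooth vector field which is complete. -/
def IsCompleteField (V : (x : M) → TangentSpace 𝓘(ℝ, E7) x) : Prop :=
  (∀ x, ContDiffAt ℝ ∞
    (fun y => diffAt (chart x) ((chart x).symm y) (V ((chart x).symm y)) : E7 → E7)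
    (chart x x)) ∧
  ∀ x, ∃ γ : ℝ → M, γ 0 = x ∧ IsMIntegralCurve (I := 𝓘(ℝ, E7)) γ V

/-- A tensor field in the chart at `x`. -/
def localTensor {k : ℕ} (T : TensorField M k) (x : M) : E7 → Ten k :=
  fun y => (T ((chart x).symm y)).compContinuousLinearMap fun _ => diffAt (chart x).symm y

/-- The Lie derivative `L_V T` at `x`, evaluated on `u`; in the chart at `x` it is
`D_V T (u_1, …, u_k) + ∑ T(…, D_{u_j} V, …)`. -/
def lieDer {k : ℕ} (V : (x : M) → TangentSpace 𝓘(ℝ, E7) x) (T : TensorField M k) (x : M)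
    (u : Fin k → E7) : ℝ :=
  let W : E7 → E7 := fun y => diffAt (chart x) ((chart x).symm y) (V ((chart x).symm y))
  let y₀ : E7 := chart x x
  let u' : Fin k → E7 := fun j => diffAt (chart x) x (u j)
  fderiv ℝ (localTensor T x) y₀ (W y₀) u' +
    ∑ j, localTensor T x y₀ (Function.update u' j (fderiv ℝ W y₀ (u' j)))

/-- `φ` is a Laplacian soliton with constant `c`: `Δφ = cφ + L_Vφ` for a complete field `V`.
It is steady if `c = 0`. -/
def IsLaplacianSoliton (φ : Form M 3) (c : ℝ) : Prop :=
  IsG2Structure φ ∧ ∃ V : (x : M) → TangentSpace 𝓘(ℝ, E7) x, IsCompleteField V ∧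
    ∀ x u, laplacian φ φ x u =
      c * φ x u + lieDer V (fun y => (φ y).toContinuousMultilinearMap) x u

/-- The standard coordinate vectors. -/
def stdVec (i : Fin 7) : E7 := EuclideanSpace.single i 1

/-- The partial derivative `∂_i f`. -/
def pd (i : Fin 7) (f : E7 → ℝ) (y : E7) : ℝ := fderiv ℝ f y (stdVec i)

/-- The matrix `(g_ij)` of a metric given on an open subset of `E7`. -/
def gram (g : E7 → Ten 2) (y : E7) : Matrix (Fin 7) (Fin 7) ℝ :=
  Matrix.of fun i j => g y ![stdVec i, stdVec j]

/-- The Christoffel symbols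
`Γ^k_ij = (1/2) ∑_l g^kl (∂_i g_jl + ∂_j g_il - ∂_l g_ij)`. -/
def christoffel (g : E7 → Ten 2) (k i j : Fin 7) (y : E7) : ℝ :=
  (1 / 2) * ∑ l, (gram g y)⁻¹ k l *
    (pd i (fun z => gram g z j l) y + pd j (fun z => gram g z i l) y
      - pd l (fun z => gram g z i j) y)

/-- `Ric_ij = ∂_k Γ^k_ij - ∂_j Γ^k_ik + Γ^k_kl Γ^l_ij - Γ^k_jl Γ^l_ik`. -/
def ricciCoord (g : E7 → Ten 2) (i j : Fin 7) (y : E7) : ℝ :=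
  ∑ k, (pd k (christoffel g k i j) y - pd j (christoffel g k i k) y +
    ∑ l, (christoffel g k k l y * christoffel g l i j y
      - christoffel g k j l y * christoffel g l i k y))

/-- The Ricci tensor of a metric on `M`, computed in the chart at each point. -/
def ricci (g : TensorField M 2) (x : M) (u v : E7) : ℝ :=
  ∑ i, ∑ j, ricciCoord (localTensor g x) i j (chart x x) *
    (diffAt (chart x) x u) i * (diffAt (chart x) x v) j

/-- `g` is a Ricci soliton with constant `c`: `Ric = c g + L_V g` for a complete field `V`.
It is expanding if `c < 0`. -/
def IsRicciSoliton (g : TensorField M 2) (c : ℝ) : Prop :=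
  ∃ V : (x : M) → TangentSpace 𝓘(ℝ, E7) x, IsCompleteField V ∧
    ∀ x u v, ricci g x u v = c * g x ![u, v] + lieDer V g x ![u, v]

end Manifold

/-! ### The homogeneous space `(SL₂(ℂ) ⋉ ℂ²) / SU(2)` -/

/-- The block `A` of a matrix `[A v; 0 1]` or `[A v; 0 0]`. -/
def linPart (g : Matrix (Fin 3) (Fin 3) ℂ) : Matrix (Fin 2) (Fin 2) ℂ :=
  !![g 0 0, g 0 1; g 1 0, g 1 1]

/-- The column `v` of a matrix `[A v; 0 1]` or `[A v; 0 0]`. -/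
def transPart (g : Matrix (Fin 3) (Fin 3) ℂ) : Fin 2 → ℂ := ![g 0 2, g 1 2]

lemma linPart_mul (g h : Matrix (Fin 3) (Fin 3) ℂ) (h0 : h 2 0 = 0) (h1 : h 2 1 = 0) :
    linPart (g * h) = linPart g * linPart h := by
  ext i j
  fin_cases i <;> fin_cases j <;>
    simp [linPart, Matrix.mul_apply, Fin.sum_univ_succ, h0, h1]

lemma transPart_mul (g h : Matrix (Fin 3) (Fin 3) ℂ) (h2 : h 2 2 = 1) :
    transPart (g * h) = linPart g *ᵥ transPart h + transPart g := by
  ext i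
  fin_cases i <;>
    simp [linPart, transPart, Matrix.mul_apply, Fin.sum_univ_succ, h2, add_assoc, mul_comm]

/-- The group `G = SL₂(ℂ) ⋉ ℂ²`, as the group of the matrices `[A v; 0 1]` with `det A = 1`. -/
def GBry : Subgroup (Matrix.SpecialLinearGroup (Fin 3) ℂ) where
  carrier := {g | g.1 2 0 = 0 ∧ g.1 2 1 = 0 ∧ g.1 2 2 = 1}
  one_mem' := by simp
  mul_mem' := by
    rintro a b ⟨ha0, ha1, ha2⟩ ⟨hb0, hb1, hb2⟩
    simp [Matrix.mul_apply, Fin.sum_univ_succ] at *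
    simp [*]
  inv_mem' := by
    rintro a ⟨ha0, ha1, ha2⟩
    have hd : a.1.det = 1 := a.2
    rw [Matrix.det_fin_three] at hd
    simp only [ha0, ha1, ha2] at hd
    simp only [Set.mem_ofPred_eq, Matrix.SpecialLinearGroup.coe_inv]
    rw [Matrix.adjugate_fin_three]
    simp [ha0, ha1]
    linear_combination hd

/-- The subgroup `K = SU(2)` of `G`: the unitary matrices (they have `v = 0`). -/
def KBry : Subgroup GBry where
  carrier := {g | (g.1.1)ᴴ * g.1.1 = 1}
  one_mem' := by simp
  mul_mem' := by
    intro a b ha hb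
    simp only [Set.mem_ofPred_eq] at *
    simp only [Subgroup.coe_mul, Matrix.SpecialLinearGroup.coe_mul, Matrix.conjTranspose_mul]
    rw [Matrix.mul_assoc, ← Matrix.mul_assoc _ a.1.1, ha, Matrix.one_mul, hb]
  inv_mem' := by
    intro a ha
    simp only [Set.mem_ofPred_eq] at *
    have h1 : (a⁻¹).1.1 * a.1.1 = 1 := by
      rw [← Matrix.SpecialLinearGroup.coe_mul, ← Subgroup.coe_mul, inv_mul_cancel]; simp
    have h2 : (a⁻¹).1.1 = (a.1.1)ᴴ := left_inv_eq_right_inv h1 (mul_eq_one_comm.mp ha)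
    rw [h2, Matrix.conjTranspose_conjTranspose]
    exact mul_eq_one_comm.mp ha

/-- The manifold `G/K` is the set of pairs `(P, w)`, where `P` is a positive definite Hermitian
matrix of determinant one and `w ∈ ℂ²`, on which `G` acts by `(A, v) • (P, w) = (APA^*, Aw + v)`.
We use the global coordinates `x ∈ E7` given by `P = [e^s z; z̄ q]`, `s = x_0`,
`z = x_1 + i x_2`, and `w = (x_3 + i x_4, x_5 + i x_6)`. -/
def herm (x : E7) : Matrix (Fin 2) (Fin 2) ℂ :=
  !![⟨Real.exp (x 0), 0⟩, ⟨x 1, x 2⟩;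
    ⟨x 1, -x 2⟩, ⟨(1 + x 1 ^ 2 + x 2 ^ 2) * Real.exp (-x 0), 0⟩]

/-- The component `w` of the point with coordinates `x`. -/
def vecPart (x : E7) : Fin 2 → ℂ := ![(⟨x 3, x 4⟩ : ℂ), (⟨x 5, x 6⟩ : ℂ)]

/-- The coordinates of the point `(P, w)`. -/
def coords (P : Matrix (Fin 2) (Fin 2) ℂ) (w : Fin 2 → ℂ) : E7 :=
  !₂[Real.log (P 0 0).re, (P 0 1).re, (P 0 1).im, (w 0).re, (w 0).im, (w 1).re, (w 1).im]

/-- The action in coordinates. -/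
def act (g : Matrix (Fin 3) (Fin 3) ℂ) (x : E7) : E7 :=
  coords (linPart g * herm x * (linPart g)ᴴ) (linPart g *ᵥ vecPart x + transPart g)

lemma coords_herm_vec (x : E7) : coords (herm x) (vecPart x) = x := by
  ext i
  fin_cases i <;> simp [coords, herm, vecPart]

lemma vec_coords (P : Matrix (Fin 2) (Fin 2) ℂ) (w : Fin 2 → ℂ) : vecPart (coords P w) = w := by
  ext i
  fin_cases i <;> simp [coords, vecPart]

lemma herm_coords (P : Matrix (Fin 2) (Fin 2) ℂ) (w : Fin 2 → ℂ) (hP : P.IsHermitian)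
    (hd : P.det = 1) (h0 : 0 < (P 0 0).re) : herm (coords P w) = P := by
  have h00 : (P 0 0).im = 0 := by
    have := congrArg Complex.im (hP.apply 0 0); simp at this; linarith
  have h11 : (P 1 1).im = 0 := by
    have := congrArg Complex.im (hP.apply 1 1); simp at this; linarith
  have h10 : P 1 0 = star (P 0 1) := (hP.apply 1 0).symm
  have hdet : (P 0 0).re * (P 1 1).re = 1 + (P 0 1).re ^ 2 + (P 0 1).im ^ 2 := by
    rw [Matrix.det_fin_two] at hd
    have := congrArg Complex.re hd
    simp [h10, h00, h11] at this
    linarith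
  ext i j
  fin_cases i <;> fin_cases j <;>
    simp [coords, herm, Complex.ext_iff, h10, h00, h11, Real.exp_neg,
      Real.exp_log h0]
  rw [← hdet]
  field_simp

lemma herm_isHermitian (x : E7) : (herm x).IsHermitian := by
  ext i j
  fin_cases i <;> fin_cases j <;>
    simp [herm, Complex.ext_iff]

lemma herm_det (x : E7) : (herm x).det = 1 := by
  rw [Matrix.det_fin_two]
  have := Real.exp_pos (x 0)
  simp [herm, Complex.ext_iff, Real.exp_neg]
  constructor
  · field_simp
    ring
  · ring

lemma lin_det (g : GBry) : (linPart g.1.1).det = 1 := by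
  have hd : g.1.1.det = 1 := g.1.2
  obtain ⟨h0, h1, h2⟩ := g.2
  rw [Matrix.det_fin_three] at hd
  simp only [h0, h1, h2] at hd
  rw [Matrix.det_fin_two]
  simp [linPart]
  linear_combination hd

lemma herm_act_pos (g : GBry) (x : E7) : 0 < ((linPart g.1.1 * herm x * (linPart g.1.1)ᴴ) 0 0).re := by
  have hd := lin_det g
  set A := linPart g.1.1
  have hE := Real.exp_pos (x 0)
  have hdd : A 0 0 ≠ 0 ∨ A 0 1 ≠ 0 := by
    by_contra! h
    rw [Matrix.det_fin_two, h.1, h.2] at hd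
    simp at hd
  have key : ((A * herm x * Aᴴ) 0 0).re * Real.exp (x 0) =
      Complex.normSq (A 0 0 * Real.exp (x 0) + A 0 1 * ⟨x 1, -x 2⟩) +
        Complex.normSq (A 0 1) := by
    simp [Matrix.mul_apply, Fin.sum_univ_succ, herm, Complex.normSq_apply, -Complex.ofReal_exp,
      Real.exp_neg]
    field_simp
    ring
  have hpos : 0 < Complex.normSq (A 0 0 * Real.exp (x 0) + A 0 1 * ⟨x 1, -x 2⟩) +
        Complex.normSq (A 0 1) := by
    by_cases h1 : A 0 1 = 0
    · have h00 : A 0 0 ≠ 0 := by tauto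
      have h3 : A 0 0 * (Real.exp (x 0) : ℂ) ≠ 0 :=
        mul_ne_zero h00 (by exact_mod_cast hE.ne')
      have := Complex.normSq_pos.mpr h3
      simpa [h1] using this
    · have := Complex.normSq_pos.mpr h1
      have := Complex.normSq_nonneg (A 0 0 * Real.exp (x 0) + A 0 1 * ⟨x 1, -x 2⟩)
      linarith
  rw [← key] at hpos
  exact (pos_iff_pos_of_mul_pos hpos).mpr hE

lemma herm_act (g : GBry) (x : E7) :
    herm (act g.1.1 x) = linPart g.1.1 * herm x * (linPart g.1.1)ᴴ := by
  refine herm_coords _ _ ?_ ?_ (herm_act_pos g x)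
  · exact Matrix.isHermitian_mul_mul_conjTranspose _ (herm_isHermitian x)
  · simp [Matrix.det_mul, lin_det, herm_det, Matrix.det_conjTranspose]

instance : MulAction GBry E7 where
  smul g x := act g.1.1 x
  one_smul x := by
    change act 1 x = x
    have h1 : linPart 1 = 1 := by ext i j; fin_cases i <;> fin_cases j <;> simp [linPart]
    have h2 : transPart 1 = 0 := by ext i; fin_cases i <;> simp [transPart]
    simp [act, h1, h2, coords_herm_vec]
  mul_smul g h x := by
    change act (g.1.1 * h.1.1) x = act g.1.1 (act h.1.1 x)
    rw [act.eq_1 g.1.1 (act h.1.1 x), herm_act, act.eq_1 (g.1.1 * h.1.1),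
      linPart_mul _ _ h.2.1 h.2.2.1, transPart_mul _ _ h.2.2.2]
    have : vecPart (act h.1.1 x) = linPart h.1.1 *ᵥ vecPart x + transPart h.1.1 := vec_coords _ _
    rw [this, Matrix.mulVec_add, Matrix.mulVec_mulVec, Matrix.conjTranspose_mul]
    simp only [Matrix.mul_assoc, add_assoc]

/-- The base point `(I, 0)` of `G/K`. -/
def oBry : E7 := 0

/-- The Lie algebra `𝔤 = 𝔰𝔩₂(ℂ) ⋉ ℂ²`, as the real Lie algebra of the matrices `[X u; 0 0]`
with `tr X = 0`. -/
def gBry : LieSubalgebra ℝ (Matrix (Fin 3) (Fin 3) ℂ) where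
  carrier := {Y | Y 2 0 = 0 ∧ Y 2 1 = 0 ∧ Y 2 2 = 0 ∧ Y 0 0 + Y 1 1 = 0}
  zero_mem' := by simp
  add_mem' := by
    rintro a b ⟨ha0, ha1, ha2, ha3⟩ ⟨hb0, hb1, hb2, hb3⟩
    simp only [Set.mem_ofPred_eq, Matrix.add_apply, ha0, ha1, ha2, hb0, hb1, hb2, add_zero,
      true_and]
    linear_combination ha3 + hb3
  smul_mem' := by
    rintro c a ⟨ha0, ha1, ha2, ha3⟩
    simp [ha0, ha1, ha2, ← mul_add, ha3]
  lie_mem' := by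
    rintro a b ⟨ha0, ha1, ha2, ha3⟩ ⟨hb0, hb1, hb2, hb3⟩
    simp only [Ring.lie_def, Set.mem_ofPred_eq, Matrix.sub_apply, Matrix.mul_apply,
      Fin.sum_univ_three, ha0, ha1, ha2, hb0, hb1, hb2]
    refine ⟨by ring, by ring, by ring, by ring⟩

/-- `𝔨 = 𝔰𝔲(2)`. -/
def kBry : Submodule ℝ gBry where
  carrier := {Y | (Y.1)ᴴ = -Y.1}
  zero_mem' := by simp
  add_mem' := by
    intro a b ha hb
    simp only [Set.mem_ofPred_eq] at *
    simp [ha, hb, add_comm]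
  smul_mem' := by
    intro c a ha
    simp only [Set.mem_ofPred_eq] at *
    simp [ha]

/-- `𝔭 = herm(2) ⊕ ℂ²`. -/
def pBry : Submodule ℝ gBry where
  carrier := {Y | (linPart Y.1)ᴴ = linPart Y.1}
  zero_mem' := by
    ext i j; fin_cases i <;> fin_cases j <;> simp [linPart]
  add_mem' := by
    intro a b ha hb
    have h : linPart (a + b).1 = linPart a.1 + linPart b.1 := by
      ext i j; fin_cases i <;> fin_cases j <;> simp [linPart]
    simp only [Set.mem_ofPred_eq] at *
    rw [h, Matrix.conjTranspose_add, ha, hb]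
  smul_mem' := by
    intro c a ha
    have h : linPart (c • a).1 = c • linPart a.1 := by
      ext i j; fin_cases i <;> fin_cases j <;> simp [linPart]
    simp only [Set.mem_ofPred_eq] at *
    rw [h, Matrix.conjTranspose_smul, ha]
    simp

open Complex in
/-- The basis `e_1, …, e_7` of `𝔭`:
`e_1 = [-1 0; 0 1]`, `e_2 = [0 -i; i 0]`, `e_3 = [0 -1; -1 0]` in `herm(2)` and
`e_4 = (1, 0)`, `e_5 = (i, 0)`, `e_6 = (0, 1)`, `e_7 = (0, -i)` in `ℂ²`. -/
def pMat : Fin 7 → Matrix (Fin 3) (Fin 3) ℂ :=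
  ![!![-1, 0, 0; 0, 1, 0; 0, 0, 0], !![0, -I, 0; I, 0, 0; 0, 0, 0],
    !![0, -1, 0; -1, 0, 0; 0, 0, 0], !![0, 0, 1; 0, 0, 0; 0, 0, 0],
    !![0, 0, I; 0, 0, 0; 0, 0, 0], !![0, 0, 0; 0, 0, 1; 0, 0, 0],
    !![0, 0, 0; 0, 0, -I; 0, 0, 0]]

/-- The differential `𝔤 → T_o(G/K)` at the identity of the orbit map `a ↦ a • o`; its restriction
to `𝔭` is the identification `𝔭 ≡ T_o(G/K)`. -/
def tang (Y : Matrix (Fin 3) (Fin 3) ℂ) : E7 :=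
  deriv (fun t : ℝ => act (NormedSpace.exp (t • Y)) oBry) 0

/-- `G`-invariant forms on `G/K`. -/
def IsGInvariant {k : ℕ} (α : Form E7 k) : Prop :=
  ∀ a : GBry, pullback (fun x : E7 => a • x) α = α

/-- The derivation `D` of `𝔤` vanishes on `𝔰𝔩₂(ℂ)` and is `r` times the identity on `ℂ²`. -/
def IsBlockScalar (D : LieDerivation ℝ gBry gBry) (r : ℝ) : Prop :=
  (∀ Y : gBry, transPart Y.1 = 0 → D Y = 0) ∧ ∀ Y : gBry, linPart Y.1 = 0 → D Y = r • Y

/-- `f` is an equivariant diffeomorphism of `G/K`, that is, `f (aK) = F(a)K` for an automorphism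
`F` of the Lie group `G` with `F(K) = K`. -/
def IsEquivariant (f : E7 ≃ₘ⟮𝓘(ℝ, E7), 𝓘(ℝ, E7)⟯ E7) : Prop :=
  ∃ F : GBry ≃ₜ* GBry, KBry.map (F : GBry →* GBry) = KBry ∧ ∀ a : GBry, f (a • oBry) = F a • oBry

/-- `ψ` is the `G`-invariant Laplacian flow solution starting at `φ`, on the interval `J`. -/
def IsInvariantFlow (J : Set ℝ) (φ : Form E7 3) (ψ : ℝ → Form E7 3) : Prop :=
  ψ 0 = φ ∧ (∀ t ∈ J, IsGInvariant (ψ t)) ∧ IsLaplacianFlow J ψ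

/-- `Q : T_o(G/K) → T_o(G/K)` is the symmetric operator `Q_{dτ}` at the base point, that is,
`θ(Q)φ = dτ`. -/
def IsQ (φ : Form E7 3) (Q : E7 →ₗ[ℝ] E7) : Prop :=
  (∀ u v, innerOf (φ oBry) ![Q u, v] = innerOf (φ oBry) ![u, Q v]) ∧
    IsTheta Q (φ oBry) (extD (torsion φ) oBry)

/-- `Q = cI + (1/2)(D_𝔭 + D_𝔭^t)` on `𝔭 ≡ T_o(G/K)` for the derivation `D = [0 0; 0 D_𝔭]` of
`𝔤 = 𝔨 ⊕ 𝔭`, and `D^t = [0 0; 0 D_𝔭^t]` is a derivation too. -/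
def IsAlgebraicFor (φ : Form E7 3) (Q : E7 →ₗ[ℝ] E7) (c : ℝ) (D : LieDerivation ℝ gBry gBry) : Prop :=
  (∀ Y ∈ kBry, D Y = 0) ∧ (∀ Y ∈ pBry, D Y ∈ pBry) ∧
  ∃ Dt : LieDerivation ℝ gBry gBry, (∀ Y ∈ kBry, Dt Y = 0) ∧ (∀ Y ∈ pBry, Dt Y ∈ pBry) ∧
    (∀ Y ∈ pBry, ∀ Z ∈ pBry,
      innerOf (φ oBry) ![tang (Dt Y).1, tang Z.1] = innerOf (φ oBry) ![tang Y.1, tang (D Z).1]) ∧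
    ∀ Y ∈ pBry, Q (tang Y.1) =
      c • tang Y.1 + (1 / 2 : ℝ) • (tang (D Y).1 + tang (Dt Y).1)

end G2Flow

end

open G2Flow

noncomputable section

namespace G2Flow


/-! ### Alternating forms and increasing tuples -/

/-! By the Cholesky factorisation P = LL*, the lower triangular matrices with positive diagonal,
extended by the translations of ℂ², act simply transitively on G/K. Invariant forms therefore have
constant components in the left-invariant coframe `coframe`, and d acts on such forms through
integer structure constants (`extD_invForm`). Every identity between d, ∗ and φ becomes a finite
integer computation.

The metric, the star and the orientation are defined by a chosen adapted basis, so their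
independence of the choice comes first. It rests on Bryant's identity ι_uφ ∧ ι_vφ ∧ φ = 6⟨u,v⟩vol:
two bases adapted to the same φ differ by an element of SO(7) (`specialOrthogonalRel_of_phiCan_eq`).

Write η = e^123 and β = φ - η. The forms l³η + lm²β (`scaledForm`) are closed, and an adapted
coframe is obtained by rescaling the first three covectors by l and the other four by m. Counting
weights gives τ = (m²/l)(6e^45 - 6e^67) and Δ = 12(m²/l)β (`laplacian_scaledForm`). At l = m = 1
this yields the extremally Ricci pinched condition. At l = 1 the flow fixes η and multiplies β by
e^{12t}, which is the pull-back of φ by (P, w) ↦ (P, e^{6t}w). These dilations come from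
automorphisms of G, and their generator provides the soliton field and the derivations.

An element of G acts on the coframe through a unitary matrix k (`exists_unitary`), and η and β are
imaginary parts of unitary invariants; hence they are G-invariant. Conversely three elements of
SU(2) suffice to show that η and β span the invariant 3-forms (`IsGInvariant.eq_at_zero`). An
invariant flow is thus aη + bβ; positivity keeps a and b nonzero, and the flow becomes a' = 0, b' =
12b (`eq_of_isInvariantFlow`).

Statements on a quotient M are pulled back along π: star and d are natural under local
diffeomorphisms (`hodge_pullback`, `extD_pullback`) and the pull-back along a surjective one is
injective. For the Ricci tensor, the metric coefficients are polynomials in x_1, x_2 and e^{±x_0},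
so the coordinate formula is evaluated exactly (`ricciPoly_eq`): Ric is -12 on the hyperbolic
directions and 0 on the fibres, while the Lie derivative of g along the dilation field is 0 and 12
there, which together give the Ricci soliton. -/

theorem dualForm_apply {l : ℕ} (e : Module.Basis (Fin 7) ℝ E7) (J : Fin l → Fin 7)
    (u : Fin l → E7) :
    dualForm e J u = (Matrix.of fun a b => e.repr (u a) (J b)).det := rfl

theorem mem_increasing {k : ℕ} {I : Fin k → Fin 7} : I ∈ increasing k ↔ StrictMono I := by
  simp [increasing, StrictMono]

theorem dualForm_basis {l : ℕ} (e : Module.Basis (Fin 7) ℝ E7) (J I : Fin l → Fin 7) :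
    dualForm e J (e ∘ I) = (Matrix.of fun a b => if I a = J b then (1 : ℝ) else 0).det := by
  rw [dualForm_apply]
  congr 1
  ext a b
  simp [Finsupp.single_apply]

theorem dualForm_basis_of_strictMono {l : ℕ} (e : Module.Basis (Fin 7) ℝ E7)
    {J I : Fin l → Fin 7} (hJ : StrictMono J) (hI : StrictMono I) :
    dualForm e J (e ∘ I) = if I = J then 1 else 0 := by
  rw [dualForm_basis]
  split_ifs with h
  · subst h
    convert Matrix.det_one (n := Fin l) (R := ℝ)
    ext a b
    simp [Matrix.one_apply, hI.injective.eq_iff]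
  · have : ∃ a, ∀ b, I a ≠ J b := by
      by_contra! h'
      apply h
      rw [← StrictMono.range_inj hI hJ]
      apply Set.eq_of_subset_of_ncard_le
      · rintro _ ⟨a, rfl⟩
        obtain ⟨b, hb⟩ := h' a
        exact ⟨b, hb.symm⟩
      · rw [← Nat.card_coe_set_eq, ← Nat.card_coe_set_eq,
          Nat.card_range_of_injective hJ.injective, Nat.card_range_of_injective hI.injective]
      · exact Set.toFinite _
    obtain ⟨a, ha⟩ := this
    exact Matrix.det_eq_zero_of_row_eq_zero a fun b => by simp [ha b]

theorem strictMono_comp_sort {k : ℕ} {v : Fin k → Fin 7} (hv : Function.Injective v) :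
    StrictMono (v ∘ Tuple.sort v) :=
  (Tuple.monotone_sort v).strictMono_of_injective (hv.comp (Equiv.injective _))

/-- Sorting an injective tuple changes both forms by the same sign, and this sign cancels. -/
theorem alternating_ext_increasing {k : ℕ} (e : Module.Basis (Fin 7) ℝ E7)
    {α β : E7 [⋀^Fin k]→ₗ[ℝ] ℝ}
    (h : ∀ I : Fin k → Fin 7, StrictMono I → α (e ∘ I) = β (e ∘ I)) : α = β := by
  refine e.ext_alternating fun v hv => ?_
  have h1 := h _ (strictMono_comp_sort hv)
  have h2 := α.map_perm (e ∘ v) (Tuple.sort v)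
  have h3 := β.map_perm (e ∘ v) (Tuple.sort v)
  rw [Function.comp_assoc] at h2 h3
  rw [h2, h3] at h1
  exact smul_left_cancel _ h1

theorem alt_ext_increasing {k : ℕ} (e : Module.Basis (Fin 7) ℝ E7) {α β : Alt k}
    (h : ∀ I : Fin k → Fin 7, StrictMono I → α (e ∘ I) = β (e ∘ I)) : α = β :=
  ContinuousAlternatingMap.toAlternatingMap_injective (alternating_ext_increasing e h)

/-- Each injective tuple is I ∘ σ for exactly one increasing I and one permutation σ. Sums over all
tuples transform well under a change of basis, sums over increasing ones do not; this passes between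
them. -/
theorem sum_eq_factorial_mul_sum_increasing {k : ℕ} (F : (Fin k → Fin 7) → ℝ)
    (hF : ∀ I (σ : Equiv.Perm (Fin k)), F (I ∘ σ) = F I)
    (h0 : ∀ I, ¬ Function.Injective I → F I = 0) :
    ∑ I, F I = (Nat.factorial k : ℝ) * ∑ I ∈ increasing k, F I := by
  have h1 : ∑ I, F I = ∑ p ∈ increasing k ×ˢ (Finset.univ : Finset (Equiv.Perm (Fin k))),
      F p.1 := by
    symm
    refine Finset.sum_of_injOn (fun p => p.1 ∘ p.2) ?_ ?_ ?_ ?_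
    · rintro ⟨I, σ⟩ h ⟨I', σ'⟩ h' hh
      simp only [Finset.coe_product, Set.mem_prod, Finset.mem_coe, mem_increasing] at h h' hh
      have hI : I = I' := by
        rw [← StrictMono.range_inj h.1 h'.1, ← σ.surjective.range_comp I, hh,
          σ'.surjective.range_comp]
      subst hI
      simp only [Prod.mk.injEq, true_and]
      ext a
      exact congrArg Fin.val (h.1.injective (congrFun hh a))
    · intro p _
      simp
    · intro J _ hJ
      apply h0
      intro hi
      refine hJ ⟨(J ∘ Tuple.sort J, (Tuple.sort J)⁻¹), ?_, ?_⟩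
      · simp only [Finset.coe_product, Set.mem_prod, Finset.mem_coe, mem_increasing,
          Finset.mem_univ, and_true]
        exact strictMono_comp_sort hi
      · ext a
        simp
    · intro p _
      exact (hF _ _).symm
  rw [h1, Finset.sum_product]
  simp [Finset.sum_const, Finset.mul_sum, Fintype.card_perm]

theorem sum_fin_succ_fun {n : ℕ} {α R : Type*} [Fintype α] [AddCommMonoid R]
    (F : (Fin (n + 1) → α) → R) : ∑ J, F J = ∑ a, ∑ J, F (Matrix.vecCons a J) := by
  rw [← (Fin.consEquiv fun _ : Fin (n + 1) => α).sum_comp, Fintype.sum_prod_type]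
  rfl

theorem sum_fin_zero_fun {α R : Type*} [AddCommMonoid R] [Fintype α]
    (F : (Fin 0 → α) → R) : ∑ J, F J = F ![] := by
  rw [Fintype.sum_subsingleton]

/-! ### Orthogonal changes of basis -/

/-- The basis `e'` is obtained from `e` by an element of `SO(7)`. -/
def SpecialOrthogonalRel (e e' : Module.Basis (Fin 7) ℝ E7) : Prop :=
  e.toMatrix e' * (e.toMatrix e')ᵀ = 1 ∧ (e.toMatrix e').det = 1

/-- Full contraction of two tensors is invariant under an orthogonal change of basis. Expanding both
factors leaves products of sums ∑_j Q_aj Q_bj, which are Kronecker symbols. -/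
theorem sum_mul_of_orthogonal {k : ℕ} (f g : MultilinearMap ℝ (fun _ : Fin k => E7) ℝ)
    {e e' : Module.Basis (Fin 7) ℝ E7} (h : e.toMatrix e' * (e.toMatrix e')ᵀ = 1) :
    ∑ J : Fin k → Fin 7, f (e' ∘ J) * g (e' ∘ J) = ∑ J : Fin k → Fin 7, f (e ∘ J) * g (e ∘ J) := by
  set Q := e.toMatrix e' with hQ
  have hexp : ∀ (f : MultilinearMap ℝ (fun _ : Fin k => E7) ℝ) (J : Fin k → Fin 7),
      f (e' ∘ J) = ∑ I : Fin k → Fin 7, (∏ a, Q (I a) (J a)) * f (e ∘ I) := by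
    intro f J
    have h1 : e' ∘ J = fun a => ∑ i, Q i (J a) • e i := by
      ext1 a
      simp [hQ, e.sum_toMatrix_smul_self]
    rw [h1, f.map_sum]
    refine Finset.sum_congr rfl fun I _ => ?_
    rw [f.map_smul_univ]
    rfl
  have hd : ∀ I I' : Fin k → Fin 7, ∑ J : Fin k → Fin 7, (∏ a, Q (I a) (J a)) *
      (∏ a, Q (I' a) (J a)) = if I = I' then 1 else 0 := by
    intro I I'
    have h2 : ∀ a b, ∑ j, Q a j * Q b j = if a = b then 1 else 0 := by
      intro a b
      have := congrFun (congrFun h a) b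
      simpa [Matrix.mul_apply, Matrix.one_apply] using this
    simp_rw [← Finset.prod_mul_distrib]
    have h3 := Finset.prod_univ_sum (fun _ : Fin k => (Finset.univ : Finset (Fin 7)))
      (fun a j => Q (I a) j * Q (I' a) j)
    rw [Fintype.piFinset_univ] at h3
    rw [← h3]
    simp_rw [h2, Finset.prod_ite_zero]
    simp [funext_iff]
  simp_rw [hexp, Finset.sum_mul_sum]
  rw [Finset.sum_comm]
  refine Finset.sum_congr rfl fun I _ => ?_
  rw [Finset.sum_comm]
  have : ∀ I' : Fin k → Fin 7, ∑ J : Fin k → Fin 7,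
      (∏ a, Q (I a) (J a)) * f (e ∘ I) * ((∏ a, Q (I' a) (J a)) * g (e ∘ I')) =
      if I = I' then f (e ∘ I) * g (e ∘ I') else 0 := by
    intro I'
    rw [← mul_one (f (e ∘ I) * g (e ∘ I')), ← mul_zero (f (e ∘ I) * g (e ∘ I')), ← mul_ite, ← hd I I',
      Finset.mul_sum]
    exact Finset.sum_congr rfl fun J _ => by ring
  simp_rw [this]
  simp

/-- The Hodge star for which the basis `e` is orthonormal and positively oriented. -/
def starE (e : Module.Basis (Fin 7) ℝ E7) {k l : ℕ} (h : k + l = 7) (β : Alt k) : Alt l :=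
  ∑ I ∈ increasing k, ∑ J ∈ increasing l, (epsilon h I J * β (e ∘ I)) • dualForm e J

/-- The determinant of `e`, with its arguments split into two groups. -/
def detSum (e : Module.Basis (Fin 7) ℝ E7) {k l : ℕ} (h : k + l = 7) :
    E7 [⋀^Fin k ⊕ Fin l]→ₗ[ℝ] ℝ :=
  e.det.domDomCongr (finSumFinEquiv.trans (finCongr h)).symm

theorem detSum_apply (e : Module.Basis (Fin 7) ℝ E7) {k l : ℕ} (h : k + l = 7) (w : Fin k → E7)
    (u : Fin l → E7) :
    detSum e h (Sum.elim w u) = e.det (fun a => Fin.append w u (Fin.cast h.symm a)) := by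
  rw [detSum, AlternatingMap.domDomCongr_apply]
  congr 1
  ext1 a
  have : ∀ c : Fin (k + l), Sum.elim w u (finSumFinEquiv.symm c) = Fin.append w u c := by
    intro c
    induction c using Fin.addCases <;> simp
  simp [← this]

/-- The sign symbol is the volume form evaluated on basis vectors, in whichever basis the volume
form is normalised. -/
theorem epsilon_eq_detSum (e : Module.Basis (Fin 7) ℝ E7) {k l : ℕ} (h : k + l = 7)
    (I : Fin k → Fin 7) (J : Fin l → Fin 7) :
    epsilon h I J = detSum e h (Sum.elim (e ∘ I) (e ∘ J)) := by
  rw [detSum_apply, Module.Basis.det_apply, epsilon, ← Matrix.det_transpose]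
  congr 1
  ext a b
  have : Fin.append (e ∘ I) (e ∘ J) (Fin.cast h.symm b) =
      e (Fin.append I J (Fin.cast h.symm b)) := by
    generalize Fin.cast h.symm b = c
    induction c using Fin.addCases <;> simp
  simp [Module.Basis.toMatrix_apply, this, Finsupp.single_apply]

/-- `detSum` with fixed arguments in the first group. -/
def detSumRight (e : Module.Basis (Fin 7) ℝ E7) {k l : ℕ} (h : k + l = 7) (w : Fin k → E7) :
    E7 [⋀^Fin l]→ₗ[ℝ] ℝ where
  toFun u := detSum e h (Sum.elim w u)
  map_update_add' u i x y := by
    classical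
    simp only [← Sum.update_elim_inr, AlternatingMap.map_update_add]
  map_update_smul' u i c x := by
    classical
    simp only [← Sum.update_elim_inr, AlternatingMap.map_update_smul]
  map_eq_zero_of_eq' u i j hij hne :=
    AlternatingMap.map_eq_zero_of_eq _ _ (i := Sum.inr i) (j := Sum.inr j) (by simpa using hij)
      (by simpa using hne)

/-- `detSum` with fixed arguments in the second group. -/
def detSumLeft (e : Module.Basis (Fin 7) ℝ E7) {k l : ℕ} (h : k + l = 7) (u : Fin l → E7) :
    E7 [⋀^Fin k]→ₗ[ℝ] ℝ where
  toFun w := detSum e h (Sum.elim w u)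
  map_update_add' w i x y := by
    classical
    simp only [← Sum.update_elim_inl, AlternatingMap.map_update_add]
  map_update_smul' w i c x := by
    classical
    simp only [← Sum.update_elim_inl, AlternatingMap.map_update_smul]
  map_eq_zero_of_eq' w i j hij hne :=
    AlternatingMap.map_eq_zero_of_eq _ _ (i := Sum.inl i) (j := Sum.inl j) (by simpa using hij)
      (by simpa using hne)

theorem alternating_sum_apply {ι : Type*} {l : ℕ} (s : Finset ι) (f : ι → E7 [⋀^Fin l]→ₗ[ℝ] ℝ)
    (u : Fin l → E7) : (∑ i ∈ s, f i) u = ∑ i ∈ s, f i u := by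
  classical
  induction s using Finset.induction_on with
  | empty => simp
  | insert a s ha ih => simp [ha, ih]

theorem sum_dualForm_eq {l : ℕ} (e : Module.Basis (Fin 7) ℝ E7) (f : E7 [⋀^Fin l]→ₗ[ℝ] ℝ)
    (u : Fin l → E7) : ∑ J ∈ increasing l, f (e ∘ J) * dualForm e J u = f u := by
  have key : ∑ J ∈ increasing l, f (e ∘ J) • (dualForm e J).toAlternatingMap = f := by
    refine alternating_ext_increasing e fun I hI => ?_
    rw [alternating_sum_apply, Finset.sum_eq_single I]
    · have := dualForm_basis_of_strictMono e hI hI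
      simp [this]
    · intro J hJ hne
      have := dualForm_basis_of_strictMono e (mem_increasing.1 hJ) hI
      simp [this, hne.symm]
    · intro h
      exact absurd (mem_increasing.2 hI) h
  conv_rhs => rw [← key]
  simp [alternating_sum_apply]

/-- This form of the star is a full contraction of β with the volume form, so that its behaviour
under SO(7) follows from `sum_mul_of_orthogonal`. -/
theorem starE_apply (e : Module.Basis (Fin 7) ℝ E7) {k l : ℕ} (h : k + l = 7) (β : Alt k)
    (u : Fin l → E7) :
    (Nat.factorial k : ℝ) * starE e h β u = ∑ I, β (e ∘ I) * detSum e h (Sum.elim (e ∘ I) u) := by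
  rw [sum_eq_factorial_mul_sum_increasing]
  · congr 1
    simp only [starE, ContinuousAlternatingMap.sum_apply, ContinuousAlternatingMap.smul_apply,
      smul_eq_mul]
    refine Finset.sum_congr rfl fun I _ => ?_
    have := sum_dualForm_eq e (detSumRight e h (e ∘ I)) u
    rw [show detSum e h (Sum.elim (e ∘ I) u) = detSumRight e h (e ∘ I) u from rfl, ← this,
      Finset.mul_sum]
    refine Finset.sum_congr rfl fun J _ => ?_
    rw [epsilon_eq_detSum e]
    change _ = _ * (detSum e h (Sum.elim (e ∘ I) (e ∘ J)) * _)
    ring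
  -- Both factors change by the sign of σ, so the product is symmetric.
  · intro I σ
    have h1 := β.toAlternatingMap.map_perm (e ∘ I) σ
    have h2 := (detSumLeft e h u).map_perm (e ∘ I) σ
    have h1' : β ((e ∘ I) ∘ σ) = Equiv.Perm.sign σ • β (e ∘ I) := h1
    have hF : ∀ w, detSum e h (Sum.elim w u) = detSumLeft e h u w := fun _ => rfl
    beta_reduce
    rw [hF, hF, ← Function.comp_assoc, h2, h1']
    rcases Int.units_eq_one_or (Equiv.Perm.sign σ) with h | h <;> simp [h]
  · intro I hI
    have : β (e ∘ I) = 0 := β.toAlternatingMap.map_eq_zero_of_not_injective _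
      fun h => hI h.of_comp
    rw [this, zero_mul]

theorem SpecialOrthogonalRel.det_eq {e e' : Module.Basis (Fin 7) ℝ E7}
    (h : SpecialOrthogonalRel e e') : e'.det = e.det := by
  have := AlternatingMap.eq_smul_basis_det e' e.det
  rw [e.det_apply, h.2, one_smul] at this
  exact this.symm

theorem SpecialOrthogonalRel.starE_eq {e e' : Module.Basis (Fin 7) ℝ E7}
    (h : SpecialOrthogonalRel e e') {k l : ℕ} (hkl : k + l = 7) (β : Alt k) :
    starE e' hkl β = starE e hkl β := by
  ext u
  have hk : (Nat.factorial k : ℝ) ≠ 0 := by positivity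
  apply mul_left_cancel₀ hk
  rw [starE_apply, starE_apply]
  have hd : detSum e' hkl = detSum e hkl := by rw [detSum, detSum, h.det_eq]
  rw [hd]
  exact sum_mul_of_orthogonal β.toMultilinearMap (detSumLeft e hkl u).toMultilinearMap h.1

/-- `|τ|²` for a 2-form `τ`, in the inner product for which `e` is orthonormal. -/
def normSqE (e : Module.Basis (Fin 7) ℝ E7) (τ : Alt 2) : ℝ :=
  ∑ I ∈ increasing 2, (τ (e ∘ I)) ^ 2

theorem SpecialOrthogonalRel.normSqE_eq {e e' : Module.Basis (Fin 7) ℝ E7}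
    (h : SpecialOrthogonalRel e e') (τ : Alt 2) : normSqE e' τ = normSqE e τ := by
  have h1 : ∀ e : Module.Basis (Fin 7) ℝ E7,
      (Nat.factorial 2 : ℝ) * normSqE e τ = ∑ I : Fin 2 → Fin 7, τ (e ∘ I) * τ (e ∘ I) := by
    intro e
    rw [normSqE, ← sum_eq_factorial_mul_sum_increasing]
    · simp_rw [sq]
    · intro I σ
      have h1 := τ.toAlternatingMap.map_perm (e ∘ I) σ
      change τ.toAlternatingMap ((e ∘ I) ∘ σ) ^ 2 = τ.toAlternatingMap (e ∘ I) ^ 2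
      rw [h1]
      rcases Int.units_eq_one_or (Equiv.Perm.sign σ) with h | h <;> simp [h]
    · intro I hI
      have : τ (e ∘ I) = 0 := τ.toAlternatingMap.map_eq_zero_of_not_injective _
        fun h => hI h.of_comp
      rw [this, sq, zero_mul]
  have hk : (Nat.factorial 2 : ℝ) ≠ 0 := by positivity
  apply mul_left_cancel₀ hk
  rw [h1, h1]
  exact sum_mul_of_orthogonal τ.toMultilinearMap τ.toMultilinearMap h.1

/-- The inner product for which `e` is orthonormal. -/
def innerE (e : Module.Basis (Fin 7) ℝ E7) : Ten 2 :=
  ∑ a : Fin 7, (ContinuousMultilinearMap.mkPiAlgebra ℝ (Fin 2) ℝ).compContinuousLinearMap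
    fun _ => LinearMap.toContinuousLinearMap (e.coord a)

theorem innerE_apply (e : Module.Basis (Fin 7) ℝ E7) (u : Fin 2 → E7) :
    innerE e u = ∑ a, e.repr (u 0) a * e.repr (u 1) a := by
  simp [innerE, sum_apply, Fin.prod_univ_two]

theorem SpecialOrthogonalRel.innerE_eq {e e' : Module.Basis (Fin 7) ℝ E7}
    (h : SpecialOrthogonalRel e e') : innerE e' = innerE e := by
  ext u
  have hr : ∀ (x : E7) (a : Fin 7), e.repr x a = ∑ b, e.toMatrix e' a b * e'.repr x b := by
    intro x a
    have := congrFun (e'.toMatrix_mulVec_repr e x) a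
    rw [← this, Matrix.mulVec, dotProduct]
  set Q := e.toMatrix e' with hQ
  have h2 : ∀ a b, ∑ j, Q j a * Q j b = if a = b then 1 else 0 := by
    intro a b
    have := congrFun (congrFun (mul_eq_one_comm.1 h.1 : Qᵀ * Q = 1) a) b
    simpa [Matrix.mul_apply, Matrix.one_apply] using this
  rw [innerE_apply, innerE_apply]
  simp_rw [hr, Finset.sum_mul_sum]
  rw [Finset.sum_comm]
  refine Finset.sum_congr rfl fun a _ => ?_
  rw [Finset.sum_comm]
  have : ∀ c, ∑ b, Q b a * e'.repr (u 0) a * (Q b c * e'.repr (u 1) c) =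
      (if a = c then 1 else 0) * (e'.repr (u 0) a * e'.repr (u 1) c) := by
    intro c
    rw [← h2 a c, Finset.sum_mul]
    exact Finset.sum_congr rfl fun b _ => by ring
  simp [this]

/-! ### Products of multilinear maps and alternating sums -/

theorem update_castAdd {k l : ℕ} (w : Fin (k + l) → E7) (i : Fin k) (z : E7) :
    (fun j => Function.update w (Fin.castAdd l i) z (Fin.castAdd l j)) =
        Function.update (fun j => w (Fin.castAdd l j)) i z ∧
      (fun j => Function.update w (Fin.castAdd l i) z (Fin.natAdd k j)) =
        fun j => w (Fin.natAdd k j) := by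
  constructor
  · ext1 j
    by_cases h : j = i <;> simp [Function.update, h]
  · ext1 j
    have : (Fin.natAdd k j) ≠ Fin.castAdd l i := by simp [Fin.ext_iff]; omega
    rw [Function.update_of_ne this]

theorem update_natAdd {k l : ℕ} (w : Fin (k + l) → E7) (i : Fin l) (z : E7) :
    (fun j => Function.update w (Fin.natAdd k i) z (Fin.castAdd l j)) =
        (fun j => w (Fin.castAdd l j)) ∧
      (fun j => Function.update w (Fin.natAdd k i) z (Fin.natAdd k j)) =
        Function.update (fun j => w (Fin.natAdd k j)) i z := by
  constructor
  · ext1 j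
    have : (Fin.castAdd l j) ≠ Fin.natAdd k i := by simp [Fin.ext_iff]; omega
    rw [Function.update_of_ne this]
  · ext1 j
    by_cases h : j = i <;> simp [Function.update, h]

/-- The product of two multilinear maps in separate groups of variables. -/
def mulMultilinear {k l : ℕ} (f : MultilinearMap ℝ (fun _ : Fin k => E7) ℝ)
    (g : MultilinearMap ℝ (fun _ : Fin l => E7) ℝ) :
    MultilinearMap ℝ (fun _ : Fin (k + l) => E7) ℝ :=
  MultilinearMap.mk' (fun w => f (fun i => w (Fin.castAdd l i)) * g (fun i => w (Fin.natAdd k i)))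
    (by
      intro w i x y
      induction i using Fin.addCases with
      | left i =>
        simp only [(update_castAdd w i _).1, (update_castAdd w i _).2, f.map_update_add, add_mul]
      | right i =>
        simp only [(update_natAdd w i _).1, (update_natAdd w i _).2, g.map_update_add, mul_add])
    (by
      intro w i c x
      induction i using Fin.addCases with
      | left i =>
        simp only [(update_castAdd w i _).1, (update_castAdd w i _).2, f.map_update_smul,
          smul_eq_mul, mul_assoc]
      | right i =>
        simp only [(update_natAdd w i _).1, (update_natAdd w i _).2, g.map_update_smul,
          smul_eq_mul, mul_left_comm])

/-- The left side is the alternatization of t written in a basis; the right side shows that it does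
not depend on the basis. -/
theorem sum_mul_dualForm {l : ℕ} (e : Module.Basis (Fin 7) ℝ E7)
    (t : MultilinearMap ℝ (fun _ : Fin l => E7) ℝ) (u : Fin l → E7) :
    ∑ J : Fin l → Fin 7, t (e ∘ J) * dualForm e J u =
      ∑ σ : Equiv.Perm (Fin l), (Equiv.Perm.sign σ : ℝ) * t (u ∘ σ) := by
  have hexp : ∀ σ : Equiv.Perm (Fin l), t (u ∘ σ) =
      ∑ J : Fin l → Fin 7, (∏ b, e.repr (u (σ b)) (J b)) * t (e ∘ J) := by
    intro σ
    have h1 : u ∘ σ = fun b => ∑ i, e.repr (u (σ b)) i • e i := by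
      ext1 b
      simp [e.sum_repr]
    rw [h1, t.map_sum]
    refine Finset.sum_congr rfl fun I _ => ?_
    rw [t.map_smul_univ]
    rfl
  simp_rw [hexp, Finset.mul_sum]
  rw [Finset.sum_comm]
  refine Finset.sum_congr rfl fun J _ => ?_
  rw [dualForm_apply, Matrix.det_apply, Finset.mul_sum]
  refine Finset.sum_congr rfl fun σ _ => ?_
  simp only [Matrix.of_apply, Units.smul_def, zsmul_eq_mul]
  ring

/-- The basis e no longer occurs on the right, which makes τ ∧ τ natural under linear isomorphisms.
-/
theorem wedgeSq_apply (e : Module.Basis (Fin 7) ℝ E7) (τ : Alt 2) (u : Fin 4 → E7) :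
    wedgeSq e τ u = (1 / 4 : ℝ) * ∑ σ : Equiv.Perm (Fin 4), (Equiv.Perm.sign σ : ℝ) *
      (τ ![u (σ 0), u (σ 1)] * τ ![u (σ 2), u (σ 3)]) := by
  have ht : ∀ w : Fin 4 → E7, τ ![w 0, w 1] * τ ![w 2, w 3] =
      mulMultilinear (k := 2) (l := 2) τ.toMultilinearMap τ.toMultilinearMap w := by
    intro w
    change _ = τ _ * τ _
    congr 2 <;> ext1 i <;> fin_cases i <;> rfl
  have h2 : ∀ σ : Equiv.Perm (Fin 4), τ ![u (σ 0), u (σ 1)] * τ ![u (σ 2), u (σ 3)] =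
      mulMultilinear (k := 2) (l := 2) τ.toMultilinearMap τ.toMultilinearMap (u ∘ σ) :=
    fun σ => ht (u ∘ σ)
  have h1 : wedgeSq e τ u = (1 / 4 : ℝ) *
      ∑ J : Fin 4 → Fin 7, mulMultilinear (k := 2) (l := 2) τ.toMultilinearMap τ.toMultilinearMap
        (e ∘ J) * dualForm e J u := by
    rw [wedgeSq]
    simp only [sum_fin_succ_fun, sum_fin_zero_fun, ContinuousAlternatingMap.smul_apply,
      ContinuousAlternatingMap.sum_apply, smul_eq_mul, ← ht]
    rfl
  rw [h1, sum_mul_dualForm]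
  simp only [h2]

/-! ### The stabilizer of a positive 3-form is contained in `SO(7)` -/

/-- The index `c` for which `φ_abc ≠ 0`, for `a ≠ b` and the canonical form `φ`. -/
def crossIndex : Fin 7 → Fin 7 → Fin 7 :=
  ![![0, 6, 4, 5, 2, 3, 1], ![6, 0, 5, 4, 3, 2, 0], ![4, 5, 0, 6, 0, 1, 3], ![5, 4, 6, 0, 1, 0, 2],
    ![2, 3, 0, 1, 0, 6, 5], ![3, 2, 1, 0, 6, 0, 4], ![1, 0, 3, 2, 5, 4, 0]]

/-- The value of the nonzero component `φ_abc` of the canonical form `φ`. -/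
def crossSign : Fin 7 → Fin 7 → ℤ :=
  ![![0, 1, 1, -1, -1, 1, -1], ![-1, 0, -1, -1, 1, 1, 1], ![-1, 1, 0, 1, 1, -1, -1],
    ![1, 1, -1, 0, -1, -1, 1], ![1, -1, -1, 1, 0, 1, -1], ![-1, -1, 1, 1, -1, 0, 1],
    ![1, -1, 1, -1, 1, -1, 0]]

/-- The components of the canonical form. -/
def phiCoeff (i a b : Fin 7) : ℤ := if b = crossIndex i a then crossSign i a else 0

/-- The Kronecker symbol. -/
def kron (i j : Fin 7) : ℤ := if i = j then 1 else 0

/-- The components of `e^J` for a triple `J`. -/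
def triple (J : Fin 3 → Fin 7) (i a b : Fin 7) : ℤ :=
  kron i (J 0) * kron a (J 1) * kron b (J 2) - kron i (J 0) * kron a (J 2) * kron b (J 1)
  - kron i (J 1) * kron a (J 0) * kron b (J 2) + kron i (J 1) * kron a (J 2) * kron b (J 0)
  + kron i (J 2) * kron a (J 0) * kron b (J 1) - kron i (J 2) * kron a (J 1) * kron b (J 0)

theorem comp_vec3 (e : Module.Basis (Fin 7) ℝ E7) (i a b : Fin 7) :
    e ∘ ![i, a, b] = ![e i, e a, e b] := by
  ext1 j
  fin_cases j <;> rfl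

theorem dualForm_comp_three (e : Module.Basis (Fin 7) ℝ E7) (J I : Fin 3 → Fin 7) :
    dualForm e J (e ∘ I) = (triple J (I 0) (I 1) (I 2) : ℝ) := by
  rw [dualForm_basis, Matrix.det_fin_three]
  simp only [Matrix.of_apply, triple, Int.cast_add, Int.cast_sub, Int.cast_mul, kron, Int.cast_ite,
    Int.cast_one, Int.cast_zero]

theorem dualForm_triple (e : Module.Basis (Fin 7) ℝ E7) (J : Fin 3 → Fin 7) (i a b : Fin 7) :
    dualForm e J ![e i, e a, e b] = (triple J i a b : ℝ) := by
  rw [← comp_vec3]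
  exact dualForm_comp_three e J ![i, a, b]

theorem phiCan_basis (e : Module.Basis (Fin 7) ℝ E7) (i a b : Fin 7) :
    phiCan e ![e i, e a, e b] = (phiCoeff i a b : ℝ) := by
  have h : ∀ i a b : Fin 7, triple ![0, 1, 6] i a b + triple ![2, 3, 6] i a b
      + triple ![4, 5, 6] i a b + triple ![0, 2, 4] i a b - triple ![0, 3, 5] i a b
      - triple ![1, 2, 5] i a b - triple ![1, 3, 4] i a b = phiCoeff i a b := by
    decide +kernel
  rw [← h]
  simp [phiCan, dualForm_triple]

/-- The Vandermonde determinant of σ is a computable multiple of its sign, with factor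
1!·2!·3!·4!·5!·6! = 24883200. Unlike the sign it is a polynomial in the values, and it vanishes on
tuples that are not injective. -/
theorem det_vandermonde_comp (σ : Equiv.Perm (Fin 7)) :
    (Matrix.vandermonde fun a => ((σ a : ℕ) : ℤ)).det = (Equiv.Perm.sign σ : ℤ) * 24883200 := by
  have h := Matrix.det_permute σ (Matrix.vandermonde fun a : Fin 7 => ((a : ℕ) : ℤ))
  have h1 : (Matrix.vandermonde fun a : Fin 7 => ((a : ℕ) : ℤ)).det = 24883200 := by
    rw [Matrix.det_vandermonde]
    decide +kernel
  rw [h1] at h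
  rw [← Int.cast_id (n := (Equiv.Perm.sign σ : ℤ)), ← h]
  rfl

/-- A product which is evaluated only if its first factor is not zero. -/
def lazyMul (x y : ℤ) : ℤ := if x = 0 then 0 else x * y

theorem lazyMul_eq (x y : ℤ) : lazyMul x y = x * y := by
  unfold lazyMul
  split_ifs with h <;> simp [h]

/-- The factors that involve only the first four entries stand in front, so that most tuples are
discarded before the remaining factors are evaluated. -/
theorem det_vandermonde_vec7 (a b c d m n p : Fin 7) :
    (Matrix.vandermonde fun i => ((![a, b, c, d, m, n, p] i : ℕ) : ℤ)).det =
      lazyMul (c - a) (lazyMul (d - a) (lazyMul (c - b) (lazyMul (d - b) (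
        ((b : ℤ) - a) * (d - c) * ((m - a) * (m - b) * (m - c) * (m - d)) *
        ((n - a) * (n - b) * (n - c) * (n - d) * (n - m)) *
        ((p - a) * (p - b) * (p - c) * (p - d) * (p - m) * (p - n)))))) := by
  rw [Matrix.det_vandermonde]
  simp only [Fin.prod_univ_succ, Fin.prod_Ioi_zero, Fin.prod_Ioi_succ, lazyMul_eq]
  simp
  -- Treating the 21 differences as atoms keeps `ring` from expanding a polynomial of degree 21.
  generalize (((b : ℕ) : ℤ) : ℤ) - ((a : ℕ) : ℤ) = x0
  generalize (((c : ℕ) : ℤ) : ℤ) - ((a : ℕ) : ℤ) = x1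
  generalize (((d : ℕ) : ℤ) : ℤ) - ((a : ℕ) : ℤ) = x2
  generalize (((m : ℕ) : ℤ) : ℤ) - ((a : ℕ) : ℤ) = x3
  generalize (((n : ℕ) : ℤ) : ℤ) - ((a : ℕ) : ℤ) = x4
  generalize (((p : ℕ) : ℤ) : ℤ) - ((a : ℕ) : ℤ) = x5
  generalize (((c : ℕ) : ℤ) : ℤ) - ((b : ℕ) : ℤ) = x6
  generalize (((d : ℕ) : ℤ) : ℤ) - ((b : ℕ) : ℤ) = x7
  generalize (((m : ℕ) : ℤ) : ℤ) - ((b : ℕ) : ℤ) = x8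
  generalize (((n : ℕ) : ℤ) : ℤ) - ((b : ℕ) : ℤ) = x9
  generalize (((p : ℕ) : ℤ) : ℤ) - ((b : ℕ) : ℤ) = x10
  generalize (((d : ℕ) : ℤ) : ℤ) - ((c : ℕ) : ℤ) = x11
  generalize (((m : ℕ) : ℤ) : ℤ) - ((c : ℕ) : ℤ) = x12
  generalize (((n : ℕ) : ℤ) : ℤ) - ((c : ℕ) : ℤ) = x13
  generalize (((p : ℕ) : ℤ) : ℤ) - ((c : ℕ) : ℤ) = x14
  generalize (((m : ℕ) : ℤ) : ℤ) - ((d : ℕ) : ℤ) = x15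
  generalize (((n : ℕ) : ℤ) : ℤ) - ((d : ℕ) : ℤ) = x16
  generalize (((p : ℕ) : ℤ) : ℤ) - ((d : ℕ) : ℤ) = x17
  generalize (((n : ℕ) : ℤ) : ℤ) - ((m : ℕ) : ℤ) = x18
  generalize (((p : ℕ) : ℤ) : ℤ) - ((m : ℕ) : ℤ) = x19
  generalize (((p : ℕ) : ℤ) : ℤ) - ((n : ℕ) : ℤ) = x20
  ring

/-- The alternating 7-form `ι_u φ ∧ ι_v φ ∧ φ`, up to a factor. -/
def bryantForm (φ : Alt 3) (u v : E7) : E7 [⋀^Fin 7]→ₗ[ℝ] ℝ :=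
  MultilinearMap.alternatization (mulMultilinear (k := 4) (l := 3)
    (mulMultilinear (k := 2) (l := 2) (φ.toMultilinearMap.curryLeft u)
      (φ.toMultilinearMap.curryLeft v)) φ.toMultilinearMap)

theorem bryantForm_apply (φ : Alt 3) (u v : E7) (w : Fin 7 → E7) :
    bryantForm φ u v w = ∑ σ : Equiv.Perm (Fin 7), (Equiv.Perm.sign σ : ℝ) *
      (φ ![u, w (σ 0), w (σ 1)] * φ ![v, w (σ 2), w (σ 3)] *
        φ ![w (σ 4), w (σ 5), w (σ 6)]) := by
  rw [bryantForm, MultilinearMap.alternatization_apply]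
  refine Finset.sum_congr rfl fun σ _ => ?_
  rw [Units.smul_def, zsmul_eq_mul]
  congr 1
  change φ _ * φ _ * φ _ = _
  congr 2
  · congr 1
    congr 1
    ext1 i; fin_cases i <;> rfl
  · congr 1
    ext1 i; fin_cases i <;> rfl
  · ext1 i; fin_cases i <;> rfl

/-- A sum over permutations becomes an unrestricted sum over tuples, which can be nested and
contracted index by index. -/
theorem sum_perm_eq (F : (Fin 7 → Fin 7) → ℤ) :
    24883200 * ∑ σ : Equiv.Perm (Fin 7), (Equiv.Perm.sign σ : ℤ) * F σ =
      ∑ J : Fin 7 → Fin 7, (Matrix.vandermonde fun i => ((J i : ℕ) : ℤ)).det * F J := by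
  rw [Finset.mul_sum]
  refine Finset.sum_of_injOn (fun σ : Equiv.Perm (Fin 7) => (σ : Fin 7 → Fin 7))
    (fun σ _ σ' _ h => Equiv.coe_fn_injective h) (fun _ _ => Finset.mem_coe.2 (Finset.mem_univ _))
    ?_ ?_
  · intro J _ hJ
    have : ¬ Function.Injective J := fun h =>
      hJ ⟨Equiv.ofBijective J (Finite.injective_iff_bijective.1 h), by simp, rfl⟩
    simp only [Function.Injective, not_forall] at this
    obtain ⟨a, b, hab, hne⟩ := this
    rw [Matrix.det_zero_of_row_eq hne (by ext j; simp [Matrix.vandermonde, hab]), zero_mul]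
  · intro σ _
    rw [det_vandermonde_comp]
    ring

/-- Two indices of φ determine the third, so each factor of φ removes one summation. -/
theorem sum_crossIndex (i : Fin 7) (F : Fin 7 → Fin 7 → ℤ) :
    ∑ a, ∑ b, phiCoeff i a b * F a b = ∑ a, crossSign i a * F a (crossIndex i a) := by
  simp [phiCoeff, ite_mul]

/-- `∑ φ_iab φ_jcd φ_mnp ε(abcdmnp)`, up to a factor. -/
def bryantSum (i j : Fin 7) : ℤ :=
  ∑ a, lazyMul (crossSign i a) (∑ c, lazyMul (crossSign j c)
    (let b := crossIndex i a
     let d := crossIndex j c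
     lazyMul (c - a) (lazyMul (d - a) (lazyMul (c - b) (lazyMul (d - b)
      (∑ m : Fin 7, lazyMul ((m - a) * (m - b)) (lazyMul ((m - c) * (m - d))
        (∑ n : Fin 7, lazyMul (crossSign m n) (lazyMul ((n - a) * (n - b) * (n - c) * (n - d))
          (let p := crossIndex m n
          ((b : ℤ) - a) * (d - c) * (n - m) *
            ((p - a) * (p - b) * (p - c) * (p - d) * (p - m) * (p - n))))))))))))

/-- Here 144 = 6·(2!·2!·3!): the 6 is the constant in Bryant's identity, and the factorials come
from summing over all permutations instead of shuffles. -/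
theorem bryantSum_eq (i j : Fin 7) : bryantSum i j = if i = j then 144 * 24883200 else 0 := by
  revert i j
  decide +kernel

theorem bryantSum_eq_sum (i j : Fin 7) :
    ∑ J : Fin 7 → Fin 7, (Matrix.vandermonde fun i => ((J i : ℕ) : ℤ)).det *
      (phiCoeff i (J 0) (J 1) * phiCoeff j (J 2) (J 3) * phiCoeff (J 4) (J 5) (J 6)) =
      bryantSum i j := by
  simp only [sum_fin_succ_fun, sum_fin_zero_fun, Matrix.cons_val, det_vandermonde_vec7]
  have h : ∀ (x y z w : ℤ), w * (x * y * z) = x * (y * (z * w)) := by intros; ring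
  simp only [h, ← Finset.mul_sum, sum_crossIndex]
  rw [bryantSum]
  simp only [lazyMul_eq]
  refine Finset.sum_congr rfl fun a _ => congrArg _ (Finset.sum_congr rfl fun c _ => congrArg _ ?_)
  simp only [Finset.mul_sum]
  refine Finset.sum_congr rfl fun m _ => ?_
  refine Finset.sum_congr rfl fun n _ => ?_
  generalize ((crossIndex m n : ℕ) : ℤ) = p
  generalize ((crossIndex i a : ℕ) : ℤ) = b
  generalize ((crossIndex j c : ℕ) : ℤ) = d
  generalize b - ((a : ℕ) : ℤ) = x0
  generalize ((c : ℕ) : ℤ) - ((a : ℕ) : ℤ) = x1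
  generalize d - ((a : ℕ) : ℤ) = x2
  generalize ((m : ℕ) : ℤ) - ((a : ℕ) : ℤ) = x3
  generalize ((n : ℕ) : ℤ) - ((a : ℕ) : ℤ) = x4
  generalize p - ((a : ℕ) : ℤ) = x5
  generalize ((c : ℕ) : ℤ) - b = x6
  generalize d - b = x7
  generalize ((m : ℕ) : ℤ) - b = x8
  generalize ((n : ℕ) : ℤ) - b = x9
  generalize p - b = x10
  generalize d - ((c : ℕ) : ℤ) = x11
  generalize ((m : ℕ) : ℤ) - ((c : ℕ) : ℤ) = x12
  generalize ((n : ℕ) : ℤ) - ((c : ℕ) : ℤ) = x13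
  generalize p - ((c : ℕ) : ℤ) = x14
  generalize ((m : ℕ) : ℤ) - d = x15
  generalize ((n : ℕ) : ℤ) - d = x16
  generalize p - d = x17
  generalize ((n : ℕ) : ℤ) - ((m : ℕ) : ℤ) = x18
  generalize p - ((m : ℕ) : ℤ) = x19
  generalize p - ((n : ℕ) : ℤ) = x20
  ring

theorem bryantForm_basis {φ : Alt 3} {e : Module.Basis (Fin 7) ℝ E7} (h : φ = phiCan e)
    (i j : Fin 7) : bryantForm φ (e i) (e j) e = if i = j then 144 else 0 := by
  rw [bryantForm_apply, h]
  simp only [phiCan_basis]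
  have h1 := (sum_perm_eq fun J =>
    phiCoeff i (J 0) (J 1) * phiCoeff j (J 2) (J 3) * phiCoeff (J 4) (J 5) (J 6)).trans
      ((bryantSum_eq_sum i j).trans (bryantSum_eq i j))
  have h2 := congrArg (Int.cast : ℤ → ℝ) h1
  push_cast at h2
  split_ifs at h2 ⊢ with hij <;> linarith

theorem bryantForm_sum (φ : Alt 3) (e : Module.Basis (Fin 7) ℝ E7) (u v : Fin 7 → ℝ)
    (w : Fin 7 → E7) :
    bryantForm φ (∑ a, u a • e a) (∑ a, v a • e a) w =
      ∑ a, ∑ b, u a * v b * bryantForm φ (e a) (e b) w := by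
  have hφ : ∀ (u : Fin 7 → ℝ) (x y : E7), φ ![∑ a, u a • e a, x, y] =
      ∑ a, u a * φ ![e a, x, y] := by
    intro u x y
    have h1 : ∀ z, φ ![z, x, y] = φ.toMultilinearMap.curryLeft z ![x, y] := fun _ => rfl
    simp only [h1, map_sum, map_smul, sum_apply, smul_apply,
      smul_eq_mul]
  simp only [bryantForm_apply, hφ, Finset.mul_sum, Finset.sum_mul]
  have h2 : ∀ a, ∑ b, ∑ σ : Equiv.Perm (Fin 7), u a * v b * ((Equiv.Perm.sign σ : ℝ) *
      (φ ![e a, w (σ 0), w (σ 1)] * φ ![e b, w (σ 2), w (σ 3)] *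
        φ ![w (σ 4), w (σ 5), w (σ 6)])) = ∑ σ : Equiv.Perm (Fin 7), ∑ b, u a * v b *
      ((Equiv.Perm.sign σ : ℝ) * (φ ![e a, w (σ 0), w (σ 1)] * φ ![e b, w (σ 2), w (σ 3)] *
        φ ![w (σ 4), w (σ 5), w (σ 6)])) := fun a => Finset.sum_comm
  simp only [h2]
  rw [Finset.sum_comm (γ := Fin 7)]
  refine Finset.sum_congr rfl fun σ _ => ?_
  rw [Finset.sum_comm]
  refine Finset.sum_congr rfl fun a _ => Finset.sum_congr rfl fun b _ => ?_
  ring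

/-- The 7-forms are a line, spanned by the determinant. -/
theorem alternating_change_basis (e e' : Module.Basis (Fin 7) ℝ E7)
    (f : E7 [⋀^Fin 7]→ₗ[ℝ] ℝ) : f e' = f e * (e.toMatrix e').det := by
  conv_lhs => rw [AlternatingMap.eq_smul_basis_det e f]
  rw [AlternatingMap.smul_apply, e.det_apply, smul_eq_mul]

theorem bryantForm_repr (φ : Alt 3) (e : Module.Basis (Fin 7) ℝ E7) (x y : E7)
    (w : Fin 7 → E7) : bryantForm φ x y w =
      ∑ a, ∑ b, e.repr x a * e.repr y b * bryantForm φ (e a) (e b) w := by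
  have h : ∀ x : E7, ∃ u : Fin 7 → ℝ, ∑ a, u a • e a = x ∧ ∀ a, e.repr x a = u a :=
    fun x => ⟨fun a => e.repr x a, e.sum_repr x, fun _ => rfl⟩
  obtain ⟨u, hu, hu'⟩ := h x
  obtain ⟨v, hv, hv'⟩ := h y
  simp only [hu', hv']
  rw [← bryantForm_sum, hu, hv]

theorem bryantForm_eq_sum (e e' : Module.Basis (Fin 7) ℝ E7) (i j : Fin 7) :
    bryantForm (phiCan e) (e' i) (e' j) e =
      ∑ a, e.toMatrix e' a i * e.toMatrix e' a j * 144 := by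
  rw [bryantForm_repr (phiCan e) e]
  refine Finset.sum_congr rfl fun a _ => ?_
  rw [Finset.sum_eq_single a]
  · refine congrArg (fun t => _ * t) ((bryantForm_basis rfl a a).trans ?_)
    rw [if_pos rfl]
  · intro b _ hb
    rw [(bryantForm_basis rfl a b).trans (if_neg hb.symm), mul_zero]
  · intro h
    exact absurd (Finset.mem_univ a) h

/-- Bryant's form of the common 3-form is evaluated on e' in two ways: directly, since e' is
adapted, and by passing from e' to e in its seven alternating arguments, which costs the
determinant. -/
theorem det_mul_gram_eq {e e' : Module.Basis (Fin 7) ℝ E7} (h : phiCan e = phiCan e')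
    (i j : Fin 7) : (if i = j then (144 : ℝ) else 0) =
      (∑ a, e.toMatrix e' a i * e.toMatrix e' a j * 144) * (e.toMatrix e').det := by
  have h1 := bryantForm_basis (φ := phiCan e) h i j
  have h2 := alternating_change_basis e e' (bryantForm (phiCan e) (e' i) (e' j))
  have h3 := bryantForm_eq_sum e e' i j
  exact h1.symm.trans (h2.trans (congrArg (fun t => t * (e.toMatrix e').det) h3))

/-- With Q the transition matrix, Bryant's identity gives det(Q)·QᵀQ = 1. Taking determinants fixes
det Q, after which Q is orthogonal. -/
theorem specialOrthogonalRel_of_phiCan_eq {e e' : Module.Basis (Fin 7) ℝ E7}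
    (h : phiCan e = phiCan e') : SpecialOrthogonalRel e e' := by
  set Q := e.toMatrix e' with hQ
  have h1 : ∀ i j, (if i = j then (1 : ℝ) else 0) = Q.det * ∑ a, Q a i * Q a j := by
    intro i j
    have h2 := det_mul_gram_eq h i j
    rw [← Finset.sum_mul] at h2
    split_ifs at h2 ⊢ with hij <;> linarith
  have h4 : Q.det • (Qᵀ * Q) = 1 := by
    ext i j
    simp [Matrix.mul_apply, Matrix.one_apply, h1]
  -- The exponent is 7 + 2: a scalar factor in dimension seven, and the two copies of Q. As 9 is
  -- odd, the real number det Q is 1.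
  have h5 : Q.det ^ 9 = 1 := by
    have := congrArg Matrix.det h4
    rw [Matrix.det_smul, Matrix.det_mul, Matrix.det_transpose, Matrix.det_one] at this
    simp at this
    linarith
  have h6 : Q.det = 1 := by
    rcases (pow_eq_one_iff_of_ne_zero (by norm_num)).1 h5 with h | h
    · exact h
    · exact absurd h.2 (by decide)
  rw [h6, one_smul] at h4
  exact ⟨mul_eq_one_comm.1 h4, h6⟩

/-! ### The metric, the Hodge star and the orientation of a positive 3-form -/

/-- The 3-form `e^123 + e^145 + e^167 + e^246 - e^257 - e^347 - e^356`. -/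
def phiBry (e : Module.Basis (Fin 7) ℝ E7) : Alt 3 :=
  dualForm e ![0, 1, 2] + dualForm e ![0, 3, 4] + dualForm e ![0, 5, 6]
    + dualForm e ![1, 3, 5] - dualForm e ![1, 4, 6] - dualForm e ![2, 3, 6] - dualForm e ![2, 4, 5]

theorem dualForm_reindex {l : ℕ} (e : Module.Basis (Fin 7) ℝ E7) (σ : Fin 7 ≃ Fin 7)
    (J : Fin l → Fin 7) : dualForm (e.reindex σ) J = dualForm e (σ.symm ∘ J) := by
  ext u
  rw [dualForm_apply, dualForm_apply]
  simp [Module.Basis.repr_reindex, Finsupp.mapDomain_equiv_apply]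

theorem dualForm_rotate (e : Module.Basis (Fin 7) ℝ E7) (i j k : Fin 7) :
    dualForm e ![i, j, k] = dualForm e ![k, i, j] := by
  ext u
  rw [dualForm_apply, dualForm_apply, Matrix.det_fin_three, Matrix.det_fin_three]
  simp only [Matrix.of_apply, Matrix.cons_val]
  ring

/-- The two normal forms of a positive 3-form in use differ by the cyclic shift i ↦ i + 1 of the
indices. -/
theorem phiCan_reindex (e : Module.Basis (Fin 7) ℝ E7) :
    phiCan (e.reindex (finRotate 7).symm) = phiBry e := by
  have h : ∀ i j k : Fin 7, (finRotate 7).symm.symm ∘ ![i, j, k] = ![i + 1, j + 1, k + 1] := by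
    intro i j k
    ext1 a
    fin_cases a <;> simp
  simp only [phiCan, dualForm_reindex, h, phiBry]
  rw [dualForm_rotate e (0 + 1) (1 + 1) (6 + 1), dualForm_rotate e (2 + 1) (3 + 1) (6 + 1),
    dualForm_rotate e (4 + 1) (5 + 1) (6 + 1), show (0 : Fin 7) + 1 = 1 from rfl,
    show (1 : Fin 7) + 1 = 2 from rfl, show (2 : Fin 7) + 1 = 3 from rfl,
    show (3 : Fin 7) + 1 = 4 from rfl, show (4 : Fin 7) + 1 = 5 from rfl,
    show (5 : Fin 7) + 1 = 6 from rfl, show (6 : Fin 7) + 1 = 0 from rfl]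

theorem isPositive_phiBry (e : Module.Basis (Fin 7) ℝ E7) : IsPositive (phiBry e) :=
  ⟨_, (phiCan_reindex e).symm⟩

/-- A cycle of length seven is an even permutation, so the shift of indices keeps the orientation.
-/
theorem specialOrthogonalRel_rotate (e : Module.Basis (Fin 7) ℝ E7) :
    SpecialOrthogonalRel e (e.reindex (finRotate 7).symm) := by
  have h : e.toMatrix (e.reindex (finRotate 7).symm) =
      Matrix.of fun i j => if i = finRotate 7 j then 1 else 0 := by
    ext i j
    simp [Module.Basis.toMatrix_apply, Finsupp.single_apply, eq_comm]
  constructor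
  · rw [h]
    ext i j
    simp only [Matrix.mul_apply, Matrix.transpose_apply, Matrix.of_apply, Matrix.one_apply]
    rw [Equiv.sum_comp (finRotate 7) (fun k => (if i = k then (1 : ℝ) else 0) * if j = k then 1 else 0)]
    simp
  · rw [← e.det_apply]
    have h1 : ⇑(e.reindex (finRotate 7).symm) = e ∘ finRotate 7 := by
      ext1 j
      simp
    rw [h1, AlternatingMap.map_perm, e.det_self, sign_finRotate,
      show (-1 : ℤˣ) ^ 6 = 1 from rfl, one_smul]

section Adapted

variable {φ : Alt 3} {e : Module.Basis (Fin 7) ℝ E7}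

/-- The basis picked by `adaptedBasis` may thus be replaced by any explicit basis in which φ has its
normal form; the three lemmas below do this for the star, the metric and the norm. -/
theorem specialOrthogonalRel_adaptedBasis (h : φ = phiBry e) :
    SpecialOrthogonalRel (e.reindex (finRotate 7).symm) (adaptedBasis φ) := by
  have hp : IsPositive φ := h ▸ isPositive_phiBry e
  apply specialOrthogonalRel_of_phiCan_eq
  rw [phiCan_reindex, ← h, adaptedBasis, dif_pos hp]
  exact hp.choose_spec

theorem starOf_eq (h : φ = phiBry e) {k l : ℕ} (hkl : k + l = 7) (β : Alt k) :
    starOf φ hkl β = starE e hkl β :=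
  ((specialOrthogonalRel_adaptedBasis h).starE_eq hkl β).trans
    ((specialOrthogonalRel_rotate e).starE_eq hkl β)

theorem innerOf_eq (h : φ = phiBry e) : innerOf φ = innerE e :=
  (specialOrthogonalRel_adaptedBasis h).innerE_eq.trans (specialOrthogonalRel_rotate e).innerE_eq

theorem normSqTwo_eq (h : φ = phiBry e) (τ : Alt 2) : normSqTwo φ τ = normSqE e τ :=
  ((specialOrthogonalRel_adaptedBasis h).normSqE_eq τ).trans
    ((specialOrthogonalRel_rotate e).normSqE_eq τ)

end Adapted

/-! ### Change of variables -/

theorem dualForm_map {l : ℕ} (e : Module.Basis (Fin 7) ℝ E7) (A : E7 ≃L[ℝ] E7)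
    (J : Fin l → Fin 7) :
    dualForm (e.map A.symm.toLinearEquiv) J =
      (dualForm e J).compContinuousLinearMap (A : E7 →L[ℝ] E7) := by
  ext u
  rw [ContinuousAlternatingMap.compContinuousLinearMap_apply, dualForm_apply, dualForm_apply]
  rfl

theorem phiCan_map (e : Module.Basis (Fin 7) ℝ E7) (A : E7 ≃L[ℝ] E7) :
    phiCan (e.map A.symm.toLinearEquiv) =
      (phiCan e).compContinuousLinearMap (A : E7 →L[ℝ] E7) := by
  ext u
  simp only [phiCan, dualForm_map, ContinuousAlternatingMap.add_apply,
    ContinuousAlternatingMap.sub_apply, ContinuousAlternatingMap.compContinuousLinearMap_apply]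

theorem phiBry_map (e : Module.Basis (Fin 7) ℝ E7) (A : E7 ≃L[ℝ] E7) :
    phiBry (e.map A.symm.toLinearEquiv) =
      (phiBry e).compContinuousLinearMap (A : E7 →L[ℝ] E7) := by
  ext u
  simp only [phiBry, dualForm_map, ContinuousAlternatingMap.add_apply,
    ContinuousAlternatingMap.sub_apply, ContinuousAlternatingMap.compContinuousLinearMap_apply]

theorem exists_phiBry {φ : Alt 3} (h : IsPositive φ) :
    ∃ e : Module.Basis (Fin 7) ℝ E7, φ = phiBry e := by
  obtain ⟨e, rfl⟩ := h
  refine ⟨e.reindex (finRotate 7), ?_⟩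
  rw [← phiCan_reindex]
  congr 1
  ext1 i
  simp

theorem isPositive_comp {φ : Alt 3} (h : IsPositive φ) (A : E7 ≃L[ℝ] E7) :
    IsPositive (φ.compContinuousLinearMap (A : E7 →L[ℝ] E7)) := by
  obtain ⟨e, rfl⟩ := h
  exact ⟨_, (phiCan_map e A).symm⟩

theorem map_comp_comp {k : ℕ} (e : Module.Basis (Fin 7) ℝ E7) (A : E7 ≃L[ℝ] E7) (β : Alt k)
    (I : Fin k → Fin 7) :
    β.compContinuousLinearMap (A : E7 →L[ℝ] E7) (e.map A.symm.toLinearEquiv ∘ I) = β (e ∘ I) := by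
  rw [ContinuousAlternatingMap.compContinuousLinearMap_apply]
  congr 1
  ext1 i
  simp

theorem starE_map (e : Module.Basis (Fin 7) ℝ E7) (A : E7 ≃L[ℝ] E7) {k l : ℕ} (h : k + l = 7)
    (β : Alt k) : starE (e.map A.symm.toLinearEquiv) h
        (β.compContinuousLinearMap (A : E7 →L[ℝ] E7)) =
      (starE e h β).compContinuousLinearMap (A : E7 →L[ℝ] E7) := by
  simp only [starE, map_comp_comp]
  ext u
  simp only [dualForm_map, ContinuousAlternatingMap.sum_apply,
    ContinuousAlternatingMap.smul_apply,
    ContinuousAlternatingMap.compContinuousLinearMap_apply]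

/-- The star may be computed in the transported basis, which is adapted to the pulled-back 3-form.
-/
theorem starOf_comp {φ : Alt 3} (hφ : IsPositive φ) (A : E7 ≃L[ℝ] E7) {k l : ℕ} (h : k + l = 7)
    (β : Alt k) : starOf (φ.compContinuousLinearMap (A : E7 →L[ℝ] E7)) h
        (β.compContinuousLinearMap (A : E7 →L[ℝ] E7)) =
      (starOf φ h β).compContinuousLinearMap (A : E7 →L[ℝ] E7) := by
  obtain ⟨e, rfl⟩ := exists_phiBry hφ
  rw [starOf_eq (phiBry_map e A).symm, starOf_eq rfl, starE_map]

theorem normSqTwo_comp {φ : Alt 3} (hφ : IsPositive φ) (A : E7 ≃L[ℝ] E7) (τ : Alt 2) :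
    normSqTwo (φ.compContinuousLinearMap (A : E7 →L[ℝ] E7))
      (τ.compContinuousLinearMap (A : E7 →L[ℝ] E7)) = normSqTwo φ τ := by
  obtain ⟨e, rfl⟩ := exists_phiBry hφ
  rw [normSqTwo_eq (phiBry_map e A).symm, normSqTwo_eq rfl, normSqE, normSqE]
  simp only [map_comp_comp]

/-- The bases e and e' are unrelated, because `wedgeSq` does not depend on its basis. -/
theorem wedgeSq_comp (e e' : Module.Basis (Fin 7) ℝ E7) (A : E7 ≃L[ℝ] E7) (τ : Alt 2) :
    wedgeSq e' (τ.compContinuousLinearMap (A : E7 →L[ℝ] E7)) =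
      (wedgeSq e τ).compContinuousLinearMap (A : E7 →L[ℝ] E7) := by
  ext u
  rw [ContinuousAlternatingMap.compContinuousLinearMap_apply, wedgeSq_apply, wedgeSq_apply]
  congr 1
  refine Finset.sum_congr rfl fun σ _ => ?_
  have h : ∀ x y, τ.compContinuousLinearMap (A : E7 →L[ℝ] E7) ![x, y] = τ ![A x, A y] := by
    intro x y
    rw [ContinuousAlternatingMap.compContinuousLinearMap_apply]
    congr 1
    ext1 i
    fin_cases i <;> rfl
  rw [h, h]
  rfl

/-! ### Forms with integer components -/

/-- The determinant of an integer matrix, by expansion along the first row. -/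
def laplaceDet : (k : ℕ) → (Fin k → Fin k → ℤ) → ℤ
  | 0, _ => 1
  | k + 1, M => ∑ j : Fin (k + 1), lazyMul (M 0 j)
      ((-1) ^ (j : ℕ) * laplaceDet k fun a b => M a.succ (j.succAbove b))

theorem laplaceDet_eq (k : ℕ) (M : Fin k → Fin k → ℤ) : laplaceDet k M = (Matrix.of M).det := by
  induction k with
  | zero => simp [laplaceDet]
  | succ k ih =>
    rw [laplaceDet, Matrix.det_succ_row_zero]
    refine Finset.sum_congr rfl fun j _ => ?_
    rw [lazyMul_eq, ih]
    simp only [Matrix.of_apply]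
    rw [← mul_assoc, mul_comm (M 0 j)]
    rfl

theorem laplaceDet_kron {k : ℕ} (I J : Fin k → Fin 7) :
    ((laplaceDet k fun a b => kron (I a) (J b) : ℤ) : ℝ) =
      (Matrix.of fun a b => if I a = J b then (1 : ℝ) else 0).det := by
  rw [laplaceDet_eq]
  refine ((Int.castRingHom ℝ).map_det _).trans ?_
  congr 1
  ext a b
  simp [kron]

/-- The form `∑ c e^J` over the pairs `(c, J)` in a list. -/
def formOf {k : ℕ} (e : Module.Basis (Fin 7) ℝ E7) : List (ℤ × (Fin k → Fin 7)) → Alt k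
  | [] => 0
  | p :: L => (p.1 : ℝ) • dualForm e p.2 + formOf e L

/-- The components of `formOf e L`. -/
def coeffOf {k : ℕ} (L : List (ℤ × (Fin k → Fin 7))) (K : Fin k → Fin 7) : ℤ :=
  (L.map fun p => p.1 * laplaceDet k fun a b => kron (K a) (p.2 b)).sum

theorem formOf_basis {k : ℕ} (e : Module.Basis (Fin 7) ℝ E7) (L : List (ℤ × (Fin k → Fin 7)))
    (K : Fin k → Fin 7) : formOf e L (e ∘ K) = (coeffOf L K : ℝ) := by
  induction L with
  | nil => simp [formOf, coeffOf]
  | cons p L ih =>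
    rw [coeffOf] at ih
    rw [formOf, coeffOf, List.map_cons, List.sum_cons, Int.cast_add, ← ih, Int.cast_mul,
      laplaceDet_kron, ContinuousAlternatingMap.add_apply, ContinuousAlternatingMap.smul_apply,
      dualForm_basis, smul_eq_mul]

/-- The components of the Hodge dual of `formOf e L`. -/
def starCoeff {k l : ℕ} (h : k + l = 7) (L : List (ℤ × (Fin k → Fin 7))) (J : Fin l → Fin 7) : ℤ :=
  (L.map fun p => p.1 * laplaceDet 7 fun a b => kron (Fin.append p.2 J (Fin.cast h.symm a)) b).sum

theorem starE_smul {k l : ℕ} (e : Module.Basis (Fin 7) ℝ E7) (h : k + l = 7) (c : ℝ) (α : Alt k) :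
    starE e h (c • α) = c • starE e h α := by
  simp only [starE, Finset.smul_sum, smul_smul, ContinuousAlternatingMap.smul_apply, smul_eq_mul]
  refine Finset.sum_congr rfl fun I _ => Finset.sum_congr rfl fun J _ => ?_
  congr 1
  ring

theorem starE_add {k l : ℕ} (e : Module.Basis (Fin 7) ℝ E7) (h : k + l = 7) (α β : Alt k) :
    starE e h (α + β) = starE e h α + starE e h β := by
  simp only [starE, ← Finset.sum_add_distrib, ← add_smul, ContinuousAlternatingMap.add_apply,
    mul_add]

theorem starE_zero {k l : ℕ} (e : Module.Basis (Fin 7) ℝ E7) (h : k + l = 7) :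
    starE e h (0 : Alt k) = 0 := by
  simp [starE]

/-- Only the complement of K contributes, with the sign of the shuffle. -/
theorem starE_dualForm {k l : ℕ} (e : Module.Basis (Fin 7) ℝ E7) (h : k + l = 7)
    {K : Fin k → Fin 7} (hK : StrictMono K) {J : Fin l → Fin 7} (hJ : StrictMono J) :
    starE e h (dualForm e K) (e ∘ J) = epsilon h K J := by
  simp only [starE, ContinuousAlternatingMap.sum_apply, ContinuousAlternatingMap.smul_apply]
  rw [Finset.sum_eq_single K]
  · rw [Finset.sum_eq_single J]
    · rw [dualForm_basis_of_strictMono e hK hK, dualForm_basis_of_strictMono e hJ hJ]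
      simp
    · intro J' hJ' hne
      rw [dualForm_basis_of_strictMono e (mem_increasing.1 hJ') hJ, if_neg hne.symm, smul_zero]
    · intro h
      exact absurd (mem_increasing.2 hJ) h
  · intro I hI hne
    rw [dualForm_basis_of_strictMono e hK (mem_increasing.1 hI), if_neg hne]
    simp
  · intro h
    exact absurd (mem_increasing.2 hK) h

/-- Reduces the star of a form with integer components to an identity between integers over
increasing tuples, which the kernel can decide. -/
theorem starE_formOf {k l : ℕ} (e : Module.Basis (Fin 7) ℝ E7) (h : k + l = 7)
    (L : List (ℤ × (Fin k → Fin 7))) (L' : List (ℤ × (Fin l → Fin 7)))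
    (hL : ∀ p ∈ L, StrictMono p.2)
    (hs : ∀ J : Fin l → Fin 7, StrictMono J → starCoeff h L J = coeffOf L' J) :
    starE e h (formOf e L) = formOf e L' := by
  refine alt_ext_increasing e fun J hJ => ?_
  rw [formOf_basis, ← hs J hJ]
  clear hs
  induction L with
  | nil => simp [formOf, starE_zero, starCoeff]
  | cons p L ih =>
    have ih' := ih fun q hq => hL q (List.mem_cons_of_mem _ hq)
    rw [starCoeff] at ih'
    rw [formOf, starE_add, starE_smul, ContinuousAlternatingMap.add_apply, ih', starCoeff,
      List.map_cons, List.sum_cons, Int.cast_add, Int.cast_mul, laplaceDet_kron,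
      ContinuousAlternatingMap.smul_apply, starE_dualForm e h (hL p List.mem_cons_self) hJ,
      smul_eq_mul]
    rfl

/-! ### Invariant coframes and exterior derivatives -/

theorem chart_model (x : E7) : chart x = PartialEquiv.refl E7 :=
  extChartAt_model_space_eq_id ℝ x

theorem diffAt_refl (y : E7) : diffAt (PartialEquiv.refl E7) y = ContinuousLinearMap.id ℝ E7 :=
  mfderiv_id

theorem diffAt_refl_symm (y : E7) :
    diffAt (PartialEquiv.refl E7).symm y = ContinuousLinearMap.id ℝ E7 :=
  mfderiv_id

theorem localForm_model {k : ℕ} (α : Form E7 k) (x : E7) : localForm α x = α := by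
  ext1 y
  rw [localForm, pullback, chart_model, diffAt_refl_symm]
  rfl

theorem extD_model {k : ℕ} (α : Form E7 k) (x : E7) : extD α x = extDeriv α x := by
  rw [extD, localForm_model, chart_model, diffAt_refl]
  rfl

/-- The components of `d(α ∘ Θ)` in a frame with `dΘ(e_i)(e_j) = ∑ Γ_ijm e_m`, where `a` are the
components of `α`. -/
def dCoeff {k : ℕ} (Γ : Fin 7 → Fin 7 → Fin 7 → ℤ) (a : (Fin k → Fin 7) → ℤ)
    (I : Fin (k + 1) → Fin 7) : ℤ :=
  ∑ i : Fin (k + 1), (-1) ^ (i : ℕ) * ∑ j : Fin k, ∑ m, lazyMul (Γ (I i) (i.removeNth I j) m)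
    (a (Function.update (i.removeNth I) j m))

/-- The product rule for a multilinear map whose arguments Θ(y)w_i all vary. -/
theorem hasFDerivAt_comp_coframe {k : ℕ} (α : Alt k) {Θ : E7 → E7 →L[ℝ] E7} {x : E7}
    (hΘ : DifferentiableAt ℝ Θ x) (w : Fin k → E7) (a : E7) :
    fderiv ℝ (fun y => (α.compContinuousLinearMap (Θ y)) w) x a =
      ∑ j, α (Function.update (fun i => Θ x (w i)) j (fderiv ℝ Θ x a (w j))) := by
  have h1 : HasFDerivAt (fun y => fun i => Θ y (w i))
      (ContinuousLinearMap.pi fun i => (ContinuousLinearMap.apply ℝ E7 (w i)).comp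
        (fderiv ℝ Θ x)) x := by
    rw [hasFDerivAt_pi']
    intro i
    exact (ContinuousLinearMap.apply ℝ E7 (w i)).hasFDerivAt.comp x hΘ.hasFDerivAt
  have h2 := (α.toContinuousMultilinearMap.hasFDerivAt (fun i => Θ x (w i))).comp x h1
  have h3 : (fun y => (α.compContinuousLinearMap (Θ y)) w) =
      (⇑α.toContinuousMultilinearMap ∘ fun y => fun i => Θ y (w i)) := rfl
  rw [h3, h2.fderiv]
  simp [ContinuousMultilinearMap.linearDeriv_apply]

theorem alt_eq_sum {k : ℕ} (e : Module.Basis (Fin 7) ℝ E7) (α : Alt k) :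
    α = ∑ J ∈ increasing k, α (e ∘ J) • dualForm e J := by
  ext u
  rw [ContinuousAlternatingMap.sum_apply]
  exact (sum_dualForm_eq e α.toAlternatingMap u).symm

/-! ### Smoothness of families of alternating forms. -/

section Smooth

variable {E : Type*} [NormedAddCommGroup E] [NormedSpace ℝ E] {k : ℕ} {n : WithTop ℕ∞}

/-- The space of forms is spanned by finitely many dual forms, so smoothness may be tested on
components. -/
theorem contDiffAt_alt {F : E → Alt k} {x : E}
    (h : ∀ v, ContDiffAt ℝ n (fun y => F y v) x) : ContDiffAt ℝ n F x := by
  have h1 : F = fun y => ∑ J ∈ increasing k, F y ((EuclideanSpace.basisFun (Fin 7) ℝ).toBasis ∘ J) •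
      dualForm (EuclideanSpace.basisFun (Fin 7) ℝ).toBasis J := by
    ext1 y
    exact alt_eq_sum _ _
  rw [h1]
  exact ContDiffAt.sum fun J _ => (h _).smul contDiffAt_const

theorem contDiffAt_alt_apply {F : E → Alt k} {x : E} (h : ContDiffAt ℝ n F x)
    (v : Fin k → E7) : ContDiffAt ℝ n (fun y => F y v) x :=
  ((ContinuousAlternatingMap.apply ℝ E7 ℝ v).contDiff.contDiffAt (x := F x)).comp x h

theorem contDiffAt_alt_comp {F : E → Alt k} {g : E → E7 →L[ℝ] E7} {x : E}
    (hF : ContDiffAt ℝ n F x) (hg : ContDiffAt ℝ n g x) :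
    ContDiffAt ℝ n (fun y => (F y).compContinuousLinearMap (g y)) x := by
  refine contDiffAt_alt fun v => ?_
  have h1 : (fun y => (F y).compContinuousLinearMap (g y) v) = fun y =>
      ∑ J ∈ increasing k, F y ((EuclideanSpace.basisFun (Fin 7) ℝ).toBasis ∘ J) *
      dualForm (EuclideanSpace.basisFun (Fin 7) ℝ).toBasis J (fun i => g y (v i)) := by
    ext1 y
    exact (sum_dualForm_eq _ (F y).toAlternatingMap _).symm
  rw [h1]
  refine ContDiffAt.sum fun J _ => (contDiffAt_alt_apply hF _).mul ?_
  refine ((dualForm _ J).toContinuousMultilinearMap.contDiff.contDiffAt).comp x ?_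
  rw [contDiffAt_pi]
  intro i
  exact hg.clm_apply contDiffAt_const

end Smooth

theorem contDiff_comp_coframe {k : ℕ} (α : Alt k) {Θ : E7 → E7 →L[ℝ] E7} (hΘ : ContDiff ℝ ∞ Θ) :
    ContDiff ℝ ∞ fun y => α.compContinuousLinearMap (Θ y) :=
  contDiff_iff_contDiffAt.2 fun _ => contDiffAt_alt_comp contDiffAt_const hΘ.contDiffAt

/-- The derivative is evaluated on the constant vectors Θ(x)⁻¹e_i, so no brackets appear and only DΘ
contributes. Its components are integer combinations of t_0 = 1, t_1, t_2. The parts with t_1 and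
t_2 need not vanish, only their antisymmetrisation must, which is the content of the last two
conditions in `h`. -/
theorem extDeriv_comp_coframe {k : ℕ} (e : Module.Basis (Fin 7) ℝ E7) {Θ : E7 → E7 ≃L[ℝ] E7}
    (hΘ : ContDiff ℝ ∞ fun y => (Θ y : E7 →L[ℝ] E7)) (x : E7)
    (Γ : Fin 3 → Fin 7 → Fin 7 → Fin 7 → ℤ) (t : Fin 3 → ℝ)
    (hΓ : ∀ i j, fderiv ℝ (fun y => (Θ y : E7 →L[ℝ] E7)) x ((Θ x).symm (e i)) ((Θ x).symm (e j)) =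
      ∑ m, (∑ s, t s * (Γ s i j m : ℝ)) • e m)
    (L : List (ℤ × (Fin k → Fin 7))) (L' : List (ℤ × (Fin (k + 1) → Fin 7)))
    (h0 : t 0 = 1)
    (h : ∀ I : Fin (k + 1) → Fin 7, StrictMono I → dCoeff (Γ 0) (coeffOf L) I = coeffOf L' I ∧
      dCoeff (Γ 1) (coeffOf L) I = 0 ∧ dCoeff (Γ 2) (coeffOf L) I = 0) :
    extDeriv (fun y => (formOf e L).compContinuousLinearMap (Θ y : E7 →L[ℝ] E7)) x =
      (formOf e L').compContinuousLinearMap (Θ x : E7 →L[ℝ] E7) := by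
  refine alt_ext_increasing (e.map (Θ x).symm.toLinearEquiv) fun I hI => ?_
  rw [map_comp_comp, formOf_basis, extDeriv_apply
    ((contDiff_comp_coframe (formOf e L) hΘ).differentiable (by simp) x)]
  have hterm : ∀ (i : Fin (k + 1)) (j : Fin k),
      formOf e L (Function.update (e ∘ i.removeNth I) j
        (∑ m, (∑ s, t s * (Γ s (I i) (i.removeNth I j) m : ℝ)) • e m)) =
      ∑ m, (∑ s, t s * (Γ s (I i) (i.removeNth I j) m : ℝ)) *
        (coeffOf L (Function.update (i.removeNth I) j m) : ℝ) := by
    intro i j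
    have h1 := (formOf e L).toMultilinearMap.map_update_sum Finset.univ j
      (fun m => (∑ s, t s * (Γ s (I i) (i.removeNth I j) m : ℝ)) • e m) (e ∘ i.removeNth I)
    refine h1.trans (Finset.sum_congr rfl fun m _ => ?_)
    rw [MultilinearMap.map_update_smul, smul_eq_mul, ← formOf_basis e L]
    congr 1
    change formOf e L _ = formOf e L _
    congr 1
    ext1 n
    by_cases hn : n = j
    · subst hn; simp
    · simp [Function.update_of_ne hn]
  have hi : ∀ i : Fin (k + 1), fderiv ℝ (fun y => ((formOf e L).compContinuousLinearMap
      (Θ y : E7 →L[ℝ] E7)) (i.removeNth (e.map (Θ x).symm.toLinearEquiv ∘ I))) x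
      ((e.map (Θ x).symm.toLinearEquiv ∘ I) i) = ∑ j, ∑ m,
        (∑ s, t s * (Γ s (I i) (i.removeNth I j) m : ℝ)) *
        (coeffOf L (Function.update (i.removeNth I) j m) : ℝ) := by
    intro i
    rw [hasFDerivAt_comp_coframe (Θ := fun y => (Θ y : E7 →L[ℝ] E7)) _
      (hΘ.differentiable (by simp) x)]
    refine Finset.sum_congr rfl fun j _ => ?_
    rw [← hterm]
    congr 1
    have h2 : (fun n => (Θ x : E7 →L[ℝ] E7) (i.removeNth (e.map (Θ x).symm.toLinearEquiv ∘ I) n)) =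
        e ∘ i.removeNth I := by
      ext1 n
      simp [Fin.removeNth]
    rw [h2, ← hΓ]
    rfl
  obtain ⟨ha, hb, hc⟩ := h I hI
  rw [← ha]
  -- The vanishing parts are put back so that both sides have the same shape and can be compared
  -- term by term.
  have hd : (dCoeff (Γ 0) (coeffOf L) I : ℝ) = (dCoeff (Γ 0) (coeffOf L) I : ℝ) +
      t 1 * (dCoeff (Γ 1) (coeffOf L) I : ℝ) + t 2 * (dCoeff (Γ 2) (coeffOf L) I : ℝ) := by
    rw [hb, hc]; simp
  rw [hd]
  simp only [hi, dCoeff, lazyMul_eq, Fin.sum_univ_three, h0, zsmul_eq_mul]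
  push_cast
  simp only [Finset.mul_sum, ← Finset.sum_add_distrib]
  refine Finset.sum_congr rfl fun i _ => Finset.sum_congr rfl fun j _ =>
    Finset.sum_congr rfl fun m _ => ?_
  ring

/-! ### The invariant coframe of `G/K` -/

/-- The differential at `x` of the left translation which moves `x` to the base point, for the
group of the lower triangular matrices with positive diagonal and the translations. -/
def coframe (x : E7) : E7 ≃L[ℝ] E7 :=
  LinearEquiv.toContinuousLinearEquiv
    { toFun := fun u => !₂[u 0, u 1 - x 1 * u 0, u 2 - x 2 * u 0, Real.exp (-(x 0 / 2)) * u 3,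
        Real.exp (-(x 0 / 2)) * u 4,
        Real.exp (x 0 / 2) * u 5 - Real.exp (-(x 0 / 2)) * (x 1 * u 3 + x 2 * u 4),
        Real.exp (x 0 / 2) * u 6 - Real.exp (-(x 0 / 2)) * (x 1 * u 4 - x 2 * u 3)]
      invFun := fun y => !₂[y 0, y 1 + x 1 * y 0, y 2 + x 2 * y 0, Real.exp (x 0 / 2) * y 3,
        Real.exp (x 0 / 2) * y 4, Real.exp (-(x 0 / 2)) * (y 5 + x 1 * y 3 + x 2 * y 4),
        Real.exp (-(x 0 / 2)) * (y 6 + x 1 * y 4 - x 2 * y 3)]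
      map_add' := by
        intro u v
        ext j
        fin_cases j <;> simp <;> ring
      map_smul' := by
        intro c u
        ext j
        fin_cases j <;> simp <;> ring
      left_inv := by
        intro u
        have h : Real.exp (-(x 0 / 2)) * Real.exp (x 0 / 2) = 1 := by rw [← Real.exp_add]; simp
        ext j
        fin_cases j <;> simp <;> generalize Real.exp (-(x 0 / 2)) = p at * <;>
          generalize Real.exp (x 0 / 2) = q at *
        · linear_combination u 3 * h
        · linear_combination u 4 * h
        · linear_combination u 5 * h
        · linear_combination u 6 * h
      right_inv := by
        intro u
        have h : Real.exp (-(x 0 / 2)) * Real.exp (x 0 / 2) = 1 := by rw [← Real.exp_add]; simp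
        ext j
        fin_cases j <;> simp <;> generalize Real.exp (-(x 0 / 2)) = p at * <;>
          generalize Real.exp (x 0 / 2) = q at *
        · linear_combination u 3 * h
        · linear_combination u 4 * h
        · linear_combination u 5 * h
        · linear_combination u 6 * h }

theorem coframe_apply (x u : E7) : coframe x u =
    !₂[u 0, u 1 - x 1 * u 0, u 2 - x 2 * u 0, Real.exp (-(x 0 / 2)) * u 3,
        Real.exp (-(x 0 / 2)) * u 4,
        Real.exp (x 0 / 2) * u 5 - Real.exp (-(x 0 / 2)) * (x 1 * u 3 + x 2 * u 4),
        Real.exp (x 0 / 2) * u 6 - Real.exp (-(x 0 / 2)) * (x 1 * u 4 - x 2 * u 3)] := rfl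

theorem coframe_symm_apply (x y : E7) : (coframe x).symm y =
    !₂[y 0, y 1 + x 1 * y 0, y 2 + x 2 * y 0, Real.exp (x 0 / 2) * y 3,
        Real.exp (x 0 / 2) * y 4, Real.exp (-(x 0 / 2)) * (y 5 + x 1 * y 3 + x 2 * y 4),
        Real.exp (-(x 0 / 2)) * (y 6 + x 1 * y 4 - x 2 * y 3)] := rfl

theorem contDiff_coord (i : Fin 7) : ContDiff ℝ ∞ fun x : E7 => x i :=
  (EuclideanSpace.proj i : E7 →L[ℝ] ℝ).contDiff

theorem contDiff_coframe : ContDiff ℝ ∞ fun x => (coframe x : E7 →L[ℝ] E7) := by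
  rw [contDiff_clm_apply_iff]
  intro u
  rw [contDiff_euclidean]
  have h := contDiff_coord
  intro i
  have h1 : ContDiff ℝ ∞ fun x : E7 => Real.exp (x 0 / 2) := ((h 0).div_const 2).exp
  have h2 : ContDiff ℝ ∞ fun x : E7 => Real.exp (-(x 0 / 2)) := ((h 0).div_const 2).neg.exp
  fin_cases i
  · exact contDiff_const
  · exact contDiff_const.sub ((h 1).mul contDiff_const)
  · exact contDiff_const.sub ((h 2).mul contDiff_const)
  · exact h2.mul contDiff_const
  · exact h2.mul contDiff_const
  · exact (h1.mul contDiff_const).sub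
      (h2.mul (((h 1).mul contDiff_const).add ((h 2).mul contDiff_const)))
  · exact (h1.mul contDiff_const).sub
      (h2.mul (((h 1).mul contDiff_const).sub ((h 2).mul contDiff_const)))

/-- The derivative of the coframe. -/
theorem fderiv_coframe (x a c : E7) : fderiv ℝ (fun y => (coframe y : E7 →L[ℝ] E7)) x a c =
    !₂[0, -a 1 * c 0, -a 2 * c 0, -(a 0 / 2) * Real.exp (-(x 0 / 2)) * c 3,
      -(a 0 / 2) * Real.exp (-(x 0 / 2)) * c 4,
      a 0 / 2 * Real.exp (x 0 / 2) * c 5 - Real.exp (-(x 0 / 2)) * (a 1 * c 3 + a 2 * c 4)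
        + a 0 / 2 * Real.exp (-(x 0 / 2)) * (x 1 * c 3 + x 2 * c 4),
      a 0 / 2 * Real.exp (x 0 / 2) * c 6 - Real.exp (-(x 0 / 2)) * (a 1 * c 4 - a 2 * c 3)
        + a 0 / 2 * Real.exp (-(x 0 / 2)) * (x 1 * c 4 - x 2 * c 3)] := by
  have hd := (contDiff_coframe.differentiable (by simp) x).hasFDerivAt
  have hline : HasDerivAt (fun t : ℝ => x + t • a) a 0 := by
    simpa using ((hasDerivAt_id (0 : ℝ)).smul_const a).const_add x
  have hx0 : x = x + (0 : ℝ) • a := by simp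
  have h1 : HasDerivAt (fun t : ℝ => (coframe (x + t • a) : E7 →L[ℝ] E7))
      (fderiv ℝ (fun y => (coframe y : E7 →L[ℝ] E7)) x a) 0 := by
    rw [hx0] at hd
    have := HasFDerivAt.comp_hasDerivAt (f := fun t : ℝ => x + t • a) (0 : ℝ) hd hline
    rw [← hx0] at this
    exact this
  have h2 : ∀ j : Fin 7, HasDerivAt (fun t : ℝ => coframe (x + t • a) c j)
      (fderiv ℝ (fun y => (coframe y : E7 →L[ℝ] E7)) x a c j) 0 := by
    intro j
    exact ((EuclideanSpace.proj j : E7 →L[ℝ] ℝ).comp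
      (ContinuousLinearMap.apply ℝ E7 c)).hasFDerivAt.comp_hasDerivAt (0 : ℝ) h1
  have hc : ∀ i : Fin 7, HasDerivAt (fun t : ℝ => (x + t • a) i) (a i) 0 := by
    intro i
    have := ((hasDerivAt_id (0 : ℝ)).mul_const (a i)).const_add (x i)
    simpa using this
  have hp : HasDerivAt (fun t : ℝ => Real.exp (-((x + t • a) 0 / 2)))
      (-(a 0 / 2) * Real.exp (-(x 0 / 2))) 0 := by
    refine ((hc 0).div_const 2).fun_neg.exp.congr_deriv ?_
    simp
    ring
  have hq : HasDerivAt (fun t : ℝ => Real.exp ((x + t • a) 0 / 2))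
      (a 0 / 2 * Real.exp (x 0 / 2)) 0 := by
    refine ((hc 0).div_const 2).exp.congr_deriv ?_
    simp
    ring
  have hx : ∀ i, (x + (0 : ℝ) • a) i = x i := by intro i; simp
  ext j
  apply (h2 j).unique
  fin_cases j
  · exact hasDerivAt_const _ _
  · refine (((hc 1).mul_const (c 0)).const_sub (c 1)).congr_deriv ?_
    simp
  · refine (((hc 2).mul_const (c 0)).const_sub (c 2)).congr_deriv ?_
    simp
  · exact hp.mul_const _
  · exact hp.mul_const _
  · refine ((hq.mul_const (c 5)).sub (hp.mul (((hc 1).mul_const (c 3)).add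
      ((hc 2).mul_const (c 4))))).congr_deriv ?_
    simp
    ring
  · refine ((hq.mul_const (c 6)).sub (hp.mul (((hc 1).mul_const (c 4)).sub
      ((hc 2).mul_const (c 3))))).congr_deriv ?_
    simp
    ring

/-- The basis `e_1, …, e_7` of the tangent space at the base point. -/
def bBry : Module.Basis (Fin 7) ℝ E7 :=
  Module.Basis.ofEquivFun
    { toFun := fun x => ![-x 0 / 2, -x 2 / 2, -x 1 / 2, x 3, x 4, x 5, -x 6]
      invFun := fun c => !₂[-2 * c 0, -2 * c 2, -2 * c 1, c 3, c 4, c 5, -c 6]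
      map_add' := by
        intro x y
        ext j
        fin_cases j <;> simp <;> ring
      map_smul' := by
        intro c x
        ext j
        fin_cases j <;> simp <;> ring
      left_inv := by
        intro x
        ext j
        fin_cases j <;> simp <;> ring
      right_inv := by
        intro x
        ext j
        fin_cases j <;> simp }

theorem bBry_repr (x : E7) (i : Fin 7) :
    bBry.repr x i = ![-x 0 / 2, -x 2 / 2, -x 1 / 2, x 3, x 4, x 5, -x 6] i := rfl

theorem bBry_apply (i : Fin 7) : bBry i =
    ![!₂[-2, 0, 0, 0, 0, 0, 0], !₂[0, 0, -2, 0, 0, 0, 0], !₂[0, -2, 0, 0, 0, 0, 0],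
      !₂[0, 0, 0, 1, 0, 0, 0], !₂[0, 0, 0, 0, 1, 0, 0], !₂[0, 0, 0, 0, 0, 1, 0],
      !₂[0, 0, 0, 0, 0, 0, -1]] i := by
  apply bBry.repr.injective
  ext j
  rw [bBry.repr_self, bBry_repr]
  fin_cases i <;> fin_cases j <;> simp

/-- The structure constants of the coframe. -/
def gammaBry (s : Fin 3) (i j m : Fin 7) : ℤ :=
  match s.1, i.1, j.1, m.1 with
  | 0, 1, 0, 1 | 0, 2, 0, 2 | 0, 2, 3, 5 | 0, 1, 4, 5 | 0, 1, 3, 6 | 1, 0, 0, 2 | 2, 0, 0, 1 => 2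
  | 0, 0, 3, 3 | 0, 0, 4, 4 => 1
  | 0, 0, 5, 5 | 0, 0, 6, 6 => -1
  | 0, 2, 4, 6 => -2
  | _, _, _, _ => 0

/-- The definition by cases is quick to evaluate; the closed form with Kronecker symbols is the one
to compare with the derivative of the coframe. -/
theorem gammaBry_eq : ∀ (s : Fin 3) (i j m : Fin 7), gammaBry s i j m =
    (![fun i j => ![0, 2 * kron i 1 * kron j 0, 2 * kron i 2 * kron j 0, kron i 0 * kron j 3,
      kron i 0 * kron j 4, -kron i 0 * kron j 5 + 2 * kron i 2 * kron j 3 + 2 * kron i 1 * kron j 4,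
      -kron i 0 * kron j 6 - 2 * kron i 2 * kron j 4 + 2 * kron i 1 * kron j 3],
    fun i j => ![0, 0, 2 * kron i 0 * kron j 0, 0, 0, 0, 0],
    fun i j => ![0, 2 * kron i 0 * kron j 0, 0, 0, 0, 0, 0]] : Fin 3 → Fin 7 → Fin 7 → Fin 7 → ℤ) s i j m := by
  decide +kernel

/-- In the frame the exponentials cancel in pairs; what is left of the position is affine in x_1 and
x_2. -/
theorem fderiv_coframe_symm (x a c : E7) :
    fderiv ℝ (fun y => (coframe y : E7 →L[ℝ] E7)) x ((coframe x).symm a) ((coframe x).symm c) =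
      !₂[0, -(a 1 + x 1 * a 0) * c 0, -(a 2 + x 2 * a 0) * c 0, -(a 0 / 2) * c 3, -(a 0 / 2) * c 4,
        a 0 / 2 * c 5 - a 1 * c 3 - a 2 * c 4, a 0 / 2 * c 6 - a 1 * c 4 + a 2 * c 3] := by
  have h : Real.exp (-(x 0 / 2)) * Real.exp (x 0 / 2) = 1 := by rw [← Real.exp_add]; simp
  rw [fderiv_coframe, coframe_symm_apply, coframe_symm_apply]
  generalize Real.exp (-(x 0 / 2)) = p at *
  generalize Real.exp (x 0 / 2) = q at *
  ext m
  fin_cases m <;> simp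
  · linear_combination (a 0 / 2 * c 3) * h
  · linear_combination (a 0 / 2 * c 4) * h
  · linear_combination (a 0 / 2 * c 5 - a 1 * c 3 - a 2 * c 4) * h
  · linear_combination (a 0 / 2 * c 6 - a 1 * c 4 + a 2 * c 3) * h

theorem sum_smul_bBry (f : Fin 7 → ℝ) : ∑ m, f m • bBry m =
    !₂[-2 * f 0, -2 * f 2, -2 * f 1, f 3, f 4, f 5, -f 6] :=
  (bBry.equivFun_symm_apply f).symm

theorem bBry_coord (i : Fin 7) : bBry i 0 = -2 * kron i 0 ∧ bBry i 1 = -2 * kron i 2 ∧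
    bBry i 2 = -2 * kron i 1 ∧ bBry i 3 = kron i 3 ∧ bBry i 4 = kron i 4 ∧ bBry i 5 = kron i 5 ∧
    bBry i 6 = -kron i 6 := by
  rw [bBry_apply]
  fin_cases i <;> simp [kron]

/-- The terms with x_1 and x_2 occur only for i = j = 0. Being symmetric in i and j they disappear
from d, as they must for an invariant coframe. -/
theorem fderiv_coframe_basis (x : E7) (i j : Fin 7) :
    fderiv ℝ (fun y => (coframe y : E7 →L[ℝ] E7)) x ((coframe x).symm (bBry i))
      ((coframe x).symm (bBry j)) =
      ∑ m, (∑ s, ![1, x 1, x 2] s * (gammaBry s i j m : ℝ)) • bBry m := by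
  obtain ⟨h0, h1, h2, -⟩ := bBry_coord i
  obtain ⟨g0, -, -, g3, g4, g5, g6⟩ := bBry_coord j
  rw [fderiv_coframe_symm, sum_smul_bBry, h0, h1, h2, g0, g3, g4, g5, g6]
  ext m
  fin_cases m <;> simp [Fin.sum_univ_three, gammaBry_eq] <;> ring

/-! ### Invariant forms -/

/-- This and the next three lemmas interleave the inequalities with the quantifiers, so that a
decision procedure leaves the tuples that are not increasing at the earliest point. -/
theorem forall_strictMono_two {P : (Fin 2 → Fin 7) → Prop}
    (h : ∀ a b, a < b → P ![a, b]) (J : Fin 2 → Fin 7) (hJ : StrictMono J) : P J := by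
  have h1 : J = ![J 0, J 1] := by ext1 i; fin_cases i <;> rfl
  rw [h1]
  exact h _ _ (hJ (by decide))

theorem forall_strictMono_three {P : (Fin 3 → Fin 7) → Prop}
    (h : ∀ a b, a < b → ∀ c, b < c → P ![a, b, c]) (J : Fin 3 → Fin 7) (hJ : StrictMono J) :
    P J := by
  have h1 : J = ![J 0, J 1, J 2] := by ext1 i; fin_cases i <;> rfl
  rw [h1]
  exact h _ _ (hJ (by decide)) _ (hJ (by decide))

theorem forall_strictMono_four {P : (Fin 4 → Fin 7) → Prop}
    (h : ∀ a b, a < b → ∀ c, b < c → ∀ d, c < d → P ![a, b, c, d]) (J : Fin 4 → Fin 7)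
    (hJ : StrictMono J) : P J := by
  have h1 : J = ![J 0, J 1, J 2, J 3] := by ext1 i; fin_cases i <;> rfl
  rw [h1]
  exact h _ _ (hJ (by decide)) _ (hJ (by decide)) _ (hJ (by decide))

theorem forall_strictMono_five {P : (Fin 5 → Fin 7) → Prop}
    (h : ∀ a b, a < b → ∀ c, b < c → ∀ d, c < d → ∀ m, d < m → P ![a, b, c, d, m])
    (J : Fin 5 → Fin 7) (hJ : StrictMono J) : P J := by
  have h1 : J = ![J 0, J 1, J 2, J 3, J 4] := by ext1 i; fin_cases i <;> rfl
  rw [h1]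
  exact h _ _ (hJ (by decide)) _ (hJ (by decide)) _ (hJ (by decide)) _ (hJ (by decide))

/-- The form with integer components in the coframe of `G/K`. -/
def invForm {k : ℕ} (L : List (ℤ × (Fin k → Fin 7))) : Form E7 k :=
  fun x => (formOf bBry L).compContinuousLinearMap (coframe x : E7 →L[ℝ] E7)

theorem contDiff_invForm {k : ℕ} (L : List (ℤ × (Fin k → Fin 7))) :
    ContDiff ℝ ∞ (invForm L : E7 → Alt k) :=
  contDiff_comp_coframe _ contDiff_coframe

/-- The exterior derivative of an invariant form with integer components, as a finite check on the
structure constants. -/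
theorem extD_invForm {k : ℕ} (L : List (ℤ × (Fin k → Fin 7)))
    (L' : List (ℤ × (Fin (k + 1) → Fin 7)))
    (h : ∀ I : Fin (k + 1) → Fin 7, StrictMono I →
      dCoeff (gammaBry 0) (coeffOf L) I = coeffOf L' I ∧
      dCoeff (gammaBry 1) (coeffOf L) I = 0 ∧ dCoeff (gammaBry 2) (coeffOf L) I = 0) :
    extD (invForm L) = invForm L' := by
  ext1 x
  rw [extD_model]
  exact extDeriv_comp_coframe bBry contDiff_coframe x gammaBry ![1, x 1, x 2]
    (fderiv_coframe_basis x) L L' rfl h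

theorem extD_add {k : ℕ} {α β : Form E7 k} (hα : ContDiff ℝ ∞ α) (hβ : ContDiff ℝ ∞ β) :
    extD (α + β) = extD α + extD β := by
  ext1 x
  rw [Pi.add_apply, extD_model, extD_model, extD_model]
  exact extDeriv_add (hα.differentiable (by simp) x) (hβ.differentiable (by simp) x)

theorem extD_smul {k : ℕ} (c : ℝ) (α : Form E7 k) : extD (c • α) = c • extD α := by
  ext1 x
  rw [Pi.smul_apply, extD_model, extD_model]
  exact extDeriv_smul c _

theorem extD_invForm_add {k : ℕ} (a b : ℝ) (L L' : List (ℤ × (Fin k → Fin 7))) :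
    extD (a • invForm L + b • invForm L') = a • extD (invForm L) + b • extD (invForm L') := by
  rw [extD_add (α := a • invForm L) (β := b • invForm L') ((contDiff_invForm L).const_smul a)
    ((contDiff_invForm L').const_smul b), extD_smul, extD_smul]

theorem extD_zero {M : Type*} [TopologicalSpace M] [ChartedSpace E7 M] {k : ℕ} :
    extD (0 : Form M k) = 0 := by
  ext1 x
  have h : localForm (0 : Form M k) x = 0 := rfl
  rw [extD, h]
  -- The zero form is 0 times itself, and d commutes with scalars.
  have h1 : extDeriv (0 : E7 → Alt k) (chart x x) = 0 := by
    have := extDeriv_smul (x := chart x x) (0 : ℝ) (0 : E7 → Alt k)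
    rwa [zero_smul, zero_smul] at this
  rw [h1]
  rfl

theorem starOf_zero (φ : Alt 3) {k l : ℕ} (h : k + l = 7) : starOf φ h (0 : Alt k) = 0 := by
  simp [starOf]

theorem codiff_of_odd {M : Type*} [TopologicalSpace M] [ChartedSpace E7 M] (φ : Form M 3)
    {k l : ℕ} (hk : Odd (k + 1)) (h : k + 1 + l = 7) (α : Form M (k + 1)) (x : M) {β : Alt k}
    (hβ : hodge φ (k := l + 1) (l := k) (by omega) (extD (hodge φ h α)) x = β) :
    codiff φ k l h α x = -β := by
  rw [codiff, hβ]
  ext u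
  rw [ContinuousAlternatingMap.smul_apply, hk.neg_one_pow, ContinuousAlternatingMap.neg_apply,
    neg_one_smul]

theorem torsion_eq {M : Type*} [TopologicalSpace M] [ChartedSpace E7 M] {φ : Form M 3}
    {β : Form M 2}
    (h : hodge φ (k := 5) (l := 2) rfl (extD (hodge φ (k := 3) (l := 4) rfl φ)) = β) :
    torsion φ = fun x => -β x := by
  obtain ⟨γ, h1, rfl⟩ : ∃ γ : Form M 2, torsion φ = (fun x => -γ x) ∧ γ = β := ⟨_, rfl, h⟩
  exact h1

/-- For closed φ only dd^* remains, and d^*φ = -∗d∗φ in degree three is exactly τ. -/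
theorem laplacian_of_closed {M : Type*} [TopologicalSpace M] [ChartedSpace E7 M] {φ : Form M 3}
    (h : extD φ = 0) : laplacian φ φ = extD (torsion φ) := by
  have h0 : ∀ {k l : ℕ} (h : k + l = 7), hodge φ h (0 : Form M k) = 0 := fun h => by
    ext1 x
    exact starOf_zero _ h
  have h1 : codiff φ 3 3 rfl (extD φ) = 0 := by
    ext1 x
    have h3 : codiff φ 3 3 rfl (0 : Form M 4) x = 0 := by
      rw [codiff, h0, extD_zero, h0]
      simp
    rw [h]
    exact h3
  have h2 : codiff φ 2 4 rfl φ = torsion φ := by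
    ext1 x
    rw [torsion]
    exact codiff_of_odd φ (k := 2) (l := 4) (by decide) rfl φ x rfl
  rw [laplacian, h1, h2, zero_add]

/-- The components of `e^123`. -/
def etaL : List (ℤ × (Fin 3 → Fin 7)) := [(1, ![0, 1, 2])]

/-- The components of `φ - e^123`. -/
def betaL : List (ℤ × (Fin 3 → Fin 7)) :=
  [(1, ![0, 3, 4]), (1, ![0, 5, 6]), (1, ![1, 3, 5]), (-1, ![1, 4, 6]), (-1, ![2, 3, 6]),
    (-1, ![2, 4, 5])]

/-- The components of `∗e^123`. -/
def starEtaL : List (ℤ × (Fin 4 → Fin 7)) := [(1, ![3, 4, 5, 6])]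

/-- The components of `∗(φ - e^123)`. -/
def starBetaL : List (ℤ × (Fin 4 → Fin 7)) :=
  [(1, ![1, 2, 5, 6]), (1, ![1, 2, 3, 4]), (1, ![0, 2, 4, 6]), (-1, ![0, 2, 3, 5]),
    (-1, ![0, 1, 4, 5]), (-1, ![0, 1, 3, 6])]

/-- The components of `d∗φ`. -/
def dStarL : List (ℤ × (Fin 5 → Fin 7)) := [(6, ![0, 1, 2, 3, 4]), (-6, ![0, 1, 2, 5, 6])]

/-- The components of `τ`. -/
def tauL : List (ℤ × (Fin 2 → Fin 7)) := [(6, ![3, 4]), (-6, ![5, 6])]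

/-- The components of `-τ`. -/
def negTauL : List (ℤ × (Fin 2 → Fin 7)) := [(-6, ![3, 4]), (6, ![5, 6])]

/-- The components of `dτ`. -/
def dTauL : List (ℤ × (Fin 3 → Fin 7)) :=
  [(12, ![0, 3, 4]), (12, ![0, 5, 6]), (12, ![1, 3, 5]), (-12, ![1, 4, 6]), (-12, ![2, 3, 6]),
    (-12, ![2, 4, 5])]

theorem extD_eta : extD (invForm etaL) = 0 :=
  extD_invForm etaL [] (forall_strictMono_four (by decide +kernel))

theorem extD_beta : extD (invForm betaL) = 0 :=
  extD_invForm betaL [] (forall_strictMono_four (by decide +kernel))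

theorem extD_starEta : extD (invForm starEtaL) = 0 :=
  extD_invForm starEtaL [] (forall_strictMono_five (by decide +kernel))

theorem extD_starBeta : extD (invForm starBetaL) = invForm dStarL :=
  extD_invForm _ _ (forall_strictMono_five (by decide +kernel))

theorem extD_tau : extD (invForm tauL) = invForm dTauL :=
  extD_invForm _ _ (forall_strictMono_three (by decide +kernel))

theorem invForm_dTau : invForm dTauL = (12 : ℝ) • invForm betaL := by
  ext x u
  simp only [invForm, dTauL, betaL, formOf, Pi.smul_apply, ContinuousAlternatingMap.smul_apply,
    ContinuousAlternatingMap.compContinuousLinearMap_apply, ContinuousAlternatingMap.add_apply]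
  push_cast
  simp only [smul_eq_mul, ContinuousAlternatingMap.coe_zero, Pi.zero_apply]
  ring

theorem invForm_negTau : invForm negTauL = -invForm tauL := by
  ext x u
  simp only [invForm, tauL, negTauL, formOf, Pi.neg_apply, ContinuousAlternatingMap.smul_apply,
    ContinuousAlternatingMap.neg_apply,
    ContinuousAlternatingMap.compContinuousLinearMap_apply, ContinuousAlternatingMap.add_apply]
  push_cast
  simp only [smul_eq_mul, ContinuousAlternatingMap.coe_zero, Pi.zero_apply]
  ring

/-! ### The invariant closed `G₂`-structures -/

/-- The closed 3-form `l³ e^123 + l m² (φ - e^123)`. -/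
def scaledForm (l m : ℝ) : Form E7 3 :=
  fun x => (l ^ 3) • invForm etaL x + (l * m ^ 2) • invForm betaL x

section Scaled

variable {l m : ℝ}

/-- The basis `(l⁻¹e_1, l⁻¹e_2, l⁻¹e_3, m⁻¹e_4, …, m⁻¹e_7)`. -/
def scaledBasis (hl : l ≠ 0) (hm : m ≠ 0) : Module.Basis (Fin 7) ℝ E7 :=
  bBry.unitsSMul fun i => if i < 3 then (Units.mk0 l hl)⁻¹ else (Units.mk0 m hm)⁻¹

theorem scaledBasis_repr (hl : l ≠ 0) (hm : m ≠ 0) (u : E7) (i : Fin 7) :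
    (scaledBasis hl hm).repr u i = (if i < 3 then l else m) * bBry.repr u i := by
  rw [scaledBasis, Module.Basis.repr_unitsSMul]
  split_ifs <;> simp [Units.smul_def]

/-- Each covector carries the weight l or m according to whether it belongs to the hyperbolic or to
the fibre directions. -/
theorem dualForm_scaledBasis (hl : l ≠ 0) (hm : m ≠ 0) {k : ℕ} (J : Fin k → Fin 7) :
    dualForm (scaledBasis hl hm) J = (∏ a, if J a < 3 then l else m) • dualForm bBry J := by
  ext u
  rw [ContinuousAlternatingMap.smul_apply, dualForm_apply, dualForm_apply, smul_eq_mul,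
    ← Matrix.det_mul_row]
  congr 1
  ext a b
  simp [scaledBasis_repr]

theorem formOf_scaledBasis (hl : l ≠ 0) (hm : m ≠ 0) {k : ℕ} (L : List (ℤ × (Fin k → Fin 7)))
    (c : ℝ) (hc : ∀ p ∈ L, (∏ a, if p.2 a < 3 then l else m) = c) :
    formOf (scaledBasis hl hm) L = c • formOf bBry L := by
  induction L with
  | nil => simp [formOf]
  | cons p L ih =>
    rw [formOf, formOf, ih fun q hq => hc q (List.mem_cons_of_mem _ hq), dualForm_scaledBasis,
      hc p List.mem_cons_self, smul_add, smul_comm]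

theorem phiBry_eq_formOf (e : Module.Basis (Fin 7) ℝ E7) :
    phiBry e = formOf e etaL + formOf e betaL := by
  ext u
  simp only [phiBry, formOf, etaL, betaL, ContinuousAlternatingMap.smul_apply,
    ContinuousAlternatingMap.sub_apply, ContinuousAlternatingMap.add_apply]
  push_cast
  simp only [smul_eq_mul, ContinuousAlternatingMap.coe_zero, Pi.zero_apply]
  ring

/-- The summand η has three indices of weight l, and every term of β has one of weight l and two of
weight m. -/
theorem scaledForm_apply (hl : l ≠ 0) (hm : m ≠ 0) (x : E7) :
    scaledForm l m x =
      phiBry ((scaledBasis hl hm).map (coframe x).symm.toLinearEquiv) := by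
  rw [phiBry_map, phiBry_eq_formOf, formOf_scaledBasis hl hm etaL (l ^ 3),
    formOf_scaledBasis hl hm betaL (l * m ^ 2)]
  · rfl
  · intro p hp
    fin_cases hp <;> simp [Fin.prod_univ_three] <;> ring
  · intro p hp
    fin_cases hp <;> simp [Fin.prod_univ_three] <;> ring

theorem contDiff_scaledForm : ContDiff ℝ ∞ (scaledForm l m : E7 → Alt 3) :=
  ((contDiff_invForm etaL).const_smul _).add ((contDiff_invForm betaL).const_smul _)

theorem scaledForm_eq : scaledForm l m = (l ^ 3) • invForm etaL + (l * m ^ 2) • invForm betaL :=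
  rfl

theorem extD_scaledForm : extD (scaledForm l m) = 0 := by
  rw [scaledForm_eq, extD_invForm_add, extD_eta, extD_beta]
  simp

/-- The constants c and c' are the weights of the two forms in the rescaled coframe. With them
included, the star is that of the unscaled basis. -/
theorem starE_invForm (hl : l ≠ 0) (hm : m ≠ 0) {k j : ℕ} (h : k + j = 7)
    (L : List (ℤ × (Fin k → Fin 7))) (L' : List (ℤ × (Fin j → Fin 7))) (c c' : ℝ)
    (hL : ∀ p ∈ L, StrictMono p.2)
    (hs : ∀ J : Fin j → Fin 7, StrictMono J → starCoeff h L J = coeffOf L' J)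
    (hc : ∀ p ∈ L, (∏ a, if p.2 a < 3 then l else m) = c)
    (hc' : ∀ p ∈ L', (∏ a, if p.2 a < 3 then l else m) = c') (x : E7) :
    starOf (scaledForm l m x) h (c • invForm L x) = c' • invForm L' x := by
  have h1 : ∀ {k : ℕ} (L : List (ℤ × (Fin k → Fin 7))) (c : ℝ), c • invForm L x =
      (c • formOf bBry L).compContinuousLinearMap (coframe x : E7 →L[ℝ] E7) := fun _ _ => rfl
  rw [starOf_eq (scaledForm_apply hl hm x), h1, h1, starE_map,
    ← formOf_scaledBasis hl hm L c hc, ← formOf_scaledBasis hl hm L' c' hc',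
    starE_formOf _ h L L' hL hs]

theorem starOf_add {φ : Alt 3} {k j : ℕ} (h : k + j = 7) (α β : Alt k) :
    starOf φ h (α + β) = starOf φ h α + starOf φ h β :=
  starE_add (adaptedBasis φ) h α β

theorem starOf_smul {φ : Alt 3} {k j : ℕ} (h : k + j = 7) (c : ℝ) (α : Alt k) :
    starOf φ h (c • α) = c • starOf φ h α :=
  starE_smul (adaptedBasis φ) h c α

theorem starOf_mul_smul (φ : Alt 3) {k l : ℕ} (h : k + l = 7) (a b : ℝ) (α : Alt k) :
    starOf φ h ((a * b) • α) = a • starOf φ h (b • α) := by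
  rw [← starOf_smul, mul_smul]

theorem hodge_scaledForm (hl : l ≠ 0) (hm : m ≠ 0) :
    hodge (scaledForm l m) (k := 3) (l := 4) rfl (scaledForm l m) =
      (m ^ 4) • invForm starEtaL + (l ^ 2 * m ^ 2) • invForm starBetaL := by
  ext1 x
  rw [hodge]
  conv_lhs => arg 3; rw [scaledForm]
  rw [starOf_add, starE_invForm hl hm _ etaL starEtaL (l ^ 3) (m ^ 4),
    starE_invForm hl hm _ betaL starBetaL (l * m ^ 2) (l ^ 2 * m ^ 2)]
  · rfl
  · decide
  · exact forall_strictMono_four (by decide +kernel)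
  · intro p hp
    fin_cases hp <;> simp [Fin.prod_univ_three] <;> ring
  · intro p hp
    fin_cases hp <;> simp [Fin.prod_univ_four] <;> ring
  · decide
  · exact forall_strictMono_four (by decide +kernel)
  · intro p hp
    fin_cases hp <;> simp [Fin.prod_univ_three] <;> ring
  · intro p hp
    fin_cases hp <;> simp [Fin.prod_univ_four] <;> ring

/-- The form ∗η is closed, so only d∗β matters. It enters with factor l²m² but has weight l³m²,
while its star has weight m²; the quotient leaves m²/l. -/
theorem torsion_scaledForm (hl : l ≠ 0) (hm : m ≠ 0) :
    torsion (scaledForm l m) = (m ^ 2 / l) • invForm tauL := by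
  have h1 : extD ((m ^ 4) • invForm starEtaL + (l ^ 2 * m ^ 2) • invForm starBetaL) =
      (l ^ 2 * m ^ 2) • invForm dStarL := by
    rw [extD_invForm_add, extD_starEta, extD_starBeta, smul_zero, zero_add]
  have h2 : hodge (scaledForm l m) (k := 5) (l := 2) rfl
      (extD (hodge (scaledForm l m) (k := 3) (l := 4) rfl (scaledForm l m))) =
      (m ^ 2 / l) • invForm negTauL := by
    rw [hodge_scaledForm hl hm, h1]
    ext1 x
    rw [hodge, Pi.smul_apply, Pi.smul_apply,
      -- Splits off the weight of d∗φ, so that the weighted star formula applies.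
      show l ^ 2 * m ^ 2 = l⁻¹ * (l ^ 3 * m ^ 2) by field_simp, starOf_mul_smul,
      starE_invForm hl hm _ dStarL negTauL (l ^ 3 * m ^ 2) (m ^ 2), smul_smul, div_eq_inv_mul]
    · decide
    · exact forall_strictMono_two (by decide +kernel)
    · intro p hp
      fin_cases hp <;> simp [Fin.prod_univ_five] <;> ring
    · intro p hp
      fin_cases hp <;> simp [Fin.prod_univ_two] <;> ring
  rw [torsion_eq h2, invForm_negTau]
  ext x u
  simp only [Pi.smul_apply, Pi.neg_apply, ContinuousAlternatingMap.smul_apply, smul_neg, neg_neg]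

theorem extD_torsion_scaledForm (hl : l ≠ 0) (hm : m ≠ 0) :
    extD (torsion (scaledForm l m)) = (12 * (m ^ 2 / l)) • invForm betaL := by
  rw [torsion_scaledForm hl hm, extD_smul, extD_tau, invForm_dTau, smul_smul, mul_comm]

/-- The η-component of the Laplacian is zero: this is why the flow moves only the coefficient of β.
-/
theorem laplacian_scaledForm (hl : l ≠ 0) (hm : m ≠ 0) :
    laplacian (scaledForm l m) (scaledForm l m) = (12 * (m ^ 2 / l)) • invForm betaL := by
  rw [laplacian_of_closed extD_scaledForm, extD_torsion_scaledForm hl hm]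

theorem isG2Structure_model {φ : Form E7 3} (h : ContDiff ℝ ∞ φ) (hp : ∀ x, IsPositive (φ x)) :
    IsG2Structure φ := by
  refine ⟨fun x => ?_, hp⟩
  rw [localForm_model]
  exact h.contDiffAt

theorem isG2Structure_scaledForm (hl : l ≠ 0) (hm : m ≠ 0) : IsG2Structure (scaledForm l m) :=
  isG2Structure_model contDiff_scaledForm fun x => by
    rw [scaledForm_apply hl hm]
    exact isPositive_phiBry _

end Scaled

/-! ### Bryant's extremally Ricci pinched `G₂`-structure -/

/-- The invariant form `e^123`. -/
def etaForm : Form E7 3 := invForm etaL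

/-- Bryant's invariant `G₂`-structure. -/
def phiForm : Form E7 3 := scaledForm 1 1

theorem phiForm_apply (x : E7) : phiForm x =
    (phiBry bBry).compContinuousLinearMap (coframe x : E7 →L[ℝ] E7) := by
  rw [phiBry_eq_formOf, phiForm, scaledForm]
  simp only [one_pow, mul_one, one_smul]
  rfl

theorem phiForm_eq_add : phiForm = etaForm + invForm betaL := by
  rw [phiForm, scaledForm_eq]
  simp [etaForm]

theorem phiForm_eq_phiBry (x : E7) :
    phiForm x = phiBry (bBry.map (coframe x).symm.toLinearEquiv) := by
  rw [phiForm_apply, phiBry_map]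

theorem torsion_phiForm : torsion phiForm = invForm tauL := by
  rw [phiForm, torsion_scaledForm one_ne_zero one_ne_zero]
  simp

theorem extD_torsion_phiForm : extD (torsion phiForm) = (12 : ℝ) • invForm betaL := by
  rw [torsion_phiForm, extD_tau, invForm_dTau]

theorem laplacian_phiForm : laplacian phiForm phiForm = (12 : ℝ) • phiForm - (12 : ℝ) • etaForm := by
  rw [laplacian_of_closed (φ := phiForm) extD_scaledForm, extD_torsion_phiForm, phiForm_eq_add, smul_add,
    add_sub_cancel_left]

theorem coframe_zero : coframe 0 = ContinuousLinearEquiv.refl ℝ E7 := by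
  ext u i
  rw [coframe_apply]
  fin_cases i <;> simp

theorem comp_coframe_zero {k : ℕ} (α : Alt k) :
    α.compContinuousLinearMap (coframe oBry : E7 →L[ℝ] E7) = α := by
  rw [oBry, coframe_zero]
  rfl

theorem phiForm_zero : phiForm oBry = phiBry bBry := by
  rw [phiForm_apply, comp_coframe_zero]

theorem etaForm_zero : etaForm oBry = dualForm bBry ![0, 1, 2] := by
  rw [etaForm, invForm, comp_coframe_zero]
  simp [formOf, etaL]

theorem torsion_phiForm_zero : torsion phiForm oBry =
    (6 : ℝ) • dualForm bBry ![3, 4] - (6 : ℝ) • dualForm bBry ![5, 6] := by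
  rw [torsion_phiForm, invForm, comp_coframe_zero]
  ext u
  simp only [formOf, tauL, ContinuousAlternatingMap.add_apply,
    ContinuousAlternatingMap.sub_apply, ContinuousAlternatingMap.smul_apply]
  push_cast
  simp only [smul_eq_mul, ContinuousAlternatingMap.coe_zero, Pi.zero_apply]
  ring

/-! ### The pinching identity and the metric at the base point. -/

theorem normSqE_tau (e : Module.Basis (Fin 7) ℝ E7) : normSqE e (formOf e tauL) = 72 := by
  have h : ∑ I ∈ increasing 2, coeffOf tauL I ^ 2 = 72 := by decide +kernel
  rw [normSqE]
  simp only [formOf_basis]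
  exact_mod_cast congrArg (Int.cast : ℤ → ℝ) h

theorem wedgeSq_tau (e : Module.Basis (Fin 7) ℝ E7) :
    wedgeSq e (formOf e tauL) = formOf e [(-72, ![3, 4, 5, 6])] := by
  refine alt_ext_increasing e fun I hI => ?_
  have h : ∑ σ : Equiv.Perm (Fin 4), (Equiv.Perm.sign σ : ℤ) *
      (coeffOf tauL ![I (σ 0), I (σ 1)] * coeffOf tauL ![I (σ 2), I (σ 3)]) =
      4 * coeffOf [(-72, ![3, 4, 5, 6])] I := by
    revert I
    exact forall_strictMono_four (by decide +kernel)
  have h2 : ∀ i j : Fin 7, ![e i, e j] = e ∘ ![i, j] := by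
    intro i j
    ext1 k
    fin_cases k <;> rfl
  rw [wedgeSq_apply, formOf_basis]
  simp only [Function.comp_apply, h2, formOf_basis]
  have h3 := congrArg (Int.cast : ℤ → ℝ) h
  push_cast at h3
  rw [h3]
  ring

theorem star_wedgeSq_tau (e : Module.Basis (Fin 7) ℝ E7) :
    starE e (k := 4) (l := 3) rfl (formOf e [(-72, ![3, 4, 5, 6])]) =
      (-72 : ℝ) • formOf e etaL := by
  rw [starE_formOf e rfl _ [(-72, ![0, 1, 2])]]
  · simp [formOf, etaL]
  · decide
  · exact forall_strictMono_three (by decide +kernel)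

/-- Since |τ|² = 72 and ∗(τ ∧ τ) = -72η, the right side is 12φ - 12η = 12β, which is dτ. The check
takes place in the coframe, by naturality of all operations. -/
theorem isERP_phiForm : IsERP phiForm := by
  refine ⟨extD_scaledForm, fun x => ?_⟩
  rw [extD_torsion_phiForm, torsion_phiForm, phiForm_apply]
  have h1 : invForm tauL x =
    (formOf bBry tauL).compContinuousLinearMap (coframe x : E7 →L[ℝ] E7) := rfl
  rw [h1, normSqTwo_comp (isPositive_phiBry _), wedgeSq_comp bBry,
    starOf_comp (isPositive_phiBry _), normSqTwo_eq rfl, starOf_eq rfl, normSqE_tau, wedgeSq_tau,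
    star_wedgeSq_tau, phiBry_eq_formOf]
  ext u
  simp only [Pi.smul_apply, invForm, ContinuousAlternatingMap.smul_apply,
    ContinuousAlternatingMap.add_apply, ContinuousAlternatingMap.compContinuousLinearMap_apply,
    smul_eq_mul]
  ring

theorem contDiff_phiForm : ContDiff ℝ ∞ (phiForm : E7 → Alt 3) := contDiff_scaledForm

theorem isG2Structure_phiForm : IsG2Structure phiForm :=
  isG2Structure_scaledForm one_ne_zero one_ne_zero

theorem metric_phiForm_apply (x u v : E7) : metric phiForm x ![u, v] =
    ∑ a, bBry.repr (coframe x u) a * bBry.repr (coframe x v) a := by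
  rw [metric, innerOf_eq (phiForm_eq_phiBry x), innerE_apply]
  rfl

theorem metric_phiForm_zero (u v : E7) : metric phiForm oBry ![u, v] =
    ∑ a, bBry.repr u a * bBry.repr v a := by
  rw [metric_phiForm_apply, oBry, coframe_zero]
  rfl

theorem metric_phiForm_basis (i j : Fin 7) :
    metric phiForm oBry ![bBry i, bBry j] = if i = j then 1 else 0 := by
  rw [metric_phiForm_zero]
  simp [Finsupp.single_apply]

theorem exists_torsion_operator :
    ∃ T : E7 →ₗ[ℝ] E7, (∀ u v, metric phiForm oBry ![T u, v] = torsion phiForm oBry ![u, v]) ∧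
      ∀ i, T (T (bBry i)) = (if i < 3 then 0 else -36 : ℝ) • bBry i := by
  -- Read off from τ = 6e^45 - 6e^67: six times a rotation in the plane e_4, e_5 and six times the
  -- opposite rotation in the plane e_6, e_7.
  refine ⟨bBry.constr ℝ ![0, 0, 0, (6 : ℝ) • bBry 4, (-6 : ℝ) • bBry 3, (-6 : ℝ) • bBry 6,
    (6 : ℝ) • bBry 5], fun u v => ?_, fun i => ?_⟩
  · rw [metric_phiForm_zero, torsion_phiForm_zero, ContinuousAlternatingMap.sub_apply,
      ContinuousAlternatingMap.smul_apply, ContinuousAlternatingMap.smul_apply, dualForm_apply,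
      dualForm_apply, Matrix.det_fin_two, Matrix.det_fin_two, Module.Basis.constr_apply_fintype]
    simp [Fin.sum_univ_seven, Finsupp.single_apply]
    ring
  · have hT := bBry.constr_basis ℝ ![0, 0, 0, (6 : ℝ) • bBry 4, (-6 : ℝ) • bBry 3,
      (-6 : ℝ) • bBry 6, (6 : ℝ) • bBry 5]
    generalize bBry.constr ℝ ![0, 0, 0, (6 : ℝ) • bBry 4, (-6 : ℝ) • bBry 3,
      (-6 : ℝ) • bBry 6, (6 : ℝ) • bBry 5] = T at hT ⊢
    have h0 : ∀ i : Fin 7, i < 3 → T (bBry i) = 0 := fun i hi => by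
      rw [hT]
      fin_cases i <;> first | rfl | exact absurd hi (by decide)
    have h3 : T (bBry 3) = (6 : ℝ) • bBry 4 := hT 3
    have h4 : T (bBry 4) = (-6 : ℝ) • bBry 3 := hT 4
    have h5 : T (bBry 5) = (-6 : ℝ) • bBry 6 := hT 5
    have h6 : T (bBry 6) = (6 : ℝ) • bBry 5 := hT 6
    split_ifs with hi
    · rw [h0 i hi, map_zero, zero_smul]
    · obtain rfl | rfl | rfl | rfl : i = 3 ∨ i = 4 ∨ i = 5 ∨ i = 6 := by omega
      · rw [h3, map_smul, h4, smul_smul]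
        norm_num
      · rw [h4, map_smul, h3, smul_smul]
        norm_num
      · rw [h5, map_smul, h6, smul_smul]
        norm_num
      · rw [h6, map_smul, h5, smul_smul]
        norm_num

/-! ### The action of `G` -/

theorem herm_smul (a : GBry) (x : E7) :
    herm (a • x) = linPart a.1.1 * herm x * (linPart a.1.1)ᴴ := herm_act a x

theorem vecPart_smul (a : GBry) (x : E7) :
    vecPart (a • x) = linPart a.1.1 *ᵥ vecPart x + transPart a.1.1 := vec_coords _ _

theorem ext_herm_vecPart {x y : E7} (h : herm x = herm y) (hv : vecPart x = vecPart y) : x = y := by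
  rw [← coords_herm_vec x, ← coords_herm_vec y, h, hv]

/-- The element `(A, v)` of `G`. -/
def mkG (A : Matrix (Fin 2) (Fin 2) ℂ) (v : Fin 2 → ℂ) (hA : A.det = 1) : GBry :=
  ⟨⟨!![A 0 0, A 0 1, v 0; A 1 0, A 1 1, v 1; 0, 0, 1], by
    rw [Matrix.det_fin_two] at hA
    rw [Matrix.det_fin_three]
    simp
    linear_combination hA⟩, rfl, rfl, rfl⟩

theorem linPart_mkG (A : Matrix (Fin 2) (Fin 2) ℂ) (v : Fin 2 → ℂ) (hA : A.det = 1) :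
    linPart (mkG A v hA).1.1 = A := by
  ext i j
  fin_cases i <;> fin_cases j <;> rfl

theorem transPart_mkG (A : Matrix (Fin 2) (Fin 2) ℂ) (v : Fin 2 → ℂ) (hA : A.det = 1) :
    transPart (mkG A v hA).1.1 = v := by
  ext i
  fin_cases i <;> rfl

theorem GBry_ext {a b : GBry} (h : linPart a.1.1 = linPart b.1.1)
    (hv : transPart a.1.1 = transPart b.1.1) : a = b := by
  obtain ⟨a0, a1, a2⟩ := a.2
  obtain ⟨b0, b1, b2⟩ := b.2
  have e00 : a.1.1 0 0 = b.1.1 0 0 := congrFun (congrFun h 0) 0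
  have e01 : a.1.1 0 1 = b.1.1 0 1 := congrFun (congrFun h 0) 1
  have e10 : a.1.1 1 0 = b.1.1 1 0 := congrFun (congrFun h 1) 0
  have e11 : a.1.1 1 1 = b.1.1 1 1 := congrFun (congrFun h 1) 1
  have f0 : a.1.1 0 2 = b.1.1 0 2 := congrFun hv 0
  have f1 : a.1.1 1 2 = b.1.1 1 2 := congrFun hv 1
  apply Subtype.ext
  apply Subtype.ext
  ext i j
  fin_cases i <;> fin_cases j
  exacts [e00, e01, f0, e10, e11, f1, a0.trans b0.symm, a1.trans b1.symm, a2.trans b2.symm]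

/-- The lower triangular matrix `L` with `L Lᴴ = herm x`. -/
def lowerTri (x : E7) : Matrix (Fin 2) (Fin 2) ℂ :=
  !![(Real.exp (x 0 / 2) : ℂ), 0;
    (Real.exp (-(x 0 / 2)) : ℂ) * ⟨x 1, -x 2⟩, (Real.exp (-(x 0 / 2)) : ℂ)]

theorem exp_half_mul (s : ℝ) : Real.exp (-(s / 2)) * Real.exp (s / 2) = 1 := by
  rw [← Real.exp_add]
  simp

theorem det_lowerTri (x : E7) : (lowerTri x).det = 1 := by
  rw [Matrix.det_fin_two, lowerTri]
  have h := exp_half_mul (x 0)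
  simp [-Complex.ofReal_exp]
  rw [mul_comm]
  exact_mod_cast h

theorem lowerTri_mul (x : E7) : lowerTri x * (lowerTri x)ᴴ = herm x := by
  have h := exp_half_mul (x 0)
  have h1 : Real.exp (x 0) = Real.exp (x 0 / 2) * Real.exp (x 0 / 2) := by
    rw [← Real.exp_add]
    ring_nf
  have h2 : Real.exp (-x 0) = Real.exp (-(x 0 / 2)) * Real.exp (-(x 0 / 2)) := by
    rw [← Real.exp_add]
    ring_nf
  rw [herm, h1, h2, lowerTri]
  generalize Real.exp (-(x 0 / 2)) = p at *
  generalize Real.exp (x 0 / 2) = q at *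
  ext i j
  fin_cases i <;> fin_cases j <;>
    simp [Matrix.mul_apply, Fin.sum_univ_two, Complex.ext_iff]
  · exact ⟨by linear_combination x 1 * h, by linear_combination x 2 * h⟩
  · exact ⟨by linear_combination x 1 * h, by linear_combination x 2 * h⟩
  · exact ⟨by ring, by ring⟩

/-- An element of `G` which moves the base point to `x`. -/
def sectionG (x : E7) : GBry := mkG (lowerTri x) (vecPart x) (det_lowerTri x)

theorem herm_zero : herm oBry = 1 := by
  ext i j
  fin_cases i <;> fin_cases j <;> simp [herm, oBry, Complex.ext_iff]

theorem vecPart_zero : vecPart oBry = 0 := by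
  ext i
  fin_cases i <;> simp [vecPart, oBry, Complex.ext_iff]

theorem herm_smul_zero (a : GBry) : herm (a • oBry) = linPart a.1.1 * (linPart a.1.1)ᴴ := by
  rw [herm_smul, herm_zero, mul_one]

theorem vecPart_smul_zero (a : GBry) : vecPart (a • oBry) = transPart a.1.1 := by
  rw [vecPart_smul, vecPart_zero, Matrix.mulVec_zero, zero_add]

theorem sectionG_smul (x : E7) : sectionG x • oBry = x := by
  apply ext_herm_vecPart
  · rw [herm_smul_zero, sectionG, linPart_mkG, lowerTri_mul]
  · rw [vecPart_smul_zero, sectionG, transPart_mkG]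

theorem isPretransitive_G : MulAction.IsPretransitive GBry E7 :=
  ⟨fun x y => ⟨sectionG y * (sectionG x)⁻¹, by
    rw [mul_smul, inv_smul_eq_iff.2 (sectionG_smul x).symm, sectionG_smul]⟩⟩

theorem mem_KBry_iff (a : GBry) : a ∈ KBry ↔
    linPart a.1.1 * (linPart a.1.1)ᴴ = 1 ∧ transPart a.1.1 = 0 := by
  obtain ⟨a0, a1, a2⟩ := a.2
  have h1 : a ∈ KBry ↔ (a.1.1)ᴴ * a.1.1 = 1 := Iff.rfl
  rw [h1, mul_eq_one_comm]
  constructor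
  · intro h
    have h' := mul_eq_one_comm.1 h
    -- The last column of a unitary matrix has norm one and its last entry is already 1, so the
    -- translation part vanishes.
    have h22 := congrFun (congrFun h' 2) 2
    simp [Matrix.mul_apply, Fin.sum_univ_three, a2, Complex.ext_iff] at h22
    have hv : a.1.1 0 2 = 0 ∧ a.1.1 1 2 = 0 := by
      constructor <;> apply Complex.ext <;> simp <;> nlinarith [h22.1]
    have hE := fun i j : Fin 3 => congrFun (congrFun h i) j
    simp only [Matrix.mul_apply, Fin.sum_univ_three, Matrix.conjTranspose_apply] at hE
    refine ⟨?_, ?_⟩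
    · ext i j
      fin_cases i <;> fin_cases j
      · simpa [Matrix.mul_apply, linPart, hv] using hE 0 0
      · simpa [Matrix.mul_apply, linPart, hv] using hE 0 1
      · simpa [Matrix.mul_apply, linPart, hv] using hE 1 0
      · simpa [Matrix.mul_apply, linPart, hv] using hE 1 1
    · ext i
      fin_cases i
      exacts [hv.1, hv.2]
  · rintro ⟨h, hv⟩
    have hv0 : a.1.1 0 2 = 0 := congrFun hv 0
    have hv1 : a.1.1 1 2 = 0 := congrFun hv 1
    have hE := fun i j : Fin 2 => congrFun (congrFun h i) j
    simp only [Matrix.mul_apply, Fin.sum_univ_two, Matrix.conjTranspose_apply] at hE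
    ext i j
    fin_cases i <;> fin_cases j <;>
      simp [Matrix.mul_apply, Fin.sum_univ_three, a0, a1, a2, hv0, hv1]
    · simpa [linPart] using hE 0 0
    · simpa [linPart] using hE 0 1
    · simpa [linPart] using hE 1 0
    · simpa [linPart] using hE 1 1

/-- The point a • o is (AA*, v); it equals (I, 0) exactly when A is unitary and v = 0. -/
theorem stabilizer_eq : MulAction.stabilizer GBry oBry = KBry := by
  ext a
  rw [MulAction.mem_stabilizer_iff, mem_KBry_iff, ← herm_smul_zero, ← vecPart_smul_zero]
  constructor
  · intro h
    rw [h]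
    exact ⟨herm_zero, vecPart_zero⟩
  · rintro ⟨h, hv⟩
    exact ext_herm_vecPart (h.trans herm_zero.symm) (hv.trans vecPart_zero.symm)

theorem contDiff_complex_mk {f g : E7 → ℝ} (hf : ContDiff ℝ ∞ f) (hg : ContDiff ℝ ∞ g) :
    ContDiff ℝ ∞ fun x => (⟨f x, g x⟩ : ℂ) :=
  Complex.equivRealProdCLM.symm.contDiff.comp (hf.prodMk hg)

theorem contDiff_herm (i j : Fin 2) : ContDiff ℝ ∞ fun x => herm x i j := by
  have h := contDiff_coord
  have h0 : ContDiff ℝ ∞ fun x : E7 => Real.exp (-x 0) := (h 0).neg.exp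
  fin_cases i <;> fin_cases j
  · exact contDiff_complex_mk (h 0).exp contDiff_const
  · exact contDiff_complex_mk (h 1) (h 2)
  · exact contDiff_complex_mk (h 1) (h 2).neg
  · exact contDiff_complex_mk (((contDiff_const.add ((h 1).pow 2)).add ((h 2).pow 2)).mul h0)
      contDiff_const

theorem contDiff_vecPart (i : Fin 2) : ContDiff ℝ ∞ fun x => vecPart x i := by
  have h := contDiff_coord
  fin_cases i
  · exact contDiff_complex_mk (h 3) (h 4)
  · exact contDiff_complex_mk (h 5) (h 6)

/-- The entries of APA* and Aw + v are smooth in the coordinates, and the logarithm is applied to a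
positive entry. -/
theorem contDiff_smul_G (a : GBry) : ContDiff ℝ ∞ fun x : E7 => a • x := by
  have hre : ∀ {f : E7 → ℂ}, ContDiff ℝ ∞ f → ContDiff ℝ ∞ fun x => (f x).re :=
    fun hf => Complex.reCLM.contDiff.comp hf
  have him : ∀ {f : E7 → ℂ}, ContDiff ℝ ∞ f → ContDiff ℝ ∞ fun x => (f x).im :=
    fun hf => Complex.imCLM.contDiff.comp hf
  have hP : ∀ i j, ContDiff ℝ ∞ fun x => (linPart a.1.1 * herm x * (linPart a.1.1)ᴴ) i j := by
    intro i j
    simp only [Matrix.mul_apply, Fin.sum_univ_two]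
    exact ((((contDiff_const.mul (contDiff_herm _ _)).add
      (contDiff_const.mul (contDiff_herm _ _))).mul contDiff_const).add
      (((contDiff_const.mul (contDiff_herm _ _)).add
      (contDiff_const.mul (contDiff_herm _ _))).mul contDiff_const))
  have hv : ∀ i, ContDiff ℝ ∞ fun x => (linPart a.1.1 *ᵥ vecPart x + transPart a.1.1) i := by
    intro i
    simp only [Pi.add_apply, Matrix.mulVec, dotProduct, Fin.sum_univ_two]
    exact ((contDiff_const.mul (contDiff_vecPart _)).add
      (contDiff_const.mul (contDiff_vecPart _))).add contDiff_const
  rw [contDiff_euclidean]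
  intro i
  fin_cases i
  · exact (hre (hP 0 0)).log fun x => (herm_act_pos a x).ne'
  · exact hre (hP 0 1)
  · exact him (hP 0 1)
  · exact hre (hv 0)
  · exact him (hv 0)
  · exact hre (hv 1)
  · exact him (hv 1)

/-! ### The Lie algebra of `G` -/

/-- The element `(X, u)` of `𝔤`. -/
def mkLie (X : Matrix (Fin 2) (Fin 2) ℂ) (u : Fin 2 → ℂ) (hX : X 0 0 + X 1 1 = 0) : gBry :=
  ⟨!![X 0 0, X 0 1, u 0; X 1 0, X 1 1, u 1; 0, 0, 0], rfl, rfl, rfl, hX⟩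

theorem linPart_mkLie (X : Matrix (Fin 2) (Fin 2) ℂ) (u : Fin 2 → ℂ) (hX : X 0 0 + X 1 1 = 0) :
    linPart (mkLie X u hX).1 = X := by
  ext i j
  fin_cases i <;> fin_cases j <;> rfl

theorem transPart_mkLie (X : Matrix (Fin 2) (Fin 2) ℂ) (u : Fin 2 → ℂ) (hX : X 0 0 + X 1 1 = 0) :
    transPart (mkLie X u hX).1 = u := by
  ext i
  fin_cases i <;> rfl

theorem gBry_ext {a b : gBry} (h : linPart a.1 = linPart b.1)
    (hv : transPart a.1 = transPart b.1) : a = b := by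
  obtain ⟨a0, a1, a2, -⟩ := a.2
  obtain ⟨b0, b1, b2, -⟩ := b.2
  have e00 : a.1 0 0 = b.1 0 0 := congrFun (congrFun h 0) 0
  have e01 : a.1 0 1 = b.1 0 1 := congrFun (congrFun h 0) 1
  have e10 : a.1 1 0 = b.1 1 0 := congrFun (congrFun h 1) 0
  have e11 : a.1 1 1 = b.1 1 1 := congrFun (congrFun h 1) 1
  have f0 : a.1 0 2 = b.1 0 2 := congrFun hv 0
  have f1 : a.1 1 2 = b.1 1 2 := congrFun hv 1
  apply Subtype.ext
  ext i j
  fin_cases i <;> fin_cases j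
  exacts [e00, e01, f0, e10, e11, f1, a0.trans b0.symm, a1.trans b1.symm, a2.trans b2.symm]

theorem linPart_add (a b : Matrix (Fin 3) (Fin 3) ℂ) :
    linPart (a + b) = linPart a + linPart b := by
  ext i j
  fin_cases i <;> fin_cases j <;> rfl

theorem transPart_add (a b : Matrix (Fin 3) (Fin 3) ℂ) :
    transPart (a + b) = transPart a + transPart b := by
  ext i
  fin_cases i <;> rfl

theorem linPart_smul (c : ℝ) (a : Matrix (Fin 3) (Fin 3) ℂ) :
    linPart (c • a) = c • linPart a := by
  ext i j
  fin_cases i <;> fin_cases j <;> rfl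

theorem transPart_smul (c : ℝ) (a : Matrix (Fin 3) (Fin 3) ℂ) :
    transPart (c • a) = c • transPart a := by
  ext i
  fin_cases i <;> rfl

theorem coe_add_g (a b : gBry) : (a + b).1 = a.1 + b.1 := rfl

theorem coe_sub_g (a b : gBry) : (a - b).1 = a.1 - b.1 := rfl

theorem coe_smul_g (c : ℝ) (a : gBry) : (c • a).1 = c • a.1 := rfl

theorem linPart_lie (a b : gBry) :
    linPart ⁅a, b⁆.1 = linPart a.1 * linPart b.1 - linPart b.1 * linPart a.1 := by
  obtain ⟨a0, a1, a2, -⟩ := a.2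
  obtain ⟨b0, b1, b2, -⟩ := b.2
  have h : (⁅a, b⁆ : gBry).1 = a.1 * b.1 - b.1 * a.1 := rfl
  rw [h, ← linPart_mul _ _ a0 a1, ← linPart_mul _ _ b0 b1]
  ext i j
  fin_cases i <;> fin_cases j <;> rfl

theorem transPart_lie (a b : gBry) :
    transPart ⁅a, b⁆.1 = linPart a.1 *ᵥ transPart b.1 - linPart b.1 *ᵥ transPart a.1 := by
  obtain ⟨-, -, a2, -⟩ := a.2
  obtain ⟨-, -, b2, -⟩ := b.2
  have h : (⁅a, b⁆ : gBry).1 = a.1 * b.1 - b.1 * a.1 := rfl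
  rw [h]
  ext i
  fin_cases i <;>
    simp [linPart, transPart, Matrix.mul_apply, Fin.sum_univ_three, a2, b2, Matrix.vecHead,
      Matrix.vecTail] <;> ring

theorem mem_kBry_iff (Y : gBry) :
    Y ∈ kBry ↔ (linPart Y.1)ᴴ = -linPart Y.1 ∧ transPart Y.1 = 0 := by
  obtain ⟨a0, a1, a2, -⟩ := Y.2
  have h1 : Y ∈ kBry ↔ (Y.1)ᴴ = -Y.1 := Iff.rfl
  rw [h1]
  constructor
  · intro h
    have hE := fun i j : Fin 3 => congrFun (congrFun h i) j
    simp only [Matrix.conjTranspose_apply, Matrix.neg_apply] at hE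
    constructor
    · ext i j
      fin_cases i <;> fin_cases j
      exacts [hE 0 0, hE 0 1, hE 1 0, hE 1 1]
    · ext i
      fin_cases i
      · change Y.1 0 2 = 0
        simpa [a0] using (hE 0 2).symm
      · change Y.1 1 2 = 0
        simpa [a1] using (hE 1 2).symm
  · rintro ⟨h, hv⟩
    have hv0 : Y.1 0 2 = 0 := congrFun hv 0
    have hv1 : Y.1 1 2 = 0 := congrFun hv 1
    have hE := fun i j : Fin 2 => congrFun (congrFun h i) j
    ext i j
    fin_cases i <;> fin_cases j <;> simp [a0, a1, a2, hv0, hv1]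
    exacts [hE 0 0, hE 0 1, hE 1 0, hE 1 1]

theorem mem_pBry_iff (Y : gBry) : Y ∈ pBry ↔ (linPart Y.1)ᴴ = linPart Y.1 := Iff.rfl

theorem isCompl_kBry_pBry : IsCompl kBry pBry := by
  constructor
  · rw [Submodule.disjoint_def]
    intro Y hk hp
    rw [mem_kBry_iff] at hk
    rw [mem_pBry_iff, hk.1] at hp
    have h0 : linPart Y.1 = 0 := by
      ext i j
      have := congrFun (congrFun hp i) j
      rwa [Matrix.neg_apply, neg_eq_self] at this
    exact gBry_ext (h0.trans (by ext i j; fin_cases i <;> fin_cases j <;> rfl))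
      (hk.2.trans (by ext i; fin_cases i <;> rfl))
  · rw [codisjoint_iff, eq_top_iff]
    intro Y _
    obtain ⟨-, -, -, ht⟩ := Y.2
    set X := linPart Y.1 with hX
    have ht' : X 0 0 + X 1 1 = 0 := ht
    have htc : star (X 0 0) + star (X 1 1) = 0 := by rw [← star_add, ht', star_zero]
    rw [Submodule.mem_sup]
    -- The skew-Hermitian and the Hermitian half of X; the translation part goes to 𝔭.
    refine ⟨mkLie ((1 / 2 : ℂ) • (X - Xᴴ)) 0 ?_, ?_, mkLie ((1 / 2 : ℂ) • (X + Xᴴ))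
      (transPart Y.1) ?_, ?_, ?_⟩
    · simp only [Matrix.smul_apply, Matrix.sub_apply, Matrix.conjTranspose_apply, smul_eq_mul]
      linear_combination (1 / 2 : ℂ) * ht' - (1 / 2 : ℂ) * htc
    · rw [mem_kBry_iff, linPart_mkLie, transPart_mkLie]
      refine ⟨?_, rfl⟩
      ext i j
      simp
      ring
    · simp only [Matrix.smul_apply, Matrix.add_apply, Matrix.conjTranspose_apply, smul_eq_mul]
      linear_combination (1 / 2 : ℂ) * ht' + (1 / 2 : ℂ) * htc
    · rw [mem_pBry_iff, linPart_mkLie]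
      ext i j
      simp
      ring
    · apply gBry_ext
      · rw [coe_add_g, linPart_add, linPart_mkLie, linPart_mkLie, ← hX]
        ext i j
        simp
        ring
      · rw [coe_add_g, transPart_add, transPart_mkLie, transPart_mkLie, zero_add]

theorem lie_kBry_pBry : ∀ Z ∈ kBry, ∀ Y ∈ pBry, ⁅Z, Y⁆ ∈ pBry := by
  intro Z hZ Y hY
  rw [mem_kBry_iff] at hZ
  rw [mem_pBry_iff] at *
  rw [linPart_lie, Matrix.conjTranspose_sub, Matrix.conjTranspose_mul, Matrix.conjTranspose_mul,
    hZ.1, hY]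
  simp only [Matrix.mul_neg, Matrix.neg_mul]
  abel

/-- The projection of `𝔤` onto `ℂ²`, scaled by `r`. -/
def scaleLie (r : ℝ) (Y : gBry) : gBry := mkLie 0 (r • transPart Y.1) (by simp)

theorem linPart_scaleLie (r : ℝ) (Y : gBry) : linPart (scaleLie r Y).1 = 0 :=
  linPart_mkLie _ _ _

theorem transPart_scaleLie (r : ℝ) (Y : gBry) :
    transPart (scaleLie r Y).1 = r • transPart Y.1 :=
  transPart_mkLie _ _ _

/-- The derivation of `𝔤` which vanishes on `𝔰𝔩₂(ℂ)` and is `r` times the identity on `ℂ²`. -/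
def blockDerivation (r : ℝ) : LieDerivation ℝ gBry gBry where
  toFun := scaleLie r
  map_add' Y Z := by
    apply gBry_ext
    · rw [coe_add_g, linPart_add, linPart_scaleLie, linPart_scaleLie, linPart_scaleLie, add_zero]
    · rw [coe_add_g, transPart_add, transPart_scaleLie, transPart_scaleLie, transPart_scaleLie,
        coe_add_g, transPart_add, smul_add]
  map_smul' c Y := by
    rw [RingHom.id_apply]
    apply gBry_ext
    · rw [coe_smul_g, linPart_smul, linPart_scaleLie, linPart_scaleLie, smul_zero]
    · rw [coe_smul_g, transPart_smul, transPart_scaleLie, transPart_scaleLie, coe_smul_g,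
        transPart_smul, smul_comm]
  leibniz' Y Z := by
    change scaleLie r ⁅Y, Z⁆ = ⁅Y, scaleLie r Z⁆ - ⁅Z, scaleLie r Y⁆
    apply gBry_ext
    · rw [coe_sub_g, sub_eq_add_neg, linPart_add, ← neg_one_smul ℝ, linPart_smul,
        linPart_lie, linPart_lie, linPart_scaleLie, linPart_scaleLie, linPart_scaleLie]
      simp
    · rw [coe_sub_g, sub_eq_add_neg, transPart_add, ← neg_one_smul ℝ, transPart_smul,
        transPart_lie, transPart_lie, linPart_scaleLie, linPart_scaleLie, transPart_scaleLie,
        transPart_scaleLie, transPart_scaleLie, transPart_lie, smul_sub, Matrix.mulVec_smul,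
        Matrix.mulVec_smul, Matrix.zero_mulVec, Matrix.zero_mulVec, sub_zero, sub_zero,
        neg_one_smul, sub_eq_add_neg]

theorem linPart_blockDerivation (r : ℝ) (Y : gBry) : linPart (blockDerivation r Y).1 = 0 :=
  linPart_scaleLie r Y

theorem transPart_blockDerivation (r : ℝ) (Y : gBry) :
    transPart (blockDerivation r Y).1 = r • transPart Y.1 :=
  transPart_scaleLie r Y

theorem linPart_zero : linPart 0 = 0 := by
  ext i j
  fin_cases i <;> fin_cases j <;> rfl

theorem transPart_zero : transPart 0 = 0 := by
  ext i
  fin_cases i <;> rfl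

theorem blockDerivation_eq_zero (r : ℝ) {Y : gBry} (h : transPart Y.1 = 0) :
    blockDerivation r Y = 0 := by
  apply gBry_ext
  · rw [linPart_blockDerivation]
    exact linPart_zero.symm
  · rw [transPart_blockDerivation, h, smul_zero]
    exact transPart_zero.symm

theorem isBlockScalar_blockDerivation (r : ℝ) : IsBlockScalar (blockDerivation r) r := by
  refine ⟨fun Y hY => blockDerivation_eq_zero r hY, fun Y hY => ?_⟩
  apply gBry_ext
  · rw [linPart_blockDerivation, coe_smul_g, linPart_smul, hY, smul_zero]
  · rw [transPart_blockDerivation, coe_smul_g, transPart_smul]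

theorem blockDerivation_kBry (r : ℝ) : ∀ Y ∈ kBry, blockDerivation r Y = 0 := fun Y hY =>
  blockDerivation_eq_zero r ((mem_kBry_iff Y).1 hY).2

theorem blockDerivation_pBry (r : ℝ) : ∀ Y ∈ pBry, blockDerivation r Y ∈ pBry := by
  intro Y _
  rw [mem_pBry_iff, linPart_blockDerivation, Matrix.conjTranspose_zero]

/-! ### The identification of `𝔭` with the tangent space -/

theorem hasDerivAt_E7 {f : ℝ → E7} {f' : E7} {t : ℝ}
    (h : ∀ i, HasDerivAt (fun s => f s i) (f' i) t) : HasDerivAt f f' t := by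
  rw [hasDerivAt_iff_hasFDerivAt, ← hasFDerivWithinAt_univ, hasFDerivWithinAt_euclidean]
  intro i
  refine (h i).hasFDerivAt.hasFDerivWithinAt.congr_fderiv ?_
  ext
  simp

section Exp

attribute [local instance] Matrix.linftyOpNormedRing Matrix.linftyOpNormedAlgebra

theorem hasDerivAt_exp_smul (Y : Matrix (Fin 3) (Fin 3) ℂ) (i j : Fin 3) :
    HasDerivAt (fun t : ℝ => NormedSpace.exp (t • Y) i j) (Y i j) 0 := by
  have h := hasDerivAt_exp_smul_const (𝕂 := ℝ) Y (0 : ℝ)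
  rw [zero_smul, NormedSpace.exp_zero, one_mul] at h
  have h1 := hasDerivAt_pi.1 (hasDerivAt_pi.1 h i) j
  exact h1

end Exp

/-- The derivative of (AA*, v) at the identity is (Y + Y*, u); this is the source of the factor 2
and of the sums of opposite entries. -/
theorem tang_eq (Y : Matrix (Fin 3) (Fin 3) ℂ) : tang Y =
    !₂[2 * (Y 0 0).re, (Y 0 1).re + (Y 1 0).re, (Y 0 1).im - (Y 1 0).im, (Y 0 2).re, (Y 0 2).im,
      (Y 1 2).re, (Y 1 2).im] := by
  apply HasDerivAt.deriv
  have h := hasDerivAt_exp_smul Y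
  have hr : ∀ i j : Fin 3, HasDerivAt (fun t : ℝ => (NormedSpace.exp (t • Y) i j).re)
      (Y i j).re 0 := fun i j => Complex.reCLM.hasFDerivAt.comp_hasDerivAt _ (h i j)
  have hi : ∀ i j : Fin 3, HasDerivAt (fun t : ℝ => (NormedSpace.exp (t • Y) i j).im)
      (Y i j).im 0 := fun i j => Complex.imCLM.hasFDerivAt.comp_hasDerivAt _ (h i j)
  have hact : ∀ g : Matrix (Fin 3) (Fin 3) ℂ, act g oBry = !₂[Real.log ((g 0 0).re * (g 0 0).re +
      (g 0 0).im * (g 0 0).im + ((g 0 1).re * (g 0 1).re + (g 0 1).im * (g 0 1).im)),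
      (g 0 0).re * (g 1 0).re + (g 0 0).im * (g 1 0).im + ((g 0 1).re * (g 1 1).re +
      (g 0 1).im * (g 1 1).im),
      (g 0 0).im * (g 1 0).re - (g 0 0).re * (g 1 0).im + ((g 0 1).im * (g 1 1).re -
      (g 0 1).re * (g 1 1).im),
      (g 0 2).re, (g 0 2).im, (g 1 2).re, (g 1 2).im] := by
    intro g
    rw [act, herm_zero, vecPart_zero]
    ext i
    fin_cases i <;> simp [coords, linPart, transPart, Matrix.mul_apply]
    ring
  simp only [hact]
  apply hasDerivAt_E7
  intro k
  fin_cases k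
  · refine (((((hr 0 0).mul (hr 0 0)).add ((hi 0 0).mul (hi 0 0))).add
      (((hr 0 1).mul (hr 0 1)).add ((hi 0 1).mul (hi 0 1)))).log ?_).congr_deriv ?_
    · simp
    · simp
      ring
  · refine ((((hr 0 0).mul (hr 1 0)).add ((hi 0 0).mul (hi 1 0))).add
      (((hr 0 1).mul (hr 1 1)).add ((hi 0 1).mul (hi 1 1)))).congr_deriv ?_
    simp
    ring
  · refine ((((hi 0 0).mul (hr 1 0)).sub ((hr 0 0).mul (hi 1 0))).add
      (((hi 0 1).mul (hr 1 1)).sub ((hr 0 1).mul (hi 1 1)))).congr_deriv ?_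
    simp
    ring
  · exact hr 0 2
  · exact hi 0 2
  · exact hr 1 2
  · exact hi 1 2

theorem bBry_eq_tang (i : Fin 7) : bBry i = tang (pMat i) := by
  rw [tang_eq, bBry_apply]
  ext j
  fin_cases i <;> fin_cases j <;> simp [pMat] <;> norm_num

/-! ### The operator of the soliton -/

/-- The operator `Diag(0, 0, 0, r, r, r, r)`. -/
def fiberScale (r : ℝ) : E7 →ₗ[ℝ] E7 where
  toFun u := !₂[0, 0, 0, r * u 3, r * u 4, r * u 5, r * u 6]
  map_add' u v := by
    ext i
    fin_cases i <;> simp <;> ring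
  map_smul' c u := by
    ext i
    fin_cases i <;> simp <;> ring

theorem fiberScale_apply (r : ℝ) (u : E7) :
    fiberScale r u = !₂[0, 0, 0, r * u 3, r * u 4, r * u 5, r * u 6] := rfl

theorem repr_fiberScale (r : ℝ) (u : E7) (i : Fin 7) :
    bBry.repr (fiberScale r u) i = (if i < 3 then 0 else r) * bBry.repr u i := by
  rw [bBry_repr, bBry_repr, fiberScale_apply]
  fin_cases i <;> simp

theorem fiberScale_basis (r : ℝ) (i : Fin 7) :
    fiberScale r (bBry i) = (if i < 3 then 0 else r : ℝ) • bBry i := by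
  apply bBry.repr.injective
  ext j
  rw [repr_fiberScale, map_smul, Finsupp.smul_apply, Module.Basis.repr_self, smul_eq_mul,
    Finsupp.single_apply]
  by_cases h : i = j
  · subst h
    rfl
  · simp [h]

theorem tang_blockDerivation (r : ℝ) (Y : gBry) :
    tang (blockDerivation r Y).1 = fiberScale r (tang Y.1) := by
  have hl := linPart_blockDerivation r Y
  have ht := transPart_blockDerivation r Y
  have e00 : (blockDerivation r Y).1 0 0 = 0 := congrFun (congrFun hl 0) 0
  have e01 : (blockDerivation r Y).1 0 1 = 0 := congrFun (congrFun hl 0) 1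
  have e10 : (blockDerivation r Y).1 1 0 = 0 := congrFun (congrFun hl 1) 0
  have f0 : (blockDerivation r Y).1 0 2 = r • Y.1 0 2 := congrFun ht 0
  have f1 : (blockDerivation r Y).1 1 2 = r • Y.1 1 2 := congrFun ht 1
  rw [tang_eq, tang_eq, fiberScale_apply, e00, e01, e10, f0, f1]
  ext i
  fin_cases i <;> simp

theorem metric_fiberScale (r : ℝ) (u v : E7) :
    metric phiForm oBry ![fiberScale r u, v] = metric phiForm oBry ![u, fiberScale r v] := by
  rw [metric_phiForm_zero, metric_phiForm_zero]
  refine Finset.sum_congr rfl fun i _ => ?_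
  rw [repr_fiberScale, repr_fiberScale]
  ring

/-- A diagonal operator acts on e^J, as a derivation of forms, by the sum of its eigenvalues. -/
theorem theta_dualForm (e : Module.Basis (Fin 7) ℝ E7) {A : E7 →ₗ[ℝ] E7} {w : Fin 7 → ℝ}
    (hA : ∀ u i, e.repr (A u) i = w i * e.repr u i) (J : Fin 3 → Fin 7) (u : Fin 3 → E7) :
    ∑ j, dualForm e J (Function.update u j (A (u j))) =
      (w (J 0) + w (J 1) + w (J 2)) * dualForm e J u := by
  simp only [dualForm_apply, Matrix.det_fin_three, Matrix.of_apply, Fin.sum_univ_three]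
  simp [Function.update, hA]
  ring

/-- Each term of β has two fibre indices and η has none, so θ sends φ to -2(-6)β = 12β. -/
theorem isTheta_fiberScale : IsTheta (fiberScale (-6)) (phiForm oBry)
    (extD (torsion phiForm) oBry) := by
  intro u
  rw [extD_torsion_phiForm, phiForm_zero, Pi.smul_apply, invForm, comp_coframe_zero]
  simp only [phiBry, ContinuousAlternatingMap.add_apply, ContinuousAlternatingMap.sub_apply,
    Finset.sum_add_distrib, Finset.sum_sub_distrib, theta_dualForm bBry (repr_fiberScale (-6)),
    ContinuousAlternatingMap.smul_apply, formOf, betaL]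
  simp only [Matrix.cons_val, smul_eq_mul, ContinuousAlternatingMap.coe_zero, Pi.zero_apply]
  simp
  ring

theorem exists_soliton_operator :
    ∃ (Q : E7 →ₗ[ℝ] E7) (D : LieDerivation ℝ gBry gBry), IsQ phiForm Q ∧
        (∀ i, Q (bBry i) = (if i < 3 then 0 else -6 : ℝ) • bBry i) ∧
        IsBlockScalar D (-6) ∧ (∀ Y ∈ pBry, Q (tang Y.1) = tang (D Y).1) ∧
        IsAlgebraicFor phiForm Q 0 D := by
  refine ⟨fiberScale (-6), blockDerivation (-6), ⟨metric_fiberScale (-6), isTheta_fiberScale⟩,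
    fiberScale_basis (-6), isBlockScalar_blockDerivation (-6),
    fun Y _ => (tang_blockDerivation (-6) Y).symm, blockDerivation_kBry (-6),
    blockDerivation_pBry (-6), blockDerivation (-6), blockDerivation_kBry (-6),
    blockDerivation_pBry (-6), fun Y _ Z _ => ?_, fun Y _ => ?_⟩
  · rw [tang_blockDerivation, tang_blockDerivation]
    exact metric_fiberScale (-6) _ _
  -- The operator is symmetric, hence D^t = D and half the sum is D itself.
  · rw [tang_blockDerivation, zero_smul, zero_add, ← two_smul ℝ, smul_smul]
    norm_num

/-! ### Invariance -/

/-- The traceless Hermitian matrix with coordinates `y_0, y_1, y_2`. -/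
def hermHat (y : E7) : Matrix (Fin 2) (Fin 2) ℂ :=
  !![⟨y 0, 0⟩, ⟨y 1, y 2⟩; ⟨y 1, -y 2⟩, ⟨-y 0, 0⟩]

theorem ext_hermHat {x y : E7} (h : hermHat x = hermHat y) (hv : vecPart x = vecPart y) :
    x = y := by
  have h0 : x 0 = y 0 := congrArg Complex.re (congrFun (congrFun h 0) 0)
  have h1 : x 1 = y 1 := congrArg Complex.re (congrFun (congrFun h 0) 1)
  have h2 : x 2 = y 2 := congrArg Complex.im (congrFun (congrFun h 0) 1)
  have h3 : x 3 = y 3 := congrArg Complex.re (congrFun hv 0)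
  have h4 : x 4 = y 4 := congrArg Complex.im (congrFun hv 0)
  have h5 : x 5 = y 5 := congrArg Complex.re (congrFun hv 1)
  have h6 : x 6 = y 6 := congrArg Complex.im (congrFun hv 1)
  ext i
  fin_cases i
  exacts [h0, h1, h2, h3, h4, h5, h6]

theorem hasDerivAt_complex_mk {f g : ℝ → ℝ} {f' g' t : ℝ} (hf : HasDerivAt f f' t)
    (hg : HasDerivAt g g' t) :
    HasDerivAt (fun s => (⟨f s, g s⟩ : ℂ)) ⟨f', g'⟩ t :=
  Complex.equivRealProdCLM.symm.hasFDerivAt.comp_hasDerivAt t (hf.prodMk hg)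

section Curve

variable {γ : ℝ → E7} {u : E7}

theorem hasDerivAt_coord (h : HasDerivAt γ u 0) (i : Fin 7) :
    HasDerivAt (fun t => γ t i) (u i) 0 :=
  (EuclideanSpace.proj i : E7 →L[ℝ] ℝ).hasFDerivAt.comp_hasDerivAt 0 h

/-- Moving P = LL* back to the identity by L turns dP into L⁻¹(dP)L⁻*, the traceless Hermitian
matrix of the coframe components. -/
theorem hasDerivAt_herm {x : E7} (hx : γ 0 = x) (h : HasDerivAt γ u 0) (i j : Fin 2) :
    HasDerivAt (fun t => herm (γ t) i j)
      ((lowerTri x * hermHat (coframe x u) * (lowerTri x)ᴴ) i j) 0 := by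
  have hc := hasDerivAt_coord h
  have he : HasDerivAt (fun t => Real.exp (γ t 0)) (Real.exp (x 0) * u 0) 0 := by
    simpa [hx] using (hc 0).exp
  have hn : HasDerivAt (fun t => Real.exp (-γ t 0)) (Real.exp (-x 0) * -u 0) 0 := by
    simpa [hx] using (hc 0).fun_neg.exp
  have hp := exp_half_mul (x 0)
  have h1 : Real.exp (x 0) = Real.exp (x 0 / 2) * Real.exp (x 0 / 2) := by
    rw [← Real.exp_add]
    ring_nf
  have h2 : Real.exp (-x 0) = Real.exp (-(x 0 / 2)) * Real.exp (-(x 0 / 2)) := by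
    rw [← Real.exp_add]
    ring_nf
  rw [h1] at he
  have hq : HasDerivAt (fun t => (1 + γ t 1 ^ 2 + γ t 2 ^ 2) * Real.exp (-γ t 0))
      ((2 * x 1 * u 1 + 2 * x 2 * u 2) * Real.exp (-x 0) +
        (1 + x 1 ^ 2 + x 2 ^ 2) * (Real.exp (-x 0) * -u 0)) 0 := by
    refine (((((hc 1).fun_pow 2).const_add 1).fun_add ((hc 2).fun_pow 2)).fun_mul hn).congr_deriv ?_
    simp [hx]
  rw [h2] at hq
  rw [lowerTri, coframe_apply]
  generalize Real.exp (-(x 0 / 2)) = p at *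
  generalize Real.exp (x 0 / 2) = q at *
  fin_cases i <;> fin_cases j
  · refine (hasDerivAt_complex_mk he (hasDerivAt_const _ _)).congr_deriv ?_
    simp [Matrix.mul_apply, Fin.sum_univ_two, hermHat, Complex.ext_iff]
    ring
  · refine (hasDerivAt_complex_mk (hc 1) (hc 2)).congr_deriv ?_
    simp [Matrix.mul_apply, Fin.sum_univ_two, hermHat, Complex.ext_iff]
    exact ⟨by linear_combination (-u 1) * hp, by linear_combination (-u 2) * hp⟩
  · refine (hasDerivAt_complex_mk (hc 1) (hc 2).fun_neg).congr_deriv ?_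
    simp [Matrix.mul_apply, Fin.sum_univ_two, hermHat, Complex.ext_iff]
    exact ⟨by linear_combination (-u 1) * hp, by linear_combination (u 2) * hp⟩
  · refine (hasDerivAt_complex_mk hq (hasDerivAt_const _ _)).congr_deriv ?_
    simp [Matrix.mul_apply, Fin.sum_univ_two, hermHat, Complex.ext_iff]
    exact ⟨by ring, by ring⟩

theorem hasDerivAt_vecPart (x : E7) (h : HasDerivAt γ u 0) (i : Fin 2) :
    HasDerivAt (fun t => vecPart (γ t) i) ((lowerTri x *ᵥ vecPart (coframe x u)) i) 0 := by
  have hc := hasDerivAt_coord h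
  have hp := exp_half_mul (x 0)
  rw [lowerTri, coframe_apply]
  generalize Real.exp (-(x 0 / 2)) = p at *
  generalize Real.exp (x 0 / 2) = q at *
  fin_cases i
  · refine (hasDerivAt_complex_mk (hc 3) (hc 4)).congr_deriv ?_
    simp [vecPart, Complex.ext_iff]
    exact ⟨by linear_combination (-u 3) * hp, by linear_combination (-u 4) * hp⟩
  · refine (hasDerivAt_complex_mk (hc 5) (hc 6)).congr_deriv ?_
    simp [vecPart, Complex.ext_iff, Matrix.vecHead, Matrix.vecTail]
    exact ⟨by linear_combination (-u 5) * hp, by linear_combination (-u 6) * hp⟩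

end Curve

theorem diffAt_eq_fderiv (f : E7 → E7) (x : E7) : diffAt f x = fderiv ℝ f x :=
  mfderiv_eq_fderiv

theorem hasDerivAt_line (x u : E7) : HasDerivAt (fun t : ℝ => x + t • u) u 0 := by
  simpa using ((hasDerivAt_id (0 : ℝ)).smul_const u).const_add x

/-- Take k = L'⁻¹AL with L and L' the Cholesky factors at x and at a • x. It is unitary because
L'L'* = A(LL*)A*, and it is the isotropy element by which the differential of a acts between the two
frames. The formulas result from differentiating the action along lines. -/
theorem exists_unitary (a : GBry) (x : E7) : ∃ k : Matrix (Fin 2) (Fin 2) ℂ, kᴴ * k = 1 ∧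
    lowerTri (a • x) * k = linPart a.1.1 * lowerTri x ∧
    ∀ u, hermHat (coframe (a • x) (diffAt (fun y : E7 => a • y) x u)) =
        k * hermHat (coframe x u) * kᴴ ∧
      vecPart (coframe (a • x) (diffAt (fun y : E7 => a • y) x u)) =
        k *ᵥ vecPart (coframe x u) := by
  set A := linPart a.1.1 with hA
  set L := lowerTri x with hL
  set L' := lowerTri (a • x) with hL'
  have hu : IsUnit L'.det := by rw [hL', det_lowerTri]; exact isUnit_one
  have huH : IsUnit (L'ᴴ).det := by rw [Matrix.det_conjTranspose]; exact hu.star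
  have hk : L' * (L'⁻¹ * (A * L)) = A * L := by
    rw [← Matrix.mul_assoc, Matrix.mul_nonsing_inv _ hu, Matrix.one_mul]
  generalize L'⁻¹ * (A * L) = k at hk
  have hkH : kᴴ * L'ᴴ = Lᴴ * Aᴴ := by
    rw [← Matrix.conjTranspose_mul, hk, Matrix.conjTranspose_mul]
  have cancel : ∀ X Y : Matrix (Fin 2) (Fin 2) ℂ, L' * X * L'ᴴ = L' * Y * L'ᴴ → X = Y := by
    intro X Y h
    have h1 := congrArg (fun Z => L'⁻¹ * Z * (L'ᴴ)⁻¹) h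
    simp only [Matrix.mul_assoc, Matrix.mul_nonsing_inv _ huH, Matrix.mul_one] at h1
    simpa only [← Matrix.mul_assoc, Matrix.nonsing_inv_mul _ hu, Matrix.one_mul] using h1
  -- Both sides become herm(a • x) when multiplied by L' on the left and by L'* on the right.
  have hkk : k * kᴴ = 1 := by
    apply cancel
    rw [Matrix.mul_one, hL', lowerTri_mul, herm_smul, ← hL', ← lowerTri_mul, ← hL, ← hA]
    calc L' * (k * kᴴ) * L'ᴴ = (L' * k) * (kᴴ * L'ᴴ) := by simp only [Matrix.mul_assoc]
      _ = A * (L * Lᴴ) * Aᴴ := by rw [hk, hkH]; simp only [Matrix.mul_assoc]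
  refine ⟨k, mul_eq_one_comm.1 hkk, hk, fun u => ?_⟩
  rw [diffAt_eq_fderiv]
  have hγ := hasDerivAt_line x u
  have hx : x + (0 : ℝ) • u = x := by simp
  have hγ' : HasDerivAt (fun t : ℝ => a • (x + t • u)) (fderiv ℝ (fun y : E7 => a • y) x u) 0 := by
    have hd := ((contDiff_smul_G a).differentiable (by simp) x).hasFDerivAt
    rw [← hx] at hd
    have := HasFDerivAt.comp_hasDerivAt (f := fun t : ℝ => x + t • u) (0 : ℝ) hd hγ
    rw [hx] at this
    exact this
  have hx' : a • (x + (0 : ℝ) • u) = a • x := by rw [hx]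
  have h1 := hasDerivAt_herm hx hγ
  have h2 := hasDerivAt_vecPart x hγ
  have h1' := hasDerivAt_herm hx' hγ'
  have h2' := hasDerivAt_vecPart (a • x) hγ'
  generalize fderiv ℝ (fun y : E7 => a • y) x u = v at *
  constructor
  · apply cancel
    rw [show L' * (k * hermHat (coframe x u) * kᴴ) * L'ᴴ =
      (L' * k) * hermHat (coframe x u) * (kᴴ * L'ᴴ) by simp only [Matrix.mul_assoc], hk, hkH,
      show A * L * hermHat (coframe x u) * (Lᴴ * Aᴴ) = A * (L * hermHat (coframe x u) * Lᴴ) * Aᴴ by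
        simp only [Matrix.mul_assoc]]
    ext i j
    refine (h1' i j).unique ?_
    simp only [herm_smul, ← hA]
    simp only [Matrix.mul_apply (M := A * _), Matrix.mul_apply (M := A), Fin.sum_univ_two]
    exact ((((h1 _ _).const_mul _).fun_add ((h1 _ _).const_mul _)).mul_const _).fun_add
      ((((h1 _ _).const_mul _).fun_add ((h1 _ _).const_mul _)).mul_const _)
  · have hv : L' *ᵥ vecPart (coframe (a • x) v) = A *ᵥ (L *ᵥ vecPart (coframe x u)) := by
      ext i
      refine (h2' i).unique ?_
      have hm : ∀ w, (A *ᵥ w) i = A i 0 * w 0 + A i 1 * w 1 := fun w => by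
        simp only [Matrix.mulVec, dotProduct, Fin.sum_univ_two]
      simp only [vecPart_smul, ← hA, Pi.add_apply, hm]
      exact (((h2 _).const_mul _).fun_add ((h2 _).const_mul _)).add_const _
    have h3 := congrArg (fun w => L'⁻¹ *ᵥ w) hv
    simp only [Matrix.mulVec_mulVec, Matrix.nonsing_inv_mul _ hu, Matrix.one_mulVec] at h3
    rw [h3, ← Matrix.mul_assoc, Matrix.mul_assoc, ← hk, ← Matrix.mul_assoc,
      Matrix.nonsing_inv_mul _ hu, Matrix.one_mul]

/-- Written as a trace, η is visibly invariant under conjugation by unitary matrices. -/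
theorem eta_eq_trace (u : Fin 3 → E7) : formOf bBry etaL u =
    -(1 / 16) * (hermHat (u 0) * hermHat (u 1) * hermHat (u 2)).trace.im := by
  simp only [etaL, formOf, add_zero, Int.cast_one, one_smul, dualForm_apply, Matrix.det_fin_three,
    Matrix.of_apply, bBry_repr]
  simp [hermHat, Matrix.trace, Fin.sum_univ_two]
  ring

/-- The Hermitian pairing of w, H and w' is unitarily invariant. The cyclic sum makes its imaginary
part alternating. -/
theorem beta_eq_dotProduct (u : Fin 3 → E7) : formOf bBry betaL u =
    -(1 / 2) * ((star (vecPart (u 0)) ⬝ᵥ (hermHat (u 2) *ᵥ vecPart (u 1))).im +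
      (star (vecPart (u 1)) ⬝ᵥ (hermHat (u 0) *ᵥ vecPart (u 2))).im +
      (star (vecPart (u 2)) ⬝ᵥ (hermHat (u 1) *ᵥ vecPart (u 0))).im) := by
  simp only [betaL, formOf, ContinuousAlternatingMap.add_apply,
    ContinuousAlternatingMap.smul_apply, dualForm_apply, Matrix.det_fin_three,
    Matrix.of_apply, bBry_repr, ContinuousAlternatingMap.coe_zero, Pi.zero_apply]
  simp [hermHat, vecPart, dotProduct, Fin.sum_univ_two, Matrix.mulVec]
  ring

section Unitary

variable {k : Matrix (Fin 2) (Fin 2) ℂ} {u v : Fin 3 → E7}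

theorem eta_unitary (hk : kᴴ * k = 1) (h : ∀ i, hermHat (v i) = k * hermHat (u i) * kᴴ) :
    formOf bBry etaL v = formOf bBry etaL u := by
  rw [eta_eq_trace, eta_eq_trace, h, h, h]
  have h1 : k * hermHat (u 0) * kᴴ * (k * hermHat (u 1) * kᴴ) * (k * hermHat (u 2) * kᴴ) =
      k * (hermHat (u 0) * (kᴴ * k) * hermHat (u 1) * (kᴴ * k) * hermHat (u 2)) * kᴴ := by
    simp only [Matrix.mul_assoc]
  rw [h1, hk, Matrix.mul_one, Matrix.mul_one, Matrix.trace_mul_comm, ← Matrix.mul_assoc, hk,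
    Matrix.one_mul]

theorem beta_unitary (hk : kᴴ * k = 1) (h : ∀ i, hermHat (v i) = k * hermHat (u i) * kᴴ)
    (hv : ∀ i, vecPart (v i) = k *ᵥ vecPart (u i)) :
    formOf bBry betaL v = formOf bBry betaL u := by
  have h1 : ∀ i j m, star (vecPart (v i)) ⬝ᵥ (hermHat (v j) *ᵥ vecPart (v m)) =
      star (vecPart (u i)) ⬝ᵥ (hermHat (u j) *ᵥ vecPart (u m)) := by
    intro i j m
    rw [hv, hv, h, Matrix.star_mulVec, ← Matrix.dotProduct_mulVec, Matrix.mulVec_mulVec,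
      Matrix.mulVec_mulVec, show kᴴ * (k * hermHat (u j) * kᴴ) * k =
        (kᴴ * k) * hermHat (u j) * (kᴴ * k) by simp only [Matrix.mul_assoc], hk, Matrix.one_mul,
      Matrix.mul_one]
  rw [beta_eq_dotProduct, beta_eq_dotProduct, h1, h1, h1]

end Unitary

/-- By `exists_unitary`, invariance under G reduces to invariance of the value at the base point
under unitary matrices. -/
theorem isGInvariant_eta : IsGInvariant (invForm etaL) := by
  intro a
  ext x u
  obtain ⟨k, hk, -, h⟩ := exists_unitary a x
  exact eta_unitary hk fun i => (h (u i)).1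

theorem isGInvariant_beta : IsGInvariant (invForm betaL) := by
  intro a
  ext x u
  obtain ⟨k, hk, -, h⟩ := exists_unitary a x
  exact beta_unitary hk (fun i => (h (u i)).1) fun i => (h (u i)).2

theorem pullback_add {k : ℕ} (f : E7 → E7) (α β : Form E7 k) :
    pullback f (α + β) = pullback f α + pullback f β := rfl

theorem pullback_smul {k : ℕ} (f : E7 → E7) (c : ℝ) (α : Form E7 k) :
    pullback f (c • α) = c • pullback f α := rfl

theorem IsGInvariant.add {k : ℕ} {α β : Form E7 k} (hα : IsGInvariant α) (hβ : IsGInvariant β) :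
    IsGInvariant (α + β) := fun a => by
  rw [pullback_add, hα, hβ]

theorem IsGInvariant.smul {k : ℕ} {α : Form E7 k} (hα : IsGInvariant α) (c : ℝ) :
    IsGInvariant (c • α) := fun a => by
  rw [pullback_smul, hα]

theorem isGInvariant_scaledForm (l m : ℝ) : IsGInvariant (scaledForm l m) :=
  (isGInvariant_eta.smul _).add (isGInvariant_beta.smul _)

/-! ### The eternal solution of the Laplacian flow -/

/-- The linear map `(P, w) ↦ (P, cw)` in coordinates. -/
def fiberEquiv (c : ℝ) (hc : c ≠ 0) : E7 ≃L[ℝ] E7 :=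
  LinearEquiv.toContinuousLinearEquiv
    { toFun := fun u => !₂[u 0, u 1, u 2, c * u 3, c * u 4, c * u 5, c * u 6]
      invFun := fun u => !₂[u 0, u 1, u 2, c⁻¹ * u 3, c⁻¹ * u 4, c⁻¹ * u 5, c⁻¹ * u 6]
      map_add' := by
        intro u v
        ext j
        fin_cases j <;> simp <;> ring
      map_smul' := by
        intro r u
        ext j
        fin_cases j <;> simp <;> ring
      left_inv := by
        intro u
        ext j
        fin_cases j <;> simp [hc]
      right_inv := by
        intro u
        ext j
        fin_cases j <;> simp [hc] }

theorem fiberEquiv_apply (c : ℝ) (hc : c ≠ 0) (u : E7) : fiberEquiv c hc u =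
    !₂[u 0, u 1, u 2, c * u 3, c * u 4, c * u 5, c * u 6] := rfl

/-- The dilation of ℂ² commutes with linear maps of ℂ², and the coframe depends only on P. -/
theorem coframe_fiberEquiv (c : ℝ) (hc : c ≠ 0) (x u : E7) :
    coframe (fiberEquiv c hc x) (fiberEquiv c hc u) = fiberEquiv c hc (coframe x u) := by
  rw [coframe_apply, fiberEquiv_apply, fiberEquiv_apply, fiberEquiv_apply, coframe_apply]
  ext j
  fin_cases j <;> simp <;> ring

theorem formOf_fiberEquiv {c : ℝ} (hc : c ≠ 0) {k : ℕ} (L : List (ℤ × (Fin k → Fin 7))) :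
    (formOf bBry L).compContinuousLinearMap (fiberEquiv c hc : E7 →L[ℝ] E7) =
      formOf (scaledBasis one_ne_zero hc) L := by
  induction L with
  | nil => rfl
  | cons p L ih =>
    ext u
    rw [formOf, formOf, ← ih, ContinuousAlternatingMap.compContinuousLinearMap_apply,
      ContinuousAlternatingMap.add_apply, ContinuousAlternatingMap.add_apply,
      ContinuousAlternatingMap.compContinuousLinearMap_apply,
      ContinuousAlternatingMap.smul_apply, ContinuousAlternatingMap.smul_apply]
    congr 2
    rw [dualForm_apply, dualForm_apply]
    congr 1
    ext a b
    simp only [Matrix.of_apply, scaledBasis_repr, bBry_repr, Function.comp_apply,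
      ContinuousLinearEquiv.coe_coe, fiberEquiv_apply]
    generalize p.2 b = i
    fin_cases i <;> simp

/-- In the coframe the pull-back is the constant rescaling of the fibre covectors by c. -/
theorem pullback_fiberEquiv {c : ℝ} (hc : c ≠ 0) :
    pullback (fiberEquiv c hc) phiForm = scaledForm 1 c := by
  have h1 : ∀ (k : ℕ) (L : List (ℤ × (Fin k → Fin 7))), pullback (fiberEquiv c hc) (invForm L) =
      fun x => (formOf (scaledBasis one_ne_zero hc) L).compContinuousLinearMap
        (coframe x : E7 →L[ℝ] E7) := by
    intro k L
    ext x u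
    rw [← formOf_fiberEquiv, pullback, diffAt_eq_fderiv, (fiberEquiv c hc).fderiv]
    change formOf bBry L _ = formOf bBry L _
    congr 1
    ext1 i
    exact coframe_fiberEquiv c hc x (u i)
  rw [phiForm, scaledForm_eq, pullback_add, pullback_smul, pullback_smul, h1, h1,
    formOf_scaledBasis _ hc etaL 1, formOf_scaledBasis _ hc betaL (c ^ 2), scaledForm_eq]
  · simp only [one_pow, one_smul, one_mul, mul_one]
    rfl
  · intro p hp
    fin_cases hp <;> simp [Fin.prod_univ_three] <;> ring
  · intro p hp
    fin_cases hp
    simp [Fin.prod_univ_three]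

/-- The flow is the family with l = 1 and m = e^{6t}, since e^{12t}φ + (1 - e^{12t})η = η + m²β. -/
theorem flow_eq (t : ℝ) : Real.exp (12 * t) • phiForm + (1 - Real.exp (12 * t)) • etaForm =
    scaledForm 1 (Real.exp (6 * t)) := by
  have h : Real.exp (6 * t) ^ 2 = Real.exp (12 * t) := by
    rw [← Real.exp_nat_mul]
    congr 1
    push_cast
    ring
  rw [scaledForm_eq, h, phiForm_eq_add, one_pow, one_smul, one_mul]
  change _ = etaForm + _
  module

/-! ### Dilations of the translation part as automorphisms of G. -/

theorem linPart_mulG (a b : GBry) : linPart (a * b).1.1 = linPart a.1.1 * linPart b.1.1 :=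
  linPart_mul _ _ b.2.1 b.2.2.1

theorem transPart_mulG (a b : GBry) :
    transPart (a * b).1.1 = linPart a.1.1 *ᵥ transPart b.1.1 + transPart a.1.1 :=
  transPart_mul _ _ b.2.2.2

/-- The map `(A, v) ↦ (A, cv)`. -/
def fiberMap (c : ℝ) (a : GBry) : GBry := mkG (linPart a.1.1) (c • transPart a.1.1) (lin_det a)

theorem linPart_fiberMap (c : ℝ) (a : GBry) : linPart (fiberMap c a).1.1 = linPart a.1.1 :=
  linPart_mkG _ _ (lin_det a)

theorem transPart_fiberMap (c : ℝ) (a : GBry) :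
    transPart (fiberMap c a).1.1 = c • transPart a.1.1 :=
  transPart_mkG _ _ (lin_det a)

theorem fiberMap_mul (c : ℝ) (a b : GBry) :
    fiberMap c (a * b) = fiberMap c a * fiberMap c b := by
  apply GBry_ext
  · rw [linPart_mulG, linPart_fiberMap, linPart_fiberMap, linPart_fiberMap, linPart_mulG]
  · rw [transPart_mulG, transPart_fiberMap, transPart_fiberMap, transPart_fiberMap,
      linPart_fiberMap, transPart_mulG, smul_add, Matrix.mulVec_smul]

theorem fiberMap_fiberMap {c c' : ℝ} (h : c * c' = 1) (a : GBry) :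
    fiberMap c (fiberMap c' a) = a := by
  apply GBry_ext
  · rw [linPart_fiberMap, linPart_fiberMap]
  · rw [transPart_fiberMap, transPart_fiberMap, smul_smul, h, one_smul]

theorem continuous_fiberMap (c : ℝ) : Continuous (fiberMap c) := by
  have h0 : Continuous fun a : GBry => a.1.1 :=
    Continuous.comp (g := fun A : Matrix.SpecialLinearGroup (Fin 3) ℂ => A.1)
      continuous_induced_dom continuous_induced_dom
  have h : ∀ i j, Continuous fun a : GBry => a.1.1 i j := fun i j => h0.matrix_elem i j
  refine continuous_induced_rng.2 (continuous_induced_rng.2 ?_)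
  refine continuous_matrix fun i j => ?_
  fin_cases i <;> fin_cases j
  exacts [h 0 0, h 0 1, (h 0 2).const_smul c, h 1 0, h 1 1, (h 1 2).const_smul c,
    continuous_const, continuous_const, continuous_const]

/-- The automorphism `(A, v) ↦ (A, cv)` of the Lie group `G`. -/
def fiberAut (c : ℝ) (hc : c ≠ 0) : GBry ≃ₜ* GBry :=
  { toFun := fiberMap c
    map_mul' := fiberMap_mul c
    invFun := fiberMap c⁻¹
    left_inv := fiberMap_fiberMap (inv_mul_cancel₀ hc)
    right_inv := fiberMap_fiberMap (mul_inv_cancel₀ hc)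
    continuous_toFun := continuous_fiberMap c
    continuous_invFun := continuous_fiberMap c⁻¹ }

/-- The automorphism (A, v) ↦ (A, cv) fixes K pointwise, because v = 0 there, and induces (P, w) ↦
(P, cw). -/
theorem isEquivariant_fiberEquiv (c : ℝ) (hc : c ≠ 0) :
    IsEquivariant (fiberEquiv c hc).toDiffeomorph := by
  have hK : ∀ a ∈ KBry, fiberMap c a = a := fun a ha => by
    apply GBry_ext
    · rw [linPart_fiberMap]
    · rw [transPart_fiberMap, ((mem_KBry_iff a).1 ha).2, smul_zero]
  refine ⟨fiberAut c hc, ?_, fun a => ?_⟩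
  · ext a
    constructor
    · rintro ⟨b, hb, rfl⟩
      change fiberMap c b ∈ KBry
      rw [hK b hb]
      exact hb
    · intro ha
      exact ⟨a, ha, hK a ha⟩
  · change fiberEquiv c hc (a • oBry) = fiberMap c a • oBry
    have h1 : ∀ x, herm (fiberEquiv c hc x) = herm x := fun x => rfl
    have h2 : ∀ x, vecPart (fiberEquiv c hc x) = c • vecPart x := fun x => by
      rw [fiberEquiv_apply]
      ext i
      fin_cases i <;> simp [vecPart, Complex.ext_iff]
    apply ext_herm_vecPart
    · rw [h1, herm_smul_zero, herm_smul_zero, linPart_fiberMap]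
    · rw [h2, vecPart_smul_zero, vecPart_smul_zero, transPart_fiberMap]

theorem exists_equivariant_flow : ∃ f : ℝ → E7 ≃ₘ⟮𝓘(ℝ, E7), 𝓘(ℝ, E7)⟯ E7, ∀ t,
    IsEquivariant (f t) ∧ Real.exp (12 * t) • phiForm + (1 - Real.exp (12 * t)) • etaForm =
      pullback (f t) phiForm := by
  refine ⟨fun t => (fiberEquiv (Real.exp (6 * t)) (Real.exp_ne_zero _)).toDiffeomorph,
    fun t => ⟨isEquivariant_fiberEquiv _ _, ?_⟩⟩
  rw [flow_eq]
  exact (pullback_fiberEquiv (Real.exp_ne_zero (6 * t))).symm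

theorem isLaplacianFlow_phiForm : IsLaplacianFlow Set.univ
    (fun t => Real.exp (12 * t) • phiForm + (1 - Real.exp (12 * t)) • etaForm) := by
  intro t _
  have he : ContDiff ℝ ∞ fun p : ℝ × E7 => Real.exp (12 * p.1) :=
    (contDiff_const.mul contDiff_fst).exp
  refine ⟨?_, fun x => ?_, fun x => ?_⟩
  · beta_reduce
    rw [flow_eq]
    exact isG2Structure_scaledForm one_ne_zero (Real.exp_ne_zero _)
  · simp only [localForm_model]
    exact ((he.smul (contDiff_phiForm.comp contDiff_snd)).add ((contDiff_const.sub he).smul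
      ((contDiff_invForm etaL).comp contDiff_snd))).contDiffAt
  · beta_reduce
    rw [flow_eq, laplacian_scaledForm one_ne_zero (Real.exp_ne_zero _)]
    have h : Real.exp (6 * t) ^ 2 = Real.exp (12 * t) := by
      rw [← Real.exp_nat_mul]
      congr 1
      push_cast
      ring
    have h1 : HasDerivAt (fun s => Real.exp (12 * s)) (Real.exp (12 * t) * 12) t := by
      simpa using ((hasDerivAt_id t).const_mul 12).exp
    refine ((h1.smul_const (phiForm x)).add ((h1.const_sub 1).smul_const
      (etaForm x))).congr_deriv ?_
    rw [phiForm_eq_add, h, div_one, Pi.smul_apply, Pi.add_apply, mul_comm 12]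
    module

theorem isInvariantFlow_phiForm : IsInvariantFlow Set.univ phiForm
    (fun t => Real.exp (12 * t) • phiForm + (1 - Real.exp (12 * t)) • etaForm) := by
  refine ⟨by simp, fun t _ => ?_, isLaplacianFlow_phiForm⟩
  beta_reduce
  rw [flow_eq]
  exact isGInvariant_scaledForm _ _

/-! ### The soliton vector field -/

theorem localTensor_model {k : ℕ} (T : TensorField E7 k) (x : E7) : localTensor T x = T := by
  ext1 y
  rw [localTensor, chart_model, diffAt_refl_symm]
  rfl

theorem lieDer_model {k : ℕ} (V : E7 → E7) (T : TensorField E7 k) (x : E7) (u : Fin k → E7) :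
    lieDer V T x u = fderiv ℝ T x (V x) u +
      ∑ j, T x (Function.update u j (fderiv ℝ V x (u j))) := by
  simp only [lieDer, localTensor_model, chart_model, diffAt_refl]
  rfl

/-- The generator of the flow `(P, w) ↦ (P, e^{6t}w)`. -/
def solitonField (x : E7) : E7 := fiberScale 6 x

theorem fderiv_solitonField (x : E7) : fderiv ℝ solitonField x =
    LinearMap.toContinuousLinearMap (fiberScale 6) :=
  (LinearMap.toContinuousLinearMap (fiberScale 6)).fderiv

theorem isCompleteField_solitonField :
    IsCompleteField (M := E7) solitonField := by
  refine ⟨fun x => ?_, fun x => ⟨fun t => fiberEquiv (Real.exp (6 * t)) (Real.exp_ne_zero _) x,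
    ?_, fun t => ?_⟩⟩
  · simp only [chart_model, diffAt_refl]
    exact (LinearMap.toContinuousLinearMap (fiberScale 6)).contDiff.contDiffAt
  · beta_reduce
    rw [fiberEquiv_apply]
    ext i
    fin_cases i <;> simp
  · refine hasMFDerivAt_iff_hasFDerivAt.2 ?_
    change HasDerivAt (fun t => fiberEquiv (Real.exp (6 * t)) (Real.exp_ne_zero _) x)
      (solitonField (fiberEquiv (Real.exp (6 * t)) (Real.exp_ne_zero _) x)) t
    apply hasDerivAt_E7
    have h1 : HasDerivAt (fun s => Real.exp (6 * s)) (Real.exp (6 * t) * 6) t := by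
      simpa using ((hasDerivAt_id t).const_mul 6).exp
    intro i
    simp only [fiberEquiv_apply, solitonField, fiberScale_apply]
    have h2 : ∀ c : ℝ, HasDerivAt (fun s => Real.exp (6 * s) * c) (6 * (Real.exp (6 * t) * c)) t :=
      fun c => (h1.mul_const c).congr_deriv (by ring)
    fin_cases i
    exacts [hasDerivAt_const _ _, hasDerivAt_const _ _, hasDerivAt_const _ _, h2 _, h2 _, h2 _,
      h2 _]

/-- The coframe involves x_0, x_1, x_2 only, while the field points along the fibre. -/
theorem coframe_add_fiber (x : E7) (t : ℝ) :
    coframe (x + t • solitonField x) = coframe x := by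
  ext u i
  rw [coframe_apply, coframe_apply, solitonField, fiberScale_apply]
  fin_cases i <;> simp

theorem coframe_fiberScale (r : ℝ) (x u : E7) :
    coframe x (fiberScale r u) = fiberScale r (coframe x u) := by
  rw [coframe_apply, fiberScale_apply, fiberScale_apply, coframe_apply]
  ext i
  fin_cases i <;> simp <;> ring

/-- No differentiability is needed: where it fails, `fderiv` is zero by convention. -/
theorem fderiv_eq_zero_of_line {F : Type*} [NormedAddCommGroup F] [NormedSpace ℝ F]
    {T : E7 → F} {x v : E7} (h : ∀ t : ℝ, T (x + t • v) = T x) : fderiv ℝ T x v = 0 := by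
  by_cases hd : DifferentiableAt ℝ T x
  · have hx : x = x + (0 : ℝ) • v := by simp
    have h1 := hd.hasFDerivAt
    rw [hx] at h1
    have h2 := HasFDerivAt.comp_hasDerivAt (f := fun t : ℝ => x + t • v) (0 : ℝ) h1
      (hasDerivAt_line x v)
    rw [← hx] at h2
    have h3 : (T ∘ fun t : ℝ => x + t • v) = fun _ => T x := funext h
    rw [h3] at h2
    exact h2.unique (hasDerivAt_const _ _)
  · rw [fderiv_zero_of_not_differentiableAt hd]
    rfl

/-- For a tensor constant along the fibres, the derivative term is zero, and the Lie derivative is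
the algebraic action of the linear field. -/
theorem lieDer_solitonField {k : ℕ} {T : TensorField E7 k} (x : E7)
    (h : ∀ t : ℝ, T (x + t • solitonField x) = T x) (u : Fin k → E7) :
    lieDer (M := E7) solitonField T x u = ∑ j, T x (Function.update u j (fiberScale 6 (u j))) := by
  rw [lieDer_model, fderiv_eq_zero_of_line h, fderiv_solitonField]
  simp

theorem phiForm_add_fiber (x : E7) (t : ℝ) :
    phiForm (x + t • solitonField x) = phiForm x := by
  rw [phiForm_apply, phiForm_apply, coframe_add_fiber]

/-- The field scales fibre covectors with rate 6, so the Lie derivative of φ is 12β, which is Δφ. -/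
theorem isLaplacianSoliton_phiForm : IsLaplacianSoliton phiForm 0 := by
  refine ⟨isG2Structure_phiForm, solitonField, isCompleteField_solitonField, fun x u => ?_⟩
  rw [lieDer_solitonField x fun t => by rw [phiForm_add_fiber], zero_mul, zero_add,
    laplacian_of_closed (φ := phiForm) extD_scaledForm, extD_torsion_phiForm]
  have h1 : ∀ j, (phiForm x).toContinuousMultilinearMap
      (Function.update u j (fiberScale 6 (u j))) =
      phiBry bBry (Function.update (fun i => coframe x (u i)) j
        (fiberScale 6 (coframe x (u j)))) := by
    intro j
    rw [phiForm_apply]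
    change phiBry bBry _ = phiBry bBry _
    congr 1
    ext1 i
    by_cases hi : i = j
    · subst hi
      simp [coframe_fiberScale]
    · simp [Function.update_of_ne hi]
  simp only [h1]
  generalize hv : (fun i => coframe x (u i)) = v
  have hv' : ∀ j, coframe x (u j) = v j := fun j => congrFun hv j
  have h2 : ((12 : ℝ) • invForm betaL) x u = 12 * formOf bBry betaL v := by
    rw [← hv]
    rfl
  rw [h2]
  simp only [hv', phiBry, ContinuousAlternatingMap.add_apply,
    ContinuousAlternatingMap.sub_apply,
    Finset.sum_add_distrib, Finset.sum_sub_distrib, theta_dualForm bBry (repr_fiberScale 6),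
    ContinuousAlternatingMap.smul_apply, formOf, betaL]
  simp only [Matrix.cons_val, smul_eq_mul, ContinuousAlternatingMap.coe_zero, Pi.zero_apply]
  simp
  ring

theorem lieDer_metric_phiForm (x u v : E7) :
    lieDer (M := E7) solitonField (metric phiForm) x ![u, v] =
      ∑ i, (if i < 3 then 0 else 12 : ℝ) * (bBry.repr (coframe x u) i * bBry.repr (coframe x v) i) := by
  rw [lieDer_solitonField x fun t => by rw [metric, metric, phiForm_add_fiber], Fin.sum_univ_two]
  have h0 : Function.update ![u, v] 0 (fiberScale 6 (![u, v] 0)) = ![fiberScale 6 u, v] := by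
    ext1 i
    fin_cases i <;> rfl
  have h1 : Function.update ![u, v] 1 (fiberScale 6 (![u, v] 1)) = ![u, fiberScale 6 v] := by
    ext1 i
    fin_cases i <;> rfl
  rw [h0, h1, metric_phiForm_apply, metric_phiForm_apply, ← Finset.sum_add_distrib]
  refine Finset.sum_congr rfl fun i _ => ?_
  rw [coframe_fiberScale, coframe_fiberScale, repr_fiberScale, repr_fiberScale]
  split_ifs <;> ring

/-! ### Local diffeomorphisms -/

section Quotient

variable {M : Type*} [TopologicalSpace M] [ChartedSpace E7 M]

theorem exists_diffAt_equiv {π : E7 → M} (hπ : IsLocalDiffeomorph 𝓘(ℝ, E7) 𝓘(ℝ, E7) ∞ π) (x : E7) :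
    ∃ A : E7 ≃L[ℝ] E7, diffAt π x = (A : E7 →L[ℝ] E7) :=
  ⟨hπ.mfderivToContinuousLinearEquiv (by simp) x, rfl⟩

theorem pullback_injective {π : E7 → M} (hπ : IsLocalDiffeomorph 𝓘(ℝ, E7) 𝓘(ℝ, E7) ∞ π)
    (hs : Function.Surjective π) {k : ℕ} {α β : Form M k} (h : pullback π α = pullback π β) :
    α = β := by
  ext1 m
  obtain ⟨x, rfl⟩ := hs m
  obtain ⟨A, hA⟩ := exists_diffAt_equiv hπ x
  have h1 := congrFun h x
  simp only [pullback, hA] at h1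
  ext u
  have h2 := congrArg (fun γ : Alt k => γ (A.symm ∘ u)) h1
  simp only [ContinuousAlternatingMap.compContinuousLinearMap_apply] at h2
  have h3 : (⇑(A : E7 →L[ℝ] E7) ∘ ⇑A.symm ∘ u) = u := by
    ext1 i
    simp
  rwa [h3] at h2

theorem hodge_pullback {π : E7 → M} (hπ : IsLocalDiffeomorph 𝓘(ℝ, E7) 𝓘(ℝ, E7) ∞ π)
    {φ : Form M 3} (hφ : ∀ m, IsPositive (φ m)) {k l : ℕ} (h : k + l = 7) (α : Form M k) :
    hodge (pullback π φ) h (pullback π α) = pullback π (hodge φ h α) := by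
  ext1 x
  obtain ⟨A, hA⟩ := exists_diffAt_equiv hπ x
  simp only [hodge, pullback, hA]
  exact starOf_comp (hφ _) A h _

theorem diffAt_comp_of_fiber {π : E7 → M} (hπ : IsLocalDiffeomorph 𝓘(ℝ, E7) 𝓘(ℝ, E7) ∞ π)
    {f : E7 → E7} (hf : ContDiff ℝ ∞ f) (h : ∀ x, π (f x) = π x) (x : E7) :
    diffAt π x = (diffAt π (f x)).comp (diffAt f x) := by
  have h1 : π = π ∘ f := funext fun x => (h x).symm
  have h2 : MDifferentiableAt 𝓘(ℝ, E7) 𝓘(ℝ, E7) f x :=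
    (hf.differentiable (by simp) x).mdifferentiableAt
  have h3 := mfderiv_comp x (hπ.mdifferentiable (by simp) (f x)) h2
  rw [← h1] at h3
  exact h3

/-- The form is carried to M by the inverse of dπ at a chosen point of each fibre. Points of one
fibre differ by a γ with π ∘ γ = π, and invariance under γ removes the dependence on the choice. -/
theorem exists_descend {π : E7 → M} (hπ : IsLocalDiffeomorph 𝓘(ℝ, E7) 𝓘(ℝ, E7) ∞ π)
    (hs : Function.Surjective π) {k : ℕ} {α : Form E7 k} (hα : IsGInvariant α)
    (hΓ : ∀ x y, π x = π y → ∃ γ : GBry, (∀ z, π (γ • z) = π z) ∧ γ • x = y) :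
    ∃ αM : Form M k, pullback π αM = α := by
  choose σ hσ using hs
  choose A hA using exists_diffAt_equiv hπ
  refine ⟨fun m => (α (σ m)).compContinuousLinearMap ((A (σ m)).symm : E7 →L[ℝ] E7), ?_⟩
  ext1 x
  obtain ⟨γ, hγ, hx⟩ := hΓ x (σ (π x)) (hσ _).symm
  have h1 := diffAt_comp_of_fiber hπ (contDiff_smul_G γ) hγ x
  have h2 := congrFun (hα γ) x
  simp only [pullback] at h2
  rw [hx] at h1 h2
  rw [pullback, ← h2, h1, hA]
  ext u
  simp only [ContinuousAlternatingMap.compContinuousLinearMap_apply]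
  congr 1
  ext1 i
  simp

theorem comp_smul_add_smul {k : ℕ} (a b : ℝ) (α β : Alt k) (A : E7 →L[ℝ] E7) :
    (a • α + b • β).compContinuousLinearMap A =
      a • α.compContinuousLinearMap A + b • β.compContinuousLinearMap A := by
  ext u
  simp

theorem pullback_zero (π : E7 → M) (k : ℕ) : pullback π (0 : Form M k) = 0 := by
  ext x u
  simp [pullback]

/-- Chart expressions on M are pull-backs of the form upstairs by a local section s. -/
theorem localForm_eventuallyEq {π : E7 → M} {s : E7 → E7} {x : E7}
    (h : ∀ᶠ y in nhds (chart (π x) (π x)), (chart (π x)).symm y = π (s y) ∧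
        diffAt (chart (π x)).symm y = (diffAt π (s y)).comp (fderiv ℝ s y)) :
    ∀ᶠ y in nhds (chart (π x) (π x)), ∀ (k : ℕ) (α : Form M k), localForm α (π x) y =
      (pullback π α (s y)).compContinuousLinearMap (fderiv ℝ s y) := by
  filter_upwards [h] with y hy k α
  rw [localForm, pullback, hy.1, hy.2]
  rfl

variable [IsManifold 𝓘(ℝ, E7) ∞ M]

/-- The section is a local inverse of π composed with the inverse chart. Identities are needed on a
neighbourhood, as they are differentiated afterwards. -/
theorem exists_local_section {π : E7 → M} (hπ : IsLocalDiffeomorph 𝓘(ℝ, E7) 𝓘(ℝ, E7) ∞ π) (x : E7) :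
    ∃ s : E7 → E7, ContDiffAt ℝ ∞ s (chart (π x) (π x)) ∧ s (chart (π x) (π x)) = x ∧
      (∀ᶠ y in nhds (chart (π x) (π x)), (chart (π x)).symm y = π (s y) ∧
        diffAt (chart (π x)).symm y = (diffAt π (s y)).comp (fderiv ℝ s y)) ∧
      ∀ u, fderiv ℝ s (chart (π x) (π x)) (diffAt (chart (π x)) (π x) (diffAt π x u)) = u := by
  set c := chart (π x) with hc
  have hloc := hπ x
  set τ := hloc.localInverse with hτ
  have hsymm : c.symm (c (π x)) = π x := extChartAt_to_inv (I := 𝓘(ℝ, E7)) (π x)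
  have hcs : ContMDiffAt 𝓘(ℝ, E7) 𝓘(ℝ, E7) ∞ c.symm (c (π x)) :=
    (contMDiffOn_extChartAt_symm (I := 𝓘(ℝ, E7)) (π x)).contMDiffAt
      (extChartAt_target_mem_nhds (I := 𝓘(ℝ, E7)) (π x))
  have hcd : ContMDiffAt 𝓘(ℝ, E7) 𝓘(ℝ, E7) ∞ c (π x) := contMDiffAt_extChartAt
  have hτs : ContMDiffAt 𝓘(ℝ, E7) 𝓘(ℝ, E7) ∞ τ (π x) := hloc.localInverse_contMDiffAt
  have hτx : τ (π x) = x := hloc.localInverse_left_inv hloc.localInverse_mem_target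
  have hs : ContMDiffAt 𝓘(ℝ, E7) 𝓘(ℝ, E7) ∞ (τ ∘ c.symm) (c (π x)) :=
    ContMDiffAt.comp _ (by rwa [hsymm]) hcs
  have hs' : ContDiffAt ℝ ∞ (τ ∘ c.symm) (c (π x)) := hs.contDiffAt
  have hsx : (τ ∘ c.symm) (c (π x)) = x := by
    rw [Function.comp_apply, hsymm, hτx]
  have hev : ∀ᶠ y in nhds (c (π x)), c.symm y = π ((τ ∘ c.symm) y) := by
    have h1 := hloc.localInverse_eventuallyEq_right
    rw [← hsymm] at h1
    filter_upwards [hcs.continuousAt.eventually h1] with y hy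
    exact hy.symm
  have hdiff : ∀ᶠ y in nhds (c (π x)), DifferentiableAt ℝ (τ ∘ c.symm) y :=
    ((hs'.of_le (m := 1) (by simp)).eventually (by simp)).mono
      fun y hy => hy.differentiableAt (by simp)
  refine ⟨τ ∘ c.symm, hs', hsx, ?_, ?_⟩
  · filter_upwards [hev.eventually_nhds, hdiff] with y hy hd
    refine ⟨hy.self_of_nhds, ?_⟩
    have h1 : c.symm =ᶠ[nhds y] π ∘ (τ ∘ c.symm) := hy
    have h2 := mfderiv_comp y (hπ.mdifferentiable (by simp) ((τ ∘ c.symm) y)) hd.mdifferentiableAt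
    rw [← h1.mfderiv_eq, mfderiv_eq_fderiv] at h2
    exact h2
  · intro u
    have hid : (τ ∘ c.symm) ∘ (c ∘ π) =ᶠ[nhds x] id := by
      have h1 := hloc.localInverse_eventuallyEq_left
      have h2 := (hπ.contMDiff.continuous.continuousAt (x := x)).eventually
        (extChartAt_source_mem_nhds (I := 𝓘(ℝ, E7)) (π x))
      filter_upwards [h1, h2] with z hz hz'
      have h3 : c.symm (c (π z)) = π z := c.left_inv hz'
      simp only [Function.comp_apply, h3]
      exact hz
    have hπd := hπ.mdifferentiable (by simp) x
    have hcπ : MDifferentiableAt 𝓘(ℝ, E7) 𝓘(ℝ, E7) (c ∘ π) x :=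
      (hcd.mdifferentiableAt (by simp)).comp x hπd
    have h4 := mfderiv_comp x (g := τ ∘ c.symm) (hs.mdifferentiableAt (by simp)) hcπ
    rw [hid.mfderiv_eq, mfderiv_id, mfderiv_comp x (hcd.mdifferentiableAt (by simp)) hπd,
      mfderiv_eq_fderiv] at h4
    exact (congrArg (fun A : E7 →L[ℝ] E7 => A u) h4).symm

/-- In a chart α is s^*(π^*α), so the claim is naturality of the exterior derivative in Euclidean
space, together with ds ∘ d(chart) ∘ dπ = id. -/
theorem extD_pullback {π : E7 → M} (hπ : IsLocalDiffeomorph 𝓘(ℝ, E7) 𝓘(ℝ, E7) ∞ π) {k : ℕ}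
    {α : Form M k} (hα : ContDiff ℝ ∞ (pullback π α)) :
    pullback π (extD α) = extD (pullback π α) := by
  ext1 x
  obtain ⟨s, hs, hsx, hev, hid⟩ := exists_local_section hπ x
  have h1 : localForm α (π x) =ᶠ[nhds (chart (π x) (π x))] fun y =>
      (pullback π α (s y)).compContinuousLinearMap (fderiv ℝ s y) :=
    (localForm_eventuallyEq hev).mono fun y hy => hy k α
  rw [extD_model, pullback, extD, h1.extDeriv_eq,
    extDeriv_pullback (hα.differentiable (by simp) _) hs
      (by rw [minSmoothness_of_isRCLikeNormedField]; exact WithTop.coe_le_coe.2 le_top), hsx]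
  ext u
  simp only [ContinuousAlternatingMap.compContinuousLinearMap_apply]
  congr 1
  ext1 i
  exact hid (u i)

/-- The parameter t is carried along because a flow is required to be smooth jointly in time and
position. -/
theorem contDiffAt_localForm {π : E7 → M} (hπ : IsLocalDiffeomorph 𝓘(ℝ, E7) 𝓘(ℝ, E7) ∞ π)
    {k : ℕ} {ψ : ℝ → Form M k} (t : ℝ)
    (hψ : ContDiff ℝ ∞ fun p : ℝ × E7 => pullback π (ψ p.1) p.2) (x : E7) :
    ContDiffAt ℝ ∞ (fun p : ℝ × E7 => localForm (ψ p.1) (π x) p.2) (t, chart (π x) (π x)) := by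
  obtain ⟨s, hs, -, hev, -⟩ := exists_local_section hπ x
  have h1 : (fun p : ℝ × E7 => localForm (ψ p.1) (π x) p.2)
      =ᶠ[nhds (t, chart (π x) (π x))] fun p =>
        (pullback π (ψ p.1) (s p.2)).compContinuousLinearMap (fderiv ℝ s p.2) := by
    filter_upwards [(continuous_snd.tendsto (t, chart (π x) (π x))).eventually
      (localForm_eventuallyEq hev)] with p hp
    exact hp k _
  have hs' : ContDiffAt ℝ ∞ (fun p : ℝ × E7 => s p.2) (t, chart (π x) (π x)) :=
    ContDiffAt.comp (g := s) (t, chart (π x) (π x)) hs contDiffAt_snd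
  refine ContDiffAt.congr_of_eventuallyEq ?_ h1
  refine contDiffAt_alt_comp ?_ ?_
  · exact hψ.contDiffAt.comp (t, chart (π x) (π x)) (contDiffAt_fst.prodMk hs')
  · exact ContDiffAt.comp (g := fderiv ℝ s) (t, chart (π x) (π x))
      (hs.fderiv_right (by simp)) contDiffAt_snd

theorem isG2Structure_of_pullback {π : E7 → M}
    (hπ : IsLocalDiffeomorph 𝓘(ℝ, E7) 𝓘(ℝ, E7) ∞ π) (hs : Function.Surjective π) {φ : Form M 3}
    (hφ : ContDiff ℝ ∞ (pullback π φ)) (hp : ∀ x, IsPositive (pullback π φ x)) :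
    IsG2Structure φ := by
  have hpos : ∀ m, IsPositive (φ m) := fun m => by
    obtain ⟨x, rfl⟩ := hs m
    obtain ⟨A, hA⟩ := exists_diffAt_equiv hπ x
    have h1 := isPositive_comp (hp x) A.symm
    rw [pullback, hA] at h1
    convert h1 using 1
    ext u
    simp only [ContinuousAlternatingMap.compContinuousLinearMap_apply]
    congr 1
    ext1 i
    simp
  refine ⟨fun m => ?_, hpos⟩
  obtain ⟨x, rfl⟩ := hs m
  have h1 := contDiffAt_localForm hπ (ψ := fun _ => φ) 0 (hφ.comp contDiff_snd) x
  exact ContDiffAt.comp (g := fun p : ℝ × E7 => localForm φ (π x) p.2) (chart (π x) (π x)) h1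
    (contDiffAt_const.prodMk contDiffAt_id)

/-- Smoothness of ∗φ upstairs is assumed since the naturality of d requires it. -/
theorem torsion_pullback {π : E7 → M} (hπ : IsLocalDiffeomorph 𝓘(ℝ, E7) 𝓘(ℝ, E7) ∞ π)
    {φ : Form M 3} (hφ : ∀ m, IsPositive (φ m))
    (hs : ContDiff ℝ ∞ (hodge (pullback π φ) (k := 3) (l := 4) rfl (pullback π φ))) :
    pullback π (torsion φ) = torsion (pullback π φ) := by
  have h1 := hodge_pullback hπ hφ (k := 3) (l := 4) rfl φ
  rw [h1] at hs
  obtain ⟨β, hβ⟩ : ∃ β, hodge φ (k := 5) (l := 2) rfl (extD (hodge φ (k := 3) (l := 4) rfl φ)) = β :=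
    ⟨_, rfl⟩
  have h2 : hodge (pullback π φ) (k := 5) (l := 2) rfl
      (extD (hodge (pullback π φ) (k := 3) (l := 4) rfl (pullback π φ))) = pullback π β := by
    rw [h1, ← extD_pullback hπ hs, hodge_pullback hπ hφ, hβ]
  rw [torsion_eq hβ, torsion_eq h2]
  ext x u
  simp only [pullback, ContinuousAlternatingMap.compContinuousLinearMap_apply,
    ContinuousAlternatingMap.neg_apply]

/-- Both sides of the pinching identity are natural, and `pullback_injective` brings the identity
down to M. -/
theorem isERP_of_pullback {π : E7 → M} (hπ : IsLocalDiffeomorph 𝓘(ℝ, E7) 𝓘(ℝ, E7) ∞ π)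
    (hs : Function.Surjective π) {φ : Form M 3} (hφ : ∀ m, IsPositive (φ m))
    (h0 : ContDiff ℝ ∞ (pullback π φ))
    (h1 : ContDiff ℝ ∞ (hodge (pullback π φ) (k := 3) (l := 4) rfl (pullback π φ)))
    (h2 : ContDiff ℝ ∞ (torsion (pullback π φ))) (h : IsERP (pullback π φ)) : IsERP φ := by
  have hτ := torsion_pullback hπ hφ h1
  constructor
  · apply pullback_injective hπ hs
    rw [extD_pullback hπ h0, h.1, pullback_zero]
  · rw [← hτ] at h2
    have h3 : extD (torsion φ) = fun m => ((1 / 6 : ℝ) * normSqTwo (φ m) (torsion φ m)) • φ m +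
      (1 / 6 : ℝ) • starOf (φ m) (k := 4) (l := 3) rfl
        (wedgeSq (adaptedBasis (φ m)) (torsion φ m)) := by
      apply pullback_injective hπ hs
      rw [extD_pullback hπ h2, hτ]
      ext1 x
      rw [h.2 x, ← hτ]
      obtain ⟨A, hA⟩ := exists_diffAt_equiv hπ x
      simp only [pullback, hA]
      rw [normSqTwo_comp (hφ _), wedgeSq_comp (adaptedBasis (φ (π x))), starOf_comp (hφ _)]
      rw [comp_smul_add_smul]
    intro m
    rw [h3]

end Quotient

theorem contDiff_smul_invForm {k : ℕ} (c : ℝ) (L : List (ℤ × (Fin k → Fin 7))) :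
    ContDiff ℝ ∞ (c • invForm L) :=
  (contDiff_invForm L).const_smul c

theorem contDiff_hodge_scaledForm {l m : ℝ} (hl : l ≠ 0) (hm : m ≠ 0) :
    ContDiff ℝ ∞ (hodge (scaledForm l m) (k := 3) (l := 4) rfl (scaledForm l m)) := by
  rw [hodge_scaledForm hl hm]
  exact (contDiff_smul_invForm _ _).add (contDiff_smul_invForm _ _)

theorem contDiff_hodge_phiForm :
    ContDiff ℝ ∞ (hodge phiForm (k := 3) (l := 4) rfl phiForm) := by
  exact contDiff_hodge_scaledForm one_ne_zero one_ne_zero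

theorem exists_quotient_flow (Γ : Subgroup GBry) (M : Type*) [TopologicalSpace M]
    [ChartedSpace E7 M] [IsManifold 𝓘(ℝ, E7) ∞ M] (π : E7 → M)
    (hπ : IsLocalDiffeomorph 𝓘(ℝ, E7) 𝓘(ℝ, E7) ∞ π) (hs : Function.Surjective π)
    (hΓ : ∀ x y, π x = π y ↔ ∃ γ ∈ Γ, γ • x = y) :
    ∃ φM ηM : Form M 3, pullback π φM = phiForm ∧ pullback π ηM = etaForm ∧ IsERP φM ∧
      ∃ ψ : ℝ → Form M 3, ψ 0 = φM ∧ IsLaplacianFlow Set.univ ψ ∧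
        ∀ t, ψ t = Real.exp (12 * t) • φM + (1 - Real.exp (12 * t)) • ηM := by
  have hΓ' : ∀ x y, π x = π y → ∃ γ : GBry, (∀ z, π (γ • z) = π z) ∧ γ • x = y := by
    intro x y hxy
    obtain ⟨γ, hγ, h⟩ := (hΓ x y).1 hxy
    exact ⟨γ, fun z => ((hΓ z (γ • z)).2 ⟨γ, hγ, rfl⟩).symm, h⟩
  obtain ⟨φM, hφM⟩ := exists_descend hπ hs (isGInvariant_scaledForm 1 1) hΓ'
  obtain ⟨ηM, hηM⟩ := exists_descend hπ hs isGInvariant_eta hΓ'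
  change pullback π φM = phiForm at hφM
  change pullback π ηM = etaForm at hηM
  have hpull : ∀ t : ℝ, pullback π (Real.exp (12 * t) • φM + (1 - Real.exp (12 * t)) • ηM) =
      scaledForm 1 (Real.exp (6 * t)) := by
    intro t
    rw [← flow_eq, ← hφM, ← hηM]
    rfl
  have hpos : ∀ l m : ℝ, l ≠ 0 → m ≠ 0 → ∀ x, IsPositive (scaledForm l m x) :=
    fun l m hl hm x => (isG2Structure_scaledForm hl hm).2 x
  have hφ : IsG2Structure φM := by
    apply isG2Structure_of_pullback hπ hs
    · rw [hφM]
      exact contDiff_phiForm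
    · rw [hφM]
      exact hpos 1 1 one_ne_zero one_ne_zero
  refine ⟨φM, ηM, hφM, hηM, ?_,
    fun t => Real.exp (12 * t) • φM + (1 - Real.exp (12 * t)) • ηM, by simp, ?_, fun t => rfl⟩
  · apply isERP_of_pullback hπ hs hφ.2 <;> rw [hφM]
    · exact contDiff_phiForm
    · exact contDiff_hodge_phiForm
    · rw [torsion_phiForm]
      exact contDiff_invForm _
    · exact isERP_phiForm
  · intro t _
    have hm : Real.exp (6 * t) ≠ 0 := Real.exp_ne_zero _
    have hG : IsG2Structure (Real.exp (12 * t) • φM + (1 - Real.exp (12 * t)) • ηM) := by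
      apply isG2Structure_of_pullback hπ hs <;> rw [hpull]
      · exact contDiff_scaledForm
      · exact hpos _ _ one_ne_zero hm
    refine ⟨hG, fun m => ?_, fun m => ?_⟩
    · obtain ⟨x, rfl⟩ := hs m
      refine contDiffAt_localForm hπ (ψ := fun t => Real.exp (12 * t) • φM +
        (1 - Real.exp (12 * t)) • ηM) t ?_ x
      simp only [hpull, ← flow_eq]
      have he : ContDiff ℝ ∞ fun p : ℝ × E7 => Real.exp (12 * p.1) :=
        (contDiff_const.mul contDiff_fst).exp
      exact (he.smul (contDiff_phiForm.comp contDiff_snd)).add ((contDiff_const.sub he).smul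
        ((contDiff_invForm etaL).comp contDiff_snd))
    -- The Laplacian on M is identified after pulling back, where the form is `scaledForm 1
    -- (e^{6t})` and its Laplacian is known.
    · have hL : laplacian (Real.exp (12 * t) • φM + (1 - Real.exp (12 * t)) • ηM)
          (Real.exp (12 * t) • φM + (1 - Real.exp (12 * t)) • ηM) =
          (12 * Real.exp (12 * t)) • (φM - ηM) := by
        have hc : extD (Real.exp (12 * t) • φM + (1 - Real.exp (12 * t)) • ηM) = 0 := by
          apply pullback_injective hπ hs
          rw [extD_pullback hπ (by rw [hpull]; exact contDiff_scaledForm), hpull, extD_scaledForm,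
            pullback_zero]
        have hh : ContDiff ℝ ∞ (hodge (scaledForm 1 (Real.exp (6 * t))) (k := 3) (l := 4) rfl
            (scaledForm 1 (Real.exp (6 * t)))) := by
          exact contDiff_hodge_scaledForm one_ne_zero hm
        have hT := torsion_pullback hπ hG.2 (by rw [hpull]; exact hh)
        rw [hpull] at hT
        rw [laplacian_of_closed hc]
        apply pullback_injective hπ hs
        rw [extD_pullback hπ, hT, extD_torsion_scaledForm one_ne_zero hm]
        · have h1 : pullback π ((12 * Real.exp (12 * t)) • (φM - ηM)) =
              (12 * Real.exp (12 * t)) • (pullback π φM - pullback π ηM) := rfl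
          rw [h1, hφM, hηM, phiForm_eq_add, add_sub_cancel_left, div_one]
          congr 2
          rw [← Real.exp_nat_mul]
          congr 1
          push_cast
          ring
        · rw [hT, torsion_scaledForm one_ne_zero hm]
          exact contDiff_smul_invForm _ _
      rw [hL]
      have h1 : HasDerivAt (fun s => Real.exp (12 * s)) (Real.exp (12 * t) * 12) t := by
        simpa using ((hasDerivAt_id t).const_mul 12).exp
      refine ((h1.smul_const (φM m)).add ((h1.const_sub 1).smul_const (ηM m))).congr_deriv ?_
      rw [Pi.smul_apply, Pi.sub_apply, mul_comm 12]
      module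

/-! ### Exponential polynomials -/

/-- Integer polynomials in `x_1`, `x_2` and `e^{± x_0}`: the list of the terms
`(c, a, m, n)`, which stand for `c e^{a x_0} x_1^m x_2^n`. -/
abbrev ExpPoly : Type := List (ℤ × ℤ × ℕ × ℕ)

namespace ExpPoly

/-- The value of a monomial. -/
def evalMon (m : ℤ × ℕ × ℕ) (x : E7) : ℝ :=
  Real.exp (m.1 * x 0) * x 1 ^ m.2.1 * x 2 ^ m.2.2

/-- The value of an exponential polynomial. -/
def eval : ExpPoly → E7 → ℝ
  | [], _ => 0
  | t :: p, x => t.1 * evalMon t.2 x + eval p x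

/-- Add a term, collecting equal monomials. -/
def ins (t : ℤ × ℤ × ℕ × ℕ) : ExpPoly → ExpPoly
  | [] => [t]
  | s :: p => if s.2 = t.2 then
      (if s.1 + t.1 = 0 then p else (s.1 + t.1, s.2) :: p) else s :: ins t p

/-- Addition. -/
def add : ExpPoly → ExpPoly → ExpPoly
  | [], q => q
  | t :: p, q => ins t (add p q)

/-- Multiplication with a term. -/
def mulTerm (t : ℤ × ℤ × ℕ × ℕ) : ExpPoly → ExpPoly
  | [] => []
  | s :: p => (t.1 * s.1, t.2.1 + s.2.1, t.2.2.1 + s.2.2.1, t.2.2.2 + s.2.2.2) :: mulTerm t p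

/-- Multiplication. -/
def mul : ExpPoly → ExpPoly → ExpPoly
  | [], _ => []
  | t :: p, q => add (mulTerm t q) (mul p q)

/-- Multiplication with a constant. -/
def scale (c : ℤ) (p : ExpPoly) : ExpPoly := mulTerm (c, 0, 0, 0) p

/-- The derivative of a term. -/
def pderivTerm : ℕ → ℤ × ℤ × ℕ × ℕ → ExpPoly
  | 0, (c, a, m, n) => if a = 0 then [] else [(c * a, a, m, n)]
  | 1, (c, a, m, n) => if m = 0 then [] else [(c * m, a, m - 1, n)]
  | 2, (c, a, m, n) => if n = 0 then [] else [(c * n, a, m, n - 1)]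
  | _, _ => []

/-- The partial derivatives. -/
def pderiv (i : ℕ) : ExpPoly → ExpPoly
  | [] => []
  | t :: p => add (pderivTerm i t) (pderiv i p)

/-- Sums over the seven indices. -/
def sum (f : Fin 7 → ExpPoly) : ExpPoly :=
  add (f 0) (add (f 1) (add (f 2) (add (f 3) (add (f 4) (add (f 5) (f 6))))))

theorem eval_ins (t : ℤ × ℤ × ℕ × ℕ) (p : ExpPoly) (x : E7) :
    (ins t p).eval x = t.1 * evalMon t.2 x + p.eval x := by
  induction p with
  | nil => rfl
  | cons s p ih =>
    rw [ins]
    split_ifs with h1 h2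
    · have h3 : (s.1 : ℝ) + t.1 = 0 := by exact_mod_cast h2
      rw [eval, h1]
      linear_combination -evalMon t.2 x * h3
    · rw [eval, eval, h1]
      push_cast
      ring
    · rw [eval, eval, ih]
      ring

theorem eval_add (p q : ExpPoly) (x : E7) : (add p q).eval x = p.eval x + q.eval x := by
  induction p with
  | nil => simp [add, eval]
  | cons t p ih => rw [add, eval_ins, eval, ih, add_assoc]

theorem eval_mulTerm (t : ℤ × ℤ × ℕ × ℕ) (p : ExpPoly) (x : E7) :
    (mulTerm t p).eval x = t.1 * evalMon t.2 x * p.eval x := by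
  induction p with
  | nil => simp [mulTerm, eval]
  | cons s p ih =>
    rw [mulTerm, eval, eval, ih]
    simp only [evalMon, pow_add]
    push_cast
    rw [add_mul, Real.exp_add]
    ring

theorem eval_mul (p q : ExpPoly) (x : E7) : (mul p q).eval x = p.eval x * q.eval x := by
  induction p with
  | nil => simp [mul, eval]
  | cons t p ih => rw [mul, eval_add, eval_mulTerm, ih, eval, add_mul]

theorem eval_scale (c : ℤ) (p : ExpPoly) (x : E7) : (scale c p).eval x = c * p.eval x := by
  rw [scale, eval_mulTerm]
  simp [evalMon]

theorem eval_sum (f : Fin 7 → ExpPoly) (x : E7) : (sum f).eval x = ∑ i, (f i).eval x := by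
  simp only [sum, eval_add, Fin.sum_univ_succ, Fin.sum_univ_zero]
  simp [Fin.succ]

theorem pd_const_mul_add {f g : E7 → ℝ} {x : E7} (c : ℝ) (hf : DifferentiableAt ℝ f x)
    (hg : DifferentiableAt ℝ g x) (i : Fin 7) :
    pd i (fun y => c * f y + g y) x = c * pd i f x + pd i g x := by
  rw [pd, fderiv_fun_add (hf.const_mul c) hg, fderiv_const_mul hf]
  rfl

theorem differentiable_evalMon (m : ℤ × ℕ × ℕ) : Differentiable ℝ (evalMon m) := by
  unfold evalMon
  have h (i : Fin 7) : Differentiable ℝ fun x : E7 => x i := (contDiff_coord i).differentiable (by simp)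
  exact ((((h 0).const_mul _).exp).mul ((h 1).pow _)).mul ((h 2).pow _)

theorem differentiable_eval (p : ExpPoly) : Differentiable ℝ p.eval := by
  induction p with
  | nil => exact differentiable_const 0
  | cons t p ih => exact ((differentiable_evalMon t.2).const_mul _).add ih

theorem hasFDerivAt_coord (i : Fin 7) (x : E7) :
    HasFDerivAt (fun y : E7 => y i) (EuclideanSpace.proj i : E7 →L[ℝ] ℝ) x :=
  (EuclideanSpace.proj i : E7 →L[ℝ] ℝ).hasFDerivAt

/-- The case distinctions in `pderivTerm` drop zero terms and avoid the truncated exponent m - 1 at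
m = 0. -/
theorem pd_evalMon (t : ℤ × ℤ × ℕ × ℕ) (i : Fin 7) (x : E7) :
    t.1 * pd i (evalMon t.2) x = (pderivTerm i t).eval x := by
  obtain ⟨c, a, m, n⟩ := t
  have h := ((((hasFDerivAt_coord 0 x).const_mul (a : ℝ)).exp).mul
    ((hasFDerivAt_coord 1 x).pow m)).mul ((hasFDerivAt_coord 2 x).pow n)
  have h1 : pd i (evalMon (a, m, n)) x = _ := congrArg (fun A : E7 →L[ℝ] ℝ => A (stdVec i)) h.fderiv
  rw [h1]
  fin_cases i <;>
    simp [stdVec, pderivTerm, EuclideanSpace.proj, eval] <;>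
    split_ifs with h0 <;> simp [h0, eval, evalMon] <;> ring

theorem pd_eval (p : ExpPoly) (i : Fin 7) (x : E7) : pd i p.eval x = (pderiv i p).eval x := by
  induction p with
  | nil =>
    have h : eval [] = fun _ => 0 := rfl
    rw [pderiv, h, pd, fderiv_fun_const]
    rfl
  | cons t p ih =>
    rw [pderiv, eval_add, ← ih, ← pd_evalMon]
    exact pd_const_mul_add _ (differentiable_evalMon _ x) (differentiable_eval _ x) i

end ExpPoly

/-! ### The Ricci tensor -/

open ExpPoly

/-- The coefficients of the metric of Bryant's example, multiplied by four. -/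
def gramPoly (i j : Fin 7) : ExpPoly :=
  match i.1, j.1 with
  | 0, 0 => [(1, 0, 0, 0), (1, 0, 2, 0), (1, 0, 0, 2)]
  | 0, 1 | 1, 0 => [(-1, 0, 1, 0)]
  | 0, 2 | 2, 0 => [(-1, 0, 0, 1)]
  | 1, 1 | 2, 2 => [(1, 0, 0, 0)]
  | 3, 3 | 4, 4 => [(4, -1, 0, 0), (4, -1, 2, 0), (4, -1, 0, 2)]
  | 5, 5 | 6, 6 => [(4, 1, 0, 0)]
  | 3, 5 | 5, 3 | 4, 6 | 6, 4 => [(-4, 0, 1, 0)]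
  | 4, 5 | 5, 4 => [(-4, 0, 0, 1)]
  | 3, 6 | 6, 3 => [(4, 0, 0, 1)]
  | _, _ => []

/-- The coefficients of the inverse of the metric. -/
def gramInvPoly (i j : Fin 7) : ExpPoly :=
  match i.1, j.1 with
  | 0, 0 => [(4, 0, 0, 0)]
  | 0, 1 | 1, 0 => [(4, 0, 1, 0)]
  | 0, 2 | 2, 0 => [(4, 0, 0, 1)]
  | 1, 1 => [(4, 0, 0, 0), (4, 0, 2, 0)]
  | 1, 2 | 2, 1 => [(4, 0, 1, 1)]
  | 2, 2 => [(4, 0, 0, 0), (4, 0, 0, 2)]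
  | 3, 3 | 4, 4 => [(1, 1, 0, 0)]
  | 5, 5 | 6, 6 => [(1, -1, 0, 0), (1, -1, 2, 0), (1, -1, 0, 2)]
  | 3, 5 | 5, 3 | 4, 6 | 6, 4 => [(1, 0, 1, 0)]
  | 4, 5 | 5, 4 => [(1, 0, 0, 1)]
  | 3, 6 | 6, 3 => [(-1, 0, 0, 1)]
  | _, _ => []

/-- The Christoffel symbols, multiplied by eight. -/
def christoffelPoly (k i j : Fin 7) : ExpPoly :=
  ExpPoly.sum fun l => mul (gramInvPoly k l) (add (pderiv i (gramPoly j l))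
    (add (pderiv j (gramPoly i l)) (scale (-1) (pderiv l (gramPoly i j)))))

/-- The Ricci tensor, multiplied by `64`. -/
def ricciPoly (i j : Fin 7) : ExpPoly :=
  ExpPoly.sum fun k => add
    (scale 8 (add (pderiv k (christoffelPoly k i j))
      (scale (-1) (pderiv j (christoffelPoly k i k)))))
    (ExpPoly.sum fun l => add (mul (christoffelPoly k k l) (christoffelPoly l i j))
      (scale (-1) (mul (christoffelPoly k j l) (christoffelPoly l i k))))

/-- The diagonal value is 4 because `gramPoly` is four times the Gram matrix. Since `ins` merges
equal monomials and removes zeros, the product reduces literally to the stated list. -/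
theorem sum_gramPoly_mul : ∀ i j : Fin 7,
    ExpPoly.sum (fun l => mul (gramPoly i l) (gramInvPoly l j)) =
      if i = j then [(4, 0, 0, 0)] else [] := by
  decide +kernel

/-- The factor is 192 = 64·3: `ricciPoly` is 64 times the Ricci tensor, and -12g = -3·(4g) on the
base block. All other entries cancel to the empty list. -/
theorem ricciPoly_eq : ∀ i j : Fin 7, add (ricciPoly i j)
    (if i < 3 ∧ j < 3 then scale 192 (gramPoly i j) else []) = [] := by
  decide +kernel

theorem metric_phiForm_eq (x u v : E7) : 4 * metric phiForm x ![u, v] =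
    ∑ i, ∑ j, (gramPoly i j).eval x * u i * v j := by
  have hE : Real.exp (x 0) = Real.exp (x 0 / 2) ^ 2 := by
    rw [← Real.exp_nat_mul]
    congr 1
    push_cast
    ring
  have hF : Real.exp (-x 0) = Real.exp (-(x 0 / 2)) ^ 2 := by
    rw [← Real.exp_nat_mul]
    congr 1
    push_cast
    ring
  have hEF : Real.exp (-(x 0 / 2)) * Real.exp (x 0 / 2) = 1 := by
    rw [← Real.exp_add]
    simp
  simp only [metric_phiForm_apply, bBry_repr, coframe_apply, Fin.sum_univ_seven]
  simp [gramPoly, ExpPoly.eval, evalMon, hE, hF]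
  generalize Real.exp (-(x 0 / 2)) = p at *
  generalize Real.exp (x 0 / 2) = q at *
  linear_combination (-4 * (u 5 * (x 1 * v 3 + x 2 * v 4) + v 5 * (x 1 * u 3 + x 2 * u 4) +
    u 6 * (x 1 * v 4 - x 2 * v 3) + v 6 * (x 1 * u 4 - x 2 * u 3))) * hEF

/-- The first three squares of the coframe are the hyperbolic metric in the variables x_0, x_1, x_2,
that is, the upper left block of the Gram matrix. -/
theorem metric_phiForm_base (x u v : E7) :
    4 * ∑ a : Fin 3, bBry.repr (coframe x u) (Fin.castLE (by simp) a) *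
      bBry.repr (coframe x v) (Fin.castLE (by simp) a) =
    ∑ i, ∑ j, (if i < 3 ∧ j < 3 then (gramPoly i j).eval x else 0) * u i * v j := by
  simp only [bBry_repr, coframe_apply, Fin.sum_univ_seven, Fin.sum_univ_three]
  simp [gramPoly, ExpPoly.eval, evalMon]
  ring

theorem gram_metric_phiForm (x : E7) (i j : Fin 7) :
    gram (metric phiForm) x i j = (gramPoly i j).eval x / 4 := by
  have h := metric_phiForm_eq x (stdVec i) (stdVec j)
  simp only [stdVec, PiLp.single_apply, mul_ite, mul_one, mul_zero,
    Finset.sum_ite_eq', Finset.mem_univ, if_true] at h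
  rw [gram, Matrix.of_apply]
  simp only [stdVec]
  linarith

theorem gram_inv_metric_phiForm (x : E7) (i j : Fin 7) :
    (gram (metric phiForm) x)⁻¹ i j = (gramInvPoly i j).eval x := by
  have h : (gram (metric phiForm) x)⁻¹ = Matrix.of fun i j => (gramInvPoly i j).eval x := by
    apply Matrix.inv_eq_right_inv
    ext i j
    have h1 := congrArg (fun p : ExpPoly => p.eval x / 4) (sum_gramPoly_mul i j)
    simp only [eval_sum, eval_mul] at h1
    rw [Matrix.mul_apply, Matrix.one_apply]
    simp only [gram_metric_phiForm, Matrix.of_apply, div_mul_eq_mul_div, ← Finset.sum_div]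
    rw [h1]
    split_ifs <;> simp [ExpPoly.eval, evalMon]
  rw [h, Matrix.of_apply]

theorem pd_eval_div (p : ExpPoly) (c : ℝ) (i : Fin 7) (x : E7) :
    pd i (fun y => p.eval y / c) x = (ExpPoly.pderiv i p).eval x / c := by
  rw [← pd_eval, pd, pd]
  simp only [div_eq_mul_inv]
  rw [fderiv_mul_const (differentiable_eval p x)]
  simp [mul_comm]

theorem christoffel_metric_phiForm (k i j : Fin 7) :
    christoffel (metric phiForm) k i j = fun x => (christoffelPoly k i j).eval x / 8 := by
  ext1 x
  simp only [christoffel, gram_metric_phiForm, gram_inv_metric_phiForm, pd_eval_div,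
    christoffelPoly, eval_sum, eval_mul, eval_add, eval_scale]
  rw [Finset.mul_sum, Finset.sum_div]
  refine Finset.sum_congr rfl fun l _ => ?_
  push_cast
  ring

theorem ricciCoord_metric_phiForm (i j : Fin 7) (x : E7) :
    ricciCoord (metric phiForm) i j x =
      -3 * if i < 3 ∧ j < 3 then (gramPoly i j).eval x else 0 := by
  have h1 : ricciCoord (metric phiForm) i j x = (ricciPoly i j).eval x / 64 := by
    simp only [ricciCoord, christoffel_metric_phiForm, pd_eval_div, ricciPoly, eval_sum, eval_mul,
      eval_add, eval_scale]
    rw [Finset.sum_div]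
    refine Finset.sum_congr rfl fun k _ => ?_
    rw [add_div, Finset.sum_div]
    congr 1
    · push_cast
      ring
    · refine Finset.sum_congr rfl fun l _ => ?_
      push_cast
      ring
  have h2 := congrArg (fun p : ExpPoly => p.eval x) (ricciPoly_eq i j)
  simp only [eval_add] at h2
  rw [h1]
  split_ifs at h2 ⊢
  · rw [eval_scale] at h2
    simp only [ExpPoly.eval] at h2
    push_cast at h2
    linarith
  · simp only [ExpPoly.eval] at h2
    linarith

theorem ricci_metric_phiForm (x u v : E7) : ricci (metric phiForm) x u v =
    ∑ i, (if i < 3 then -12 else 0 : ℝ) *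
      (bBry.repr (coframe x u) i * bBry.repr (coframe x v) i) := by
  have h := metric_phiForm_base x u v
  have h1 : ricci (metric phiForm) x u v =
      ∑ i, ∑ j, ricciCoord (metric phiForm) i j x * u i * v j := by
    simp only [ricci, localTensor_model, chart_model, diffAt_refl]
    rfl
  rw [h1]
  simp only [ricciCoord_metric_phiForm, mul_assoc, ← Finset.mul_sum] at h ⊢
  rw [← h]
  simp [Fin.sum_univ_seven, Fin.sum_univ_three, Fin.castLE]
  ring

theorem ricci_phiForm_basis (i j : Fin 7) :
    ricci (metric phiForm) oBry (bBry i) (bBry j) = if i = j ∧ i < 3 then -12 else 0 := by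
  rw [ricci_metric_phiForm, oBry, coframe_zero]
  simp only [ContinuousLinearEquiv.refl_apply, Module.Basis.repr_self, Finsupp.single_apply]
  by_cases h : i = j
  · subst h
    simp
  · simp [h]

theorem ricci_phiForm_eq_add (u v : E7) : ricci (metric phiForm) oBry u v =
    -12 * metric phiForm oBry ![u, v] + metric phiForm oBry ![fiberScale 12 u, v] := by
  rw [ricci_metric_phiForm, metric_phiForm_zero, metric_phiForm_zero, oBry, coframe_zero,
    Finset.mul_sum, ← Finset.sum_add_distrib]
  refine Finset.sum_congr rfl fun i _ => ?_
  rw [repr_fiberScale]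
  simp only [ContinuousLinearEquiv.refl_apply]
  split_ifs <;> ring

theorem exists_ricci_derivation : ∃ E : LieDerivation ℝ gBry gBry, IsBlockScalar E 12 ∧
    (∀ Y ∈ pBry, E Y ∈ pBry) ∧
      ∀ Y ∈ pBry, ∀ Z ∈ pBry, ricci (metric phiForm) oBry (tang Y.1) (tang Z.1) =
        -12 * metric phiForm oBry ![tang Y.1, tang Z.1]
          + metric phiForm oBry ![tang (E Y).1, tang Z.1] :=
  ⟨blockDerivation 12, isBlockScalar_blockDerivation 12, blockDerivation_pBry 12,
    fun Y _ Z _ => by rw [ricci_phiForm_eq_add, tang_blockDerivation]⟩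

/-- In the coframe Ric = Diag(-12, 0) and the Lie derivative of g is Diag(0, 12) on base and fibre,
so that the two differ by -12g. -/
theorem isRicciSoliton_phiForm : IsRicciSoliton (M := E7) (metric phiForm) (-12) := by
  refine ⟨solitonField, isCompleteField_solitonField, fun x u v => ?_⟩
  rw [ricci_metric_phiForm, lieDer_metric_phiForm, metric_phiForm_apply, Finset.mul_sum,
    ← Finset.sum_add_distrib]
  refine Finset.sum_congr rfl fun i _ => ?_
  split_ifs <;> ring

/-! ### Invariant 3-forms -/

theorem lowerTri_zero : lowerTri oBry = 1 := by
  ext i j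
  fin_cases i <;> fin_cases j <;> simp [lowerTri, oBry, Complex.ext_iff]

/-- The unitary matrix of `exists_unitary` is determined by L'k = AL, so any matrix with this
property may be used. -/
theorem IsGInvariant.apply_smul {n : ℕ} {α : Form E7 n} (hα : IsGInvariant α) (a : GBry) (x : E7)
    {k : Matrix (Fin 2) (Fin 2) ℂ} (hk : lowerTri (a • x) * k = linPart a.1.1 * lowerTri x)
    {u v : Fin n → E7}
    (h : ∀ i, hermHat (coframe (a • x) (v i)) = k * hermHat (coframe x (u i)) * kᴴ ∧
      vecPart (coframe (a • x) (v i)) = k *ᵥ vecPart (coframe x (u i))) :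
    α (a • x) v = α x u := by
  obtain ⟨k', -, hk', h'⟩ := exists_unitary a x
  have hu : IsUnit (lowerTri (a • x)).det := by
    rw [det_lowerTri]
    exact isUnit_one
  have hkk : k' = k := by
    rw [← hk] at hk'
    have h1 := congrArg (fun Z => (lowerTri (a • x))⁻¹ * Z) hk'
    simpa only [← Matrix.mul_assoc, Matrix.nonsing_inv_mul _ hu, Matrix.one_mul] using h1
  subst hkk
  have hv : v = diffAt (fun y : E7 => a • y) x ∘ u := by
    ext1 i
    apply (coframe (a • x)).injective
    exact ext_hermHat ((h i).1.trans (h' (u i)).1.symm) ((h i).2.trans (h' (u i)).2.symm)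
  have h1 := congrArg (fun γ : Alt n => γ u) (congrFun (hα a) x)
  rw [hv]
  exact h1

/-- For the section of lower triangular elements k = 1: an invariant form is constant in the
coframe. -/
theorem IsGInvariant.eq_comp_coframe {n : ℕ} {α : Form E7 n} (hα : IsGInvariant α) (x : E7) :
    α x = (α oBry).compContinuousLinearMap (coframe x : E7 →L[ℝ] E7) := by
  ext v
  have h := hα.apply_smul (sectionG x) oBry (k := 1) (u := coframe x ∘ v) (v := v)
  rw [sectionG_smul, lowerTri_zero, sectionG, linPart_mkG, oBry, coframe_zero] at h
  exact h rfl fun i => by simp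

theorem IsGInvariant.apply_isotropy {n : ℕ} {α : Form E7 n} (hα : IsGInvariant α)
    {k : Matrix (Fin 2) (Fin 2) ℂ} (hd : k.det = 1) (hk : k * kᴴ = 1) {u v : Fin n → E7}
    (h : ∀ i, hermHat (v i) = k * hermHat (u i) * kᴴ ∧ vecPart (v i) = k *ᵥ vecPart (u i)) :
    α oBry v = α oBry u := by
  have ho : mkG k 0 hd • oBry = oBry := by
    apply ext_herm_vecPart
    · rw [herm_smul_zero, linPart_mkG, hk, herm_zero]
    · rw [vecPart_smul_zero, transPart_mkG, vecPart_zero]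
  have h1 := hα.apply_smul (mkG k 0 hd) oBry (k := k) (u := u) (v := v)
  rw [ho, lowerTri_zero, linPart_mkG, Matrix.one_mul, Matrix.mul_one, oBry, coframe_zero] at h1
  exact h1 rfl h

section Trilinear

variable (α : Alt 3) (x y z w : E7) (c : ℝ)

theorem alt_swap_zero_one : α ![y, x, z] = -α ![x, y, z] := by
  have h : ![y, x, z] = ![x, y, z] ∘ Equiv.swap 0 1 := by
    ext1 i
    fin_cases i <;> rfl
  rw [h]
  exact α.map_swap ![x, y, z] (i := 0) (j := 1) (by decide)

theorem alt_swap_one_two : α ![x, z, y] = -α ![x, y, z] := by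
  have h : ![x, z, y] = ![x, y, z] ∘ Equiv.swap 1 2 := by
    ext1 i
    fin_cases i <;> rfl
  rw [h]
  exact α.map_swap ![x, y, z] (i := 1) (j := 2) (by decide)

theorem alt_self_one_two : α ![x, y, y] = 0 := by
  linarith [alt_swap_one_two α x y y]

theorem update_zero : Function.update ![x, y, z] 0 w = ![w, y, z] := by
  ext1 i
  fin_cases i <;> rfl

theorem update_one : Function.update ![x, y, z] 1 w = ![x, w, z] := by
  ext1 i
  fin_cases i <;> rfl

theorem update_two : Function.update ![x, y, z] 2 w = ![x, y, w] := by
  ext1 i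
  fin_cases i <;> rfl

theorem alt_add_two : α ![x, y, z + w] = α ![x, y, z] + α ![x, y, w] := by
  simpa only [update_zero, update_one, update_two, smul_eq_mul] using
    α.map_update_add ![x, y, z] 2 z w

theorem alt_smul_two : α ![x, y, c • z] = c * α ![x, y, z] := by
  simpa only [update_zero, update_one, update_two, smul_eq_mul] using
    α.map_update_smul ![x, y, z] 2 c z

theorem alt_add_one : α ![x, y + w, z] = α ![x, y, z] + α ![x, w, z] := by
  simpa only [update_zero, update_one, update_two, smul_eq_mul] using
    α.map_update_add ![x, y, z] 1 y w

theorem alt_smul_one : α ![x, c • y, z] = c * α ![x, y, z] := by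
  simpa only [update_zero, update_one, update_two, smul_eq_mul] using
    α.map_update_smul ![x, y, z] 1 c y

theorem alt_smul_zero : α ![c • x, y, z] = c * α ![x, y, z] := by
  simpa only [update_zero, update_one, update_two, smul_eq_mul] using
    α.map_update_smul ![x, y, z] 0 c x

end Trilinear

open Complex in
/-- The element `diag(i, -i)` of `SU(2)`. -/
def isoI : Matrix (Fin 2) (Fin 2) ℂ := !![I, 0; 0, -I]

/-- The element `[0 1; -1 0]` of `SU(2)`. -/
def isoJ : Matrix (Fin 2) (Fin 2) ℂ := !![0, 1; -1, 0]

/-- An element of order six of `SU(2)`. -/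
def isoC : Matrix (Fin 2) (Fin 2) ℂ :=
  !![⟨1 / 2, 1 / 2⟩, ⟨1 / 2, 1 / 2⟩; ⟨-1 / 2, 1 / 2⟩, ⟨1 / 2, -1 / 2⟩]

/-- The element permutes the basis up to signs, so invariance equates components of α in pairs; the
same is true of `isoJ`. -/
theorem isoI_basis (i : Fin 7) :
    hermHat ((![1, -1, -1, 1, -1, 1, -1] : Fin 7 → ℝ) i • bBry (![0, 1, 2, 4, 3, 6, 5] i)) =
        isoI * hermHat (bBry i) * isoIᴴ ∧
      vecPart ((![1, -1, -1, 1, -1, 1, -1] : Fin 7 → ℝ) i • bBry (![0, 1, 2, 4, 3, 6, 5] i)) =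
        isoI *ᵥ vecPart (bBry i) := by
  constructor
  · ext j k
    fin_cases i <;> fin_cases j <;> fin_cases k <;>
      simp [bBry_apply, hermHat, isoI, Matrix.mul_apply, Complex.ext_iff]
  · ext j
    fin_cases i <;> fin_cases j <;>
      simp [bBry_apply, vecPart, isoI, Complex.ext_iff]

theorem isoJ_basis (i : Fin 7) :
    hermHat ((![-1, 1, -1, -1, 1, 1, -1] : Fin 7 → ℝ) i • bBry (![0, 1, 2, 5, 6, 3, 4] i)) =
        isoJ * hermHat (bBry i) * isoJᴴ ∧
      vecPart ((![-1, 1, -1, -1, 1, 1, -1] : Fin 7 → ℝ) i • bBry (![0, 1, 2, 5, 6, 3, 4] i)) =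
        isoJ *ᵥ vecPart (bBry i) := by
  constructor
  · ext j k
    fin_cases i <;> fin_cases j <;> fin_cases k <;>
      simp [bBry_apply, hermHat, isoJ, Matrix.mul_apply, Complex.ext_iff]
  · ext j
    fin_cases i <;> fin_cases j <;>
      simp [bBry_apply, vecPart, isoJ, Complex.ext_iff]

/-- The images of the basis vectors under `isoC`. -/
def isoCImage : Fin 7 → E7 :=
  ![(-1 : ℝ) • bBry 1, (-1 : ℝ) • bBry 2, bBry 0,
    (1 / 2 : ℝ) • bBry 3 + (1 / 2 : ℝ) • bBry 4 + (-1 / 2 : ℝ) • bBry 5 + (-1 / 2 : ℝ) • bBry 6,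
    (-1 / 2 : ℝ) • bBry 3 + (1 / 2 : ℝ) • bBry 4 + (-1 / 2 : ℝ) • bBry 5 + (1 / 2 : ℝ) • bBry 6,
    (1 / 2 : ℝ) • bBry 3 + (1 / 2 : ℝ) • bBry 4 + (1 / 2 : ℝ) • bBry 5 + (1 / 2 : ℝ) • bBry 6,
    (1 / 2 : ℝ) • bBry 3 + (-1 / 2 : ℝ) • bBry 4 + (-1 / 2 : ℝ) • bBry 5 + (1 / 2 : ℝ) • bBry 6]

/-- Up to signs this element permutes e_1, e_2, e_3 cyclically, which links the components that
`isoI` and `isoJ` leave unrelated. -/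
theorem isoC_basis (i : Fin 7) :
    hermHat (isoCImage i) = isoC * hermHat (bBry i) * isoCᴴ ∧
      vecPart (isoCImage i) = isoC *ᵥ vecPart (bBry i) := by
  constructor
  · ext j k
    fin_cases i <;> fin_cases j <;> fin_cases k <;>
      simp [isoCImage, bBry_apply, hermHat, isoC, Matrix.mul_apply, Complex.ext_iff] <;> norm_num
  · ext j
    fin_cases i <;> fin_cases j <;>
      simp [isoCImage, bBry_apply, vecPart, isoC, Complex.ext_iff] <;> norm_num

theorem IsGInvariant.isoI_apply {α : Form E7 3} (hα : IsGInvariant α) (i j k : Fin 7) :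
    (![1, -1, -1, 1, -1, 1, -1] : Fin 7 → ℝ) i * (![1, -1, -1, 1, -1, 1, -1] : Fin 7 → ℝ) j *
      (![1, -1, -1, 1, -1, 1, -1] : Fin 7 → ℝ) k *
      α oBry ![bBry (![0, 1, 2, 4, 3, 6, 5] i), bBry (![0, 1, 2, 4, 3, 6, 5] j),
        bBry (![0, 1, 2, 4, 3, 6, 5] k)] = α oBry ![bBry i, bBry j, bBry k] := by
  rw [← hα.apply_isotropy (k := isoI) (by simp [isoI, Matrix.det_fin_two]) (by
    ext i j
    fin_cases i <;> fin_cases j <;> simp [isoI, Matrix.mul_apply]) (u := ![bBry i, bBry j, bBry k])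
    (v := ![_, _, _]) (Fin.forall_fin_succ.2 ⟨isoI_basis i, Fin.forall_fin_two.2
      ⟨isoI_basis j, isoI_basis k⟩⟩), alt_smul_zero, alt_smul_one, alt_smul_two]
  ring

theorem IsGInvariant.isoJ_apply {α : Form E7 3} (hα : IsGInvariant α) (i j k : Fin 7) :
    (![-1, 1, -1, -1, 1, 1, -1] : Fin 7 → ℝ) i * (![-1, 1, -1, -1, 1, 1, -1] : Fin 7 → ℝ) j *
      (![-1, 1, -1, -1, 1, 1, -1] : Fin 7 → ℝ) k *
      α oBry ![bBry (![0, 1, 2, 5, 6, 3, 4] i), bBry (![0, 1, 2, 5, 6, 3, 4] j),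
        bBry (![0, 1, 2, 5, 6, 3, 4] k)] = α oBry ![bBry i, bBry j, bBry k] := by
  rw [← hα.apply_isotropy (k := isoJ) (by simp [isoJ, Matrix.det_fin_two]) (by
    ext i j
    fin_cases i <;> fin_cases j <;> simp [isoJ, Matrix.mul_apply]) (u := ![bBry i, bBry j, bBry k])
    (v := ![_, _, _]) (Fin.forall_fin_succ.2 ⟨isoJ_basis i, Fin.forall_fin_two.2
      ⟨isoJ_basis j, isoJ_basis k⟩⟩), alt_smul_zero, alt_smul_one, alt_smul_two]
  ring

theorem IsGInvariant.isoC_apply {α : Form E7 3} (hα : IsGInvariant α) (i j k : Fin 7) :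
    α oBry ![isoCImage i, isoCImage j, isoCImage k] = α oBry ![bBry i, bBry j, bBry k] := by
  refine hα.apply_isotropy (k := isoC) ?_ ?_ (Fin.forall_fin_succ.2 ⟨isoC_basis i,
    Fin.forall_fin_two.2 ⟨isoC_basis j, isoC_basis k⟩⟩)
  · simp [isoC, Matrix.det_fin_two, Complex.ext_iff]
    norm_num
  · ext i j
    fin_cases i <;> fin_cases j <;> simp [isoC, Matrix.mul_apply, Complex.ext_iff] <;> norm_num

theorem coeffOf_eta : ∀ i j : Fin 7, i < j → ∀ k, j < k →
    coeffOf etaL ![i, j, k] = if i = 0 ∧ j = 1 ∧ k = 2 then 1 else 0 := by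
  decide +kernel

theorem coeffOf_beta : ∀ i j : Fin 7, i < j → ∀ k, j < k → coeffOf betaL ![i, j, k] =
    if i = 0 ∧ j = 3 ∧ k = 4 ∨ i = 0 ∧ j = 5 ∧ k = 6 ∨ i = 1 ∧ j = 3 ∧ k = 5 then 1 else
    if i = 1 ∧ j = 4 ∧ k = 6 ∨ i = 2 ∧ j = 3 ∧ k = 6 ∨ i = 2 ∧ j = 4 ∧ k = 5 then -1 else 0 := by
  decide +kernel

-- For each component outside η and β, the relations from I, from J, and from I at the image of the
-- triple under I, combined with antisymmetry, form a linear system with only the zero solution.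
set_option maxHeartbeats 1600000 in
theorem eq_zero_of_symmetries {f : Fin 7 → Fin 7 → Fin 7 → ℝ}
    (hI : ∀ i j k, (![1, -1, -1, 1, -1, 1, -1] : Fin 7 → ℝ) i *
      (![1, -1, -1, 1, -1, 1, -1] : Fin 7 → ℝ) j * (![1, -1, -1, 1, -1, 1, -1] : Fin 7 → ℝ) k *
      f (![0, 1, 2, 4, 3, 6, 5] i) (![0, 1, 2, 4, 3, 6, 5] j) (![0, 1, 2, 4, 3, 6, 5] k) = f i j k)
    (hJ : ∀ i j k, (![-1, 1, -1, -1, 1, 1, -1] : Fin 7 → ℝ) i *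
      (![-1, 1, -1, -1, 1, 1, -1] : Fin 7 → ℝ) j * (![-1, 1, -1, -1, 1, 1, -1] : Fin 7 → ℝ) k *
      f (![0, 1, 2, 5, 6, 3, 4] i) (![0, 1, 2, 5, 6, 3, 4] j) (![0, 1, 2, 5, 6, 3, 4] k) = f i j k)
    (hs : ∀ i j k, f j i k = -f i j k) (ht : ∀ i j k, f i k j = -f i j k) (i j : Fin 7)
    (hij : i < j) (k : Fin 7) (hjk : j < k) (h1 : coeffOf etaL ![i, j, k] = 0)
    (h2 : coeffOf betaL ![i, j, k] = 0) : f i j k = 0 := by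
  rw [coeffOf_eta i j hij k hjk] at h1
  rw [coeffOf_beta i j hij k hjk] at h2
  have hperm : ∀ i j k, f i k j = -f i j k ∧ f j i k = -f i j k ∧ f j k i = f i j k ∧
      f k i j = f i j k ∧ f k j i = -f i j k := fun i j k =>
    ⟨ht i j k, hs i j k, by linarith [ht j i k, hs i j k], by linarith [ht i j k, hs i k j],
      by linarith [ht i j k, hs i k j, ht k i j]⟩
  have a := hI i j k
  have c := hJ i j k
  have d := hI (![0, 1, 2, 4, 3, 6, 5] i) (![0, 1, 2, 4, 3, 6, 5] j) (![0, 1, 2, 4, 3, 6, 5] k)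
  obtain ⟨p1, p2, p3, p4, p5⟩ := hperm i j k
  obtain ⟨q1, q2, q3, q4, q5⟩ := hperm (![0, 1, 2, 4, 3, 6, 5] i) (![0, 1, 2, 4, 3, 6, 5] j)
    (![0, 1, 2, 4, 3, 6, 5] k)
  clear hI hJ hs ht hperm
  fin_cases i <;> fin_cases j <;> (try exact absurd hij (by decide)) <;> fin_cases k <;>
    (try exact absurd hjk (by decide)) <;> (try exact absurd h1 (by decide)) <;>
    (try exact absurd h2 (by decide)) <;>
    simp only [Fin.reduceFinMk, Matrix.cons_val, one_mul, mul_one, mul_neg, neg_mul, neg_neg]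
      at a c d p1 p2 p3 p4 p5 q1 q2 q3 q4 q5 ⊢ <;>
    linarith

/-- After `eq_zero_of_symmetries` seven components remain. The elements I and J pair up six of them,
and two relations from C tie these to a single number, the coefficient of β. -/
theorem IsGInvariant.eq_at_zero {α : Form E7 3} (hα : IsGInvariant α) :
    α oBry = α oBry ![bBry 0, bBry 1, bBry 2] • formOf bBry etaL +
      α oBry ![bBry 0, bBry 3, bBry 4] • formOf bBry betaL := by
  have hI := hα.isoI_apply
  have hJ := hα.isoJ_apply
  have hC0 := hα.isoC_apply 0 3 4
  have hC2 := hα.isoC_apply 2 3 6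
  have hs : ∀ i j k : Fin 7, α oBry ![bBry j, bBry i, bBry k] = -α oBry ![bBry i, bBry j, bBry k] :=
    fun i j k => alt_swap_zero_one _ _ _ _
  have ht : ∀ i j k : Fin 7, α oBry ![bBry i, bBry k, bBry j] = -α oBry ![bBry i, bBry j, bBry k] :=
    fun i j k => alt_swap_one_two _ _ _ _
  have hr : ∀ i j : Fin 7, α oBry ![bBry i, bBry j, bBry j] = 0 :=
    fun i j => alt_self_one_two _ _ _
  have hC0' : α oBry ![(-1 : ℝ) • bBry 1,
    (1 / 2 : ℝ) • bBry 3 + (1 / 2 : ℝ) • bBry 4 + (-1 / 2 : ℝ) • bBry 5 + (-1 / 2 : ℝ) • bBry 6,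
    (-1 / 2 : ℝ) • bBry 3 + (1 / 2 : ℝ) • bBry 4 + (-1 / 2 : ℝ) • bBry 5 + (1 / 2 : ℝ) • bBry 6] =
    α oBry ![bBry 0, bBry 3, bBry 4] := hC0
  have hC2' : α oBry ![bBry 0,
    (1 / 2 : ℝ) • bBry 3 + (1 / 2 : ℝ) • bBry 4 + (-1 / 2 : ℝ) • bBry 5 + (-1 / 2 : ℝ) • bBry 6,
    (1 / 2 : ℝ) • bBry 3 + (-1 / 2 : ℝ) • bBry 4 + (-1 / 2 : ℝ) • bBry 5 + (1 / 2 : ℝ) • bBry 6] =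
    α oBry ![bBry 2, bBry 3, bBry 6] := hC2
  simp only [alt_smul_zero, alt_smul_one, alt_smul_two, alt_add_one, alt_add_two, hr] at hC0' hC2'
  obtain ⟨f, hf⟩ : ∃ f : Fin 7 → Fin 7 → Fin 7 → ℝ,
      ∀ i j k, α oBry ![bBry i, bBry j, bBry k] = f i j k := ⟨_, fun _ _ _ => rfl⟩
  simp only [hf] at hI hJ hs ht hC0' hC2'
  clear hC0 hC2 hr
  have h0 := eq_zero_of_symmetries hI hJ hs ht
  have hz : ∀ i j k, i < j → j < k → coeffOf etaL ![i, j, k] = 0 →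
      coeffOf betaL ![i, j, k] = 0 → f i j k = 0 := fun i j k hij hjk => h0 i j hij k hjk
  have hJ034 : -1 * -1 * 1 * f 0 5 6 = f 0 3 4 := hJ 0 3 4
  have hI135 : -1 * 1 * 1 * f 1 4 6 = f 1 3 5 := hI 1 3 5
  have hI236 : -1 * 1 * -1 * f 2 4 5 = f 2 3 6 := hI 2 3 6
  -- Expanding the C-relation for (e_1, e_4, e_5) leaves half of f 1 3 5 - f 1 4 6, and the two
  -- terms are opposite by I.
  have h135 : f 1 3 5 = f 0 3 4 := by
    linarith [ht 1 3 4, ht 1 3 5, ht 1 3 6, ht 1 4 5, ht 1 4 6, ht 1 5 6,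
      hz 1 3 4 (by decide) (by decide) (by decide) (by decide),
      hz 1 3 6 (by decide) (by decide) (by decide) (by decide),
      hz 1 4 5 (by decide) (by decide) (by decide) (by decide),
      hz 1 5 6 (by decide) (by decide) (by decide) (by decide)]
  have h236 : f 2 3 6 = -f 0 3 4 := by
    linarith [ht 0 3 4, ht 0 3 5, ht 0 3 6, ht 0 4 5, ht 0 4 6, ht 0 5 6,
      hz 0 3 5 (by decide) (by decide) (by decide) (by decide),
      hz 0 3 6 (by decide) (by decide) (by decide) (by decide),
      hz 0 4 5 (by decide) (by decide) (by decide) (by decide),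
      hz 0 4 6 (by decide) (by decide) (by decide) (by decide)]
  have key : ∀ i j, i < j → ∀ k, j < k → f i j k =
      f 0 1 2 * coeffOf etaL ![i, j, k] + f 0 3 4 * coeffOf betaL ![i, j, k] := by
    intro i j hij k hjk
    have h1 := coeffOf_eta i j hij k hjk
    have h2 := coeffOf_beta i j hij k hjk
    have h3 := h0 i j hij k hjk
    rw [h1, h2] at h3
    rw [h1, h2]
    split_ifs at h3 ⊢ with g1 g2 g3 g2 g3 <;> try omega
    · obtain ⟨rfl, rfl, rfl⟩ := g1
      simp
    · rcases g2 with ⟨rfl, rfl, rfl⟩ | ⟨rfl, rfl, rfl⟩ | ⟨rfl, rfl, rfl⟩ <;> push_cast <;> linarith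
    · rcases g3 with ⟨rfl, rfl, rfl⟩ | ⟨rfl, rfl, rfl⟩ | ⟨rfl, rfl, rfl⟩ <;> push_cast <;> linarith
    · rw [h3 rfl rfl]
      simp
  refine alt_ext_increasing bBry (forall_strictMono_three fun i j hij k hjk => ?_)
  rw [ContinuousAlternatingMap.add_apply, ContinuousAlternatingMap.smul_apply,
    ContinuousAlternatingMap.smul_apply, formOf_basis, formOf_basis, hf, hf, smul_eq_mul,
    smul_eq_mul, ← key i j hij k hjk, ← hf]
  congr 1
  ext1 a
  fin_cases a <;> rfl

/-! ### Uniqueness of the invariant Laplacian flow -/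

/-- The components of φ(u, v, ·) are those of the cross product, for which |u × v|² = |u|²|v|² - ⟨u,
v⟩². If it vanishes, equality holds in the Cauchy–Schwarz inequality and u, v are dependent. -/
theorem phiBry_nondegenerate (e : Module.Basis (Fin 7) ℝ E7) {u v : E7}
    (h : ∀ w, phiBry e ![u, v, w] = 0) : ¬ LinearIndependent ℝ ![u, v] := by
  intro hi
  obtain ⟨p, hp⟩ : ∃ p : Fin 7 → ℝ, ∀ i, e.repr u i = p i := ⟨_, fun _ => rfl⟩
  obtain ⟨q, hq⟩ : ∃ q : Fin 7 → ℝ, ∀ i, e.repr v i = q i := ⟨_, fun _ => rfl⟩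
  have hk : ∀ k, phiBry e ![u, v, e k] = 0 := fun k => h (e k)
  simp only [phiBry, ContinuousAlternatingMap.add_apply, ContinuousAlternatingMap.sub_apply,
    dualForm_apply, Matrix.det_fin_three, Matrix.of_apply, Matrix.cons_val, hp, hq,
    Module.Basis.repr_self, Finsupp.single_apply] at hk
  have h0 : p 1 * q 2 - p 2 * q 1 + (p 3 * q 4 - p 4 * q 3) + (p 5 * q 6 - p 6 * q 5) = 0 := by
    simpa using hk 0
  have h1 : -(p 0 * q 2 - p 2 * q 0) + (p 3 * q 5 - p 5 * q 3) - (p 4 * q 6 - p 6 * q 4) = 0 := by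
    have := hk 1
    simp at this
    linarith
  have h2 : p 0 * q 1 - p 1 * q 0 - (p 3 * q 6 - p 6 * q 3) - (p 4 * q 5 - p 5 * q 4) = 0 := by
    have := hk 2
    simp at this
    linarith
  have h3 : -(p 0 * q 4 - p 4 * q 0) - (p 1 * q 5 - p 5 * q 1) + (p 2 * q 6 - p 6 * q 2) = 0 := by
    have := hk 3
    simp at this
    linarith
  have h4 : p 0 * q 3 - p 3 * q 0 + (p 1 * q 6 - p 6 * q 1) + (p 2 * q 5 - p 5 * q 2) = 0 := by
    have := hk 4
    simp at this
    linarith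
  have h5 : -(p 0 * q 6 - p 6 * q 0) + (p 1 * q 3 - p 3 * q 1) - (p 2 * q 4 - p 4 * q 2) = 0 := by
    have := hk 5
    simp at this
    linarith
  have h6 : p 0 * q 5 - p 5 * q 0 - (p 1 * q 4 - p 4 * q 1) - (p 2 * q 3 - p 3 * q 2) = 0 := by
    have := hk 6
    simp at this
    linarith
  obtain ⟨S, hS⟩ : ∃ S, S = ∑ i, p i * p i := ⟨_, rfl⟩
  obtain ⟨T, hT⟩ : ∃ T, T = ∑ i, p i * q i := ⟨_, rfl⟩
  obtain ⟨R, hR⟩ : ∃ R, R = ∑ i, q i * q i := ⟨_, rfl⟩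
  -- The sum of the squares of the seven components is the Gram determinant of u and v.
  have hL : S * R - T ^ 2 = 0 := by
    have hsum := congrArg₂ (· + ·) (congrArg₂ (· + ·) (congrArg₂ (· + ·)
      (congrArg (· ^ 2) h0) (congrArg (· ^ 2) h1)) (congrArg₂ (· + ·)
      (congrArg (· ^ 2) h2) (congrArg (· ^ 2) h3))) (congrArg₂ (· + ·) (congrArg₂ (· + ·)
      (congrArg (· ^ 2) h4) (congrArg (· ^ 2) h5)) (congrArg (· ^ 2) h6))
    simp only [Fin.sum_univ_seven] at hS hT hR
    rw [hS, hT, hR]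
    linear_combination hsum
  have hz : ∑ i, (R * p i - T * q i) ^ 2 = 0 := by
    have h7 : ∀ r t : ℝ, ∑ i, (r * p i - t * q i) ^ 2 =
        r ^ 2 * ∑ i, p i * p i - 2 * r * t * ∑ i, p i * q i + t ^ 2 * ∑ i, q i * q i := by
      intro r t
      simp only [Finset.mul_sum, ← Finset.sum_sub_distrib, ← Finset.sum_add_distrib]
      exact Finset.sum_congr rfl fun i _ => by ring
    rw [h7, ← hS, ← hT, ← hR]
    linear_combination R * hL
  have hzi : ∀ i, R * p i - T * q i = 0 := fun i => by
    have := (Finset.sum_eq_zero_iff_of_nonneg fun i _ => sq_nonneg (R * p i - T * q i)).1 hz i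
      (Finset.mem_univ i)
    exact pow_eq_zero_iff (two_ne_zero) |>.1 this
  rw [LinearIndependent.pair_iff] at hi
  have hRT := hi R (-T) (by
    apply e.ext_elem
    intro i
    have := hzi i
    simp only [map_add, map_smul, Finsupp.add_apply, Finsupp.smul_apply, hp, hq, smul_eq_mul,
      map_zero, Finsupp.zero_apply]
    linarith)
  have hq0 : ∀ i, q i = 0 := fun i => by
    have := (Finset.sum_eq_zero_iff_of_nonneg fun i _ => mul_self_nonneg (q i)).1
      (hR.symm.trans hRT.1) i (Finset.mem_univ i)
    exact mul_self_eq_zero.1 this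
  have h8 := hi 0 1 (by
    apply e.ext_elem
    intro i
    simp [hq, hq0])
  exact one_ne_zero h8.2

theorem formOf_apply {k : ℕ} (e : Module.Basis (Fin 7) ℝ E7) (L : List (ℤ × (Fin k → Fin 7)))
    (u : Fin k → E7) : formOf e L u = (L.map fun p => p.1 * dualForm e p.2 u).sum := by
  induction L with
  | nil => simp [formOf]
  | cons p L ih =>
    rw [formOf, ContinuousAlternatingMap.add_apply, ih, ContinuousAlternatingMap.smul_apply,
      List.map_cons, List.sum_cons, smul_eq_mul]

theorem formOf_eta_three_four (w : E7) : formOf bBry etaL ![bBry 3, bBry 4, w] = 0 := by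
  rw [formOf_apply]
  simp [etaL, dualForm_apply, Matrix.det_fin_three]

theorem formOf_beta_zero_one (w : E7) : formOf bBry betaL ![bBry 0, bBry 1, w] = 0 := by
  rw [formOf_apply]
  simp [betaL, dualForm_apply, Matrix.det_fin_three]

theorem formOf_basis_three (L : List (ℤ × (Fin 3 → Fin 7))) (i j k : Fin 7) :
    formOf bBry L ![bBry i, bBry j, bBry k] = coeffOf L ![i, j, k] := by
  rw [← formOf_basis]
  congr 1
  ext1 a
  fin_cases a <;> rfl

/-- The form η is annihilated by the pair e_4, e_5 and β by the pair e_1, e_2, which a positive form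
does not allow. -/
theorem coeff_ne_zero {a b : ℝ}
    (h : IsPositive (a • formOf bBry etaL + b • formOf bBry betaL)) : a ≠ 0 ∧ b ≠ 0 := by
  obtain ⟨e, he⟩ := exists_phiBry h
  have hli : ∀ i j : Fin 7, i ≠ j → LinearIndependent ℝ ![bBry i, bBry j] := fun i j hij => by
    have h1 := bBry.linearIndependent.comp ![i, j] (by
      intro a b hab
      fin_cases a <;> fin_cases b <;> simp_all)
    have h2 : ⇑bBry ∘ ![i, j] = ![bBry i, bBry j] := by
      ext1 k
      fin_cases k <;> rfl
    rwa [h2] at h1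
  constructor
  · rintro rfl
    refine phiBry_nondegenerate e (fun w => ?_) (hli 0 1 (by decide))
    rw [← he, ContinuousAlternatingMap.add_apply, ContinuousAlternatingMap.smul_apply,
      ContinuousAlternatingMap.smul_apply, formOf_beta_zero_one, zero_smul, smul_zero, zero_add]
  · rintro rfl
    refine phiBry_nondegenerate e (fun w => ?_) (hli 3 4 (by decide))
    rw [← he, ContinuousAlternatingMap.add_apply, ContinuousAlternatingMap.smul_apply,
      ContinuousAlternatingMap.smul_apply, formOf_eta_three_four, zero_smul, smul_zero, zero_add]

theorem IsGInvariant.eq_invForm {α : Form E7 3} (hα : IsGInvariant α) :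
    α = α oBry ![bBry 0, bBry 1, bBry 2] • invForm etaL +
      α oBry ![bBry 0, bBry 3, bBry 4] • invForm betaL := by
  ext1 x
  rw [hα.eq_comp_coframe x, hα.eq_at_zero, comp_smul_add_smul, ← hα.eq_at_zero]
  rfl

theorem hasDerivAt_alt_apply {k : ℕ} {α : ℝ → Alt k} {β : Alt k} {t : ℝ} (h : HasDerivAt α β t)
    (u : Fin k → E7) : HasDerivAt (fun s => α s u) (β u) t := by
  exact (ContinuousAlternatingMap.apply ℝ E7 ℝ u).hasFDerivAt.comp_hasDerivAt t h

theorem pos_of_ne_zero_of_preconnected {J : Set ℝ} (hJ : IsPreconnected J) {f : ℝ → ℝ}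
    (hf : ContinuousOn f J) (h0 : ∀ t ∈ J, f t ≠ 0) {s t : ℝ} (hs : s ∈ J) (hs' : 0 < f s)
    (ht : t ∈ J) : 0 < f t := by
  by_contra! h
  obtain ⟨r, hr, hr'⟩ := hJ.intermediate_value ht hs hf ⟨h, hs'.le⟩
  exact h0 r hr hr'

/-- Solved by l = a^{1/3} and m = (b/l)^{1/2}; positive coefficients thus give a member of the
family with known Laplacian. -/
theorem exists_scaledForm {a b : ℝ} (ha : 0 < a) (hb : 0 < b) :
    ∃ l m : ℝ, l ≠ 0 ∧ m ≠ 0 ∧ l ^ 3 = a ∧ l * m ^ 2 = b := by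
  have hl : 0 < a ^ (1 / 3 : ℝ) := Real.rpow_pos_of_pos ha _
  refine ⟨a ^ (1 / 3 : ℝ), Real.sqrt (b / a ^ (1 / 3 : ℝ)), hl.ne',
    (Real.sqrt_pos.2 (div_pos hb hl)).ne', ?_, ?_⟩
  · rw [← Real.rpow_natCast, ← Real.rpow_mul ha.le]
    norm_num
  · rw [Real.sq_sqrt (div_pos hb hl).le]
    field_simp

theorem invForm_basis_zero {k : ℕ} (L : List (ℤ × (Fin k → Fin 7))) (u : Fin k → E7) :
    invForm L oBry u = formOf bBry L u := by
  rw [invForm, oBry, coframe_zero]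
  rfl

/-- Invariance reduces the flow to the two coefficients of η and β, and hence to an ordinary
differential equation that is solved explicitly. -/
theorem eq_of_isInvariantFlow {J : Set ℝ} (hJ : IsOpen J) (hc : J.OrdConnected) (h0 : 0 ∈ J)
    {ψ : ℝ → Form E7 3} (hψ : IsInvariantFlow J phiForm ψ) {t : ℝ} (ht : t ∈ J) :
    ψ t = Real.exp (12 * t) • phiForm + (1 - Real.exp (12 * t)) • etaForm := by
  obtain ⟨hψ0, hinv, hflow⟩ := hψ
  have he0 : formOf bBry etaL ![bBry 0, bBry 1, bBry 2] = 1 := by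
    rw [formOf_basis_three, coeffOf_eta _ _ (by decide) _ (by decide)]
    simp
  have he1 : formOf bBry etaL ![bBry 0, bBry 3, bBry 4] = 0 := by
    rw [formOf_basis_three, coeffOf_eta _ _ (by decide) _ (by decide)]
    simp
  have hb0 : formOf bBry betaL ![bBry 0, bBry 1, bBry 2] = 0 := formOf_beta_zero_one _
  have hb1 : formOf bBry betaL ![bBry 0, bBry 3, bBry 4] = 1 := by
    rw [formOf_basis_three, coeffOf_beta _ _ (by decide) _ (by decide)]
    simp
  obtain ⟨a, ha⟩ : ∃ a : ℝ → ℝ, a = fun s => ψ s oBry ![bBry 0, bBry 1, bBry 2] := ⟨_, rfl⟩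
  obtain ⟨b, hb⟩ : ∃ b : ℝ → ℝ, b = fun s => ψ s oBry ![bBry 0, bBry 3, bBry 4] := ⟨_, rfl⟩
  have heq : ∀ s ∈ J, ψ s = a s • invForm etaL + b s • invForm betaL := fun s hs => by
    rw [ha, hb]
    exact (hinv s hs).eq_invForm
  have hne : ∀ s ∈ J, a s ≠ 0 ∧ b s ≠ 0 := fun s hs => by
    have h1 := (hflow s hs).1.2 oBry
    rw [(hinv s hs).eq_at_zero] at h1
    rw [ha, hb]
    exact coeff_ne_zero h1
  have hda : ∀ s ∈ J, HasDerivAt a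
      (laplacian (ψ s) (ψ s) oBry ![bBry 0, bBry 1, bBry 2]) s := fun s hs => by
    rw [ha]
    exact hasDerivAt_alt_apply ((hflow s hs).2.2 oBry) _
  have hdb : ∀ s ∈ J, HasDerivAt b
      (laplacian (ψ s) (ψ s) oBry ![bBry 0, bBry 3, bBry 4]) s := fun s hs => by
    rw [hb]
    exact hasDerivAt_alt_apply ((hflow s hs).2.2 oBry) _
  have hφ0 : ∀ u, phiForm oBry u = formOf bBry etaL u + formOf bBry betaL u := fun u => by
    rw [phiForm_eq_add, etaForm, Pi.add_apply, ContinuousAlternatingMap.add_apply,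
      invForm_basis_zero, invForm_basis_zero]
  have ha0 : a 0 = 1 := by
    rw [ha]
    beta_reduce
    rw [hψ0, hφ0, he0, hb0, add_zero]
  have hb0' : b 0 = 1 := by
    rw [hb]
    beta_reduce
    rw [hψ0, hφ0, he1, hb1, zero_add]
  have hpre : IsPreconnected J := hc.isPreconnected
  -- A continuous function without zeros on an interval keeps the sign it has at time 0, where both
  -- coefficients are 1.
  have hpa : ∀ s ∈ J, 0 < a s := fun s hs => pos_of_ne_zero_of_preconnected hpre
    (fun r hr => (hda r hr).continuousAt.continuousWithinAt) (fun r hr => (hne r hr).1) h0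
    (by rw [ha0]; exact one_pos) hs
  have hpb : ∀ s ∈ J, 0 < b s := fun s hs => pos_of_ne_zero_of_preconnected hpre
    (fun r hr => (hdb r hr).continuousAt.continuousWithinAt) (fun r hr => (hne r hr).2) h0
    (by rw [hb0']; exact one_pos) hs
  have hlap : ∀ s ∈ J, ∃ l : ℝ, l ≠ 0 ∧ l ^ 3 = a s ∧
      laplacian (ψ s) (ψ s) = (12 * (b s / l ^ 2)) • invForm betaL := fun s hs => by
    obtain ⟨l, m, hl, hm, h1, h2⟩ := exists_scaledForm (hpa s hs) (hpb s hs)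
    refine ⟨l, hl, h1, ?_⟩
    rw [heq s hs, ← h1, ← h2, ← scaledForm_eq, laplacian_scaledForm hl hm]
    congr 2
    field_simp
  -- The Laplacian is a multiple of β, which has no e^123-component; so a stays equal to 1.
  have hda' : ∀ s ∈ J, HasDerivAt a 0 s := fun s hs => by
    obtain ⟨l, -, -, h1⟩ := hlap s hs
    have h2 := hda s hs
    rw [h1, Pi.smul_apply, ContinuousAlternatingMap.smul_apply, invForm_basis_zero, hb0,
      smul_zero] at h2
    exact h2
  have hconst : ∀ {f : ℝ → ℝ}, (∀ s ∈ J, HasDerivAt f 0 s) → ∀ s ∈ J, f s = f 0 := by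
    intro f hf s hs
    exact hJ.is_const_of_deriv_eq_zero hpre
      (fun r hr => (hf r hr).differentiableAt.differentiableWithinAt)
      (fun r hr => (hf r hr).deriv) hs h0
  have ha1 : ∀ s ∈ J, a s = 1 := fun s hs => (hconst hda' s hs).trans ha0
  have hdb' : ∀ s ∈ J, HasDerivAt b (12 * b s) s := fun s hs => by
    obtain ⟨l, -, h3, h1⟩ := hlap s hs
    have h2 := hdb s hs
    rw [ha1 s hs] at h3
    -- The only real cube root of 1; with it the equation for b becomes linear.
    have hl : l = 1 := by nlinarith [sq_nonneg (l + 1), sq_nonneg l]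
    rw [h1, Pi.smul_apply, ContinuousAlternatingMap.smul_apply, invForm_basis_zero, hb1, hl,
      smul_eq_mul, mul_one, one_pow, div_one] at h2
    exact h2
  -- The integrating factor makes the product constant on J.
  have hbe : b t * Real.exp (-(12 * t)) = 1 := by
    have h1 : ∀ s ∈ J, HasDerivAt (fun r => b r * Real.exp (-(12 * r))) 0 s := fun s hs => by
      have h2 : HasDerivAt (fun r : ℝ => Real.exp (-(12 * r))) (Real.exp (-(12 * s)) * -12) s := by
        simpa using ((hasDerivAt_id s).const_mul 12).fun_neg.exp
      refine ((hdb' s hs).fun_mul h2).congr_deriv ?_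
      ring
    rw [hconst h1 t ht, hb0']
    simp
  have hbt : b t = Real.exp (12 * t) := by
    rw [Real.exp_neg] at hbe
    have := Real.exp_ne_zero (12 * t)
    field_simp at hbe
    exact hbe
  rw [heq t ht, ha1 t ht, hbt, phiForm_eq_add, etaForm]
  module

end G2Flow

end

theorem mainTheorem3 :
    -- `E7` is the homogeneous space `G/K`, with the reductive decomposition `𝔤 = 𝔨 ⊕ 𝔭`.
    MulAction.IsPretransitive GBry E7 ∧ MulAction.stabilizer GBry oBry = KBry ∧
    (∀ a : GBry, ContDiff ℝ ∞ (fun x : E7 => a • x)) ∧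
    IsCompl kBry pBry ∧ (∀ Z ∈ kBry, ∀ Y ∈ pBry, ⁅Z, Y⁆ ∈ pBry) ∧
    ∃ (b : Module.Basis (Fin 7) ℝ E7) (φ η : Form E7 3),
      -- `b` is the basis `e_1, …, e_7` of `𝔭 ≡ T_o(G/K)`, `φ` is the form of Bryant,
      -- and `η = e^123`.
      (∀ i, b i = tang (pMat i)) ∧
      IsGInvariant φ ∧
      φ oBry = dualForm b ![0, 1, 2] + dualForm b ![0, 3, 4] + dualForm b ![0, 5, 6]
        + dualForm b ![1, 3, 5] - dualForm b ![1, 4, 6] - dualForm b ![2, 3, 6]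
        - dualForm b ![2, 4, 5] ∧
      IsGInvariant η ∧ η oBry = dualForm b ![0, 1, 2] ∧
      -- `φ` is an extremally Ricci pinched `G₂`-structure for which `b` is orthonormal.
      IsG2Structure φ ∧ IsERP φ ∧
      (∀ i j, metric φ oBry ![b i, b j] = if i = j then 1 else 0) ∧
      torsion φ oBry = (6 : ℝ) • dualForm b ![3, 4] - (6 : ℝ) • dualForm b ![5, 6] ∧
      (∃ T : E7 →ₗ[ℝ] E7, (∀ u v, metric φ oBry ![T u, v] = torsion φ oBry ![u, v]) ∧
        ∀ i, T (T (b i)) = (if i < 3 then 0 else -36 : ℝ) • b i) ∧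
      laplacian φ φ = extD (torsion φ) ∧
      laplacian φ φ = (12 : ℝ) • φ - (12 : ℝ) • η ∧
      -- `φ` is a steady algebraic soliton, `Q_{dτ} = D_𝔭` and `D ∈ Der(𝔤)`.
      (∃ (Q : E7 →ₗ[ℝ] E7) (D : LieDerivation ℝ gBry gBry), IsQ φ Q ∧
        (∀ i, Q (b i) = (if i < 3 then 0 else -6 : ℝ) • b i) ∧
        IsBlockScalar D (-6) ∧ (∀ Y ∈ pBry, Q (tang Y.1) = tang (D Y).1) ∧
        IsAlgebraicFor φ Q 0 D) ∧
      IsLaplacianSoliton φ 0 ∧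
      -- The `G`-invariant Laplacian flow solution starting at `φ` is eternal, unique and
      -- self-similar by equivariant diffeomorphisms.
      IsInvariantFlow Set.univ φ
        (fun t => Real.exp (12 * t) • φ + (1 - Real.exp (12 * t)) • η) ∧
      (∀ J : Set ℝ, IsOpen J → J.OrdConnected → 0 ∈ J → ∀ ψ : ℝ → Form E7 3,
        IsInvariantFlow J φ ψ →
          ∀ t ∈ J, ψ t = Real.exp (12 * t) • φ + (1 - Real.exp (12 * t)) • η) ∧
      (∃ f : ℝ → E7 ≃ₘ⟮𝓘(ℝ, E7), 𝓘(ℝ, E7)⟯ E7, ∀ t, IsEquivariant (f t) ∧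
        Real.exp (12 * t) • φ + (1 - Real.exp (12 * t)) • η = pullback (f t) φ) ∧
      -- Every smooth quotient `M = Γ \ G/K` (compact or not): `φ` and `e^123` descend to `M`, and
      -- the Laplacian flow solution starting at `φ` on `M` is eternal.
      (∀ (Γ : Subgroup GBry) (M : Type*) [TopologicalSpace M] [ChartedSpace E7 M]
        [IsManifold 𝓘(ℝ, E7) ∞ M] (π : E7 → M),
        IsLocalDiffeomorph 𝓘(ℝ, E7) 𝓘(ℝ, E7) ∞ π → Function.Surjective π →
        (∀ x y, π x = π y ↔ ∃ γ ∈ Γ, γ • x = y) →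
        ∃ φM ηM : Form M 3, pullback π φM = φ ∧ pullback π ηM = η ∧ IsERP φM ∧
          ∃ ψ : ℝ → Form M 3, ψ 0 = φM ∧ IsLaplacianFlow Set.univ ψ ∧
            ∀ t, ψ t = Real.exp (12 * t) • φM + (1 - Real.exp (12 * t)) • ηM) ∧
      -- The Ricci operator is `Diag(-12, -12, -12, 0, 0, 0, 0) = -12 I + E_𝔭` with
      -- `E ∈ Der(𝔤)`, and the metric is an expanding Ricci soliton.
      (∀ i j, ricci (metric φ) oBry (b i) (b j) = if i = j ∧ i < 3 then -12 else 0) ∧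
      (∃ E : LieDerivation ℝ gBry gBry, IsBlockScalar E 12 ∧ (∀ Y ∈ pBry, E Y ∈ pBry) ∧
        ∀ Y ∈ pBry, ∀ Z ∈ pBry, ricci (metric φ) oBry (tang Y.1) (tang Z.1) =
          -12 * metric φ oBry ![tang Y.1, tang Z.1]
            + metric φ oBry ![tang (E Y).1, tang Z.1]) ∧
      IsRicciSoliton (metric φ) (-12) := by
  refine ⟨isPretransitive_G, stabilizer_eq, contDiff_smul_G, isCompl_kBry_pBry, lie_kBry_pBry,
    bBry, phiForm, etaForm, bBry_eq_tang, isGInvariant_scaledForm 1 1, phiForm_zero,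
    isGInvariant_eta, etaForm_zero, isG2Structure_phiForm, isERP_phiForm, metric_phiForm_basis,
    torsion_phiForm_zero, exists_torsion_operator, ?_, laplacian_phiForm, exists_soliton_operator,
    isLaplacianSoliton_phiForm, isInvariantFlow_phiForm,
    fun J hJ hc h0 ψ hψ t ht => eq_of_isInvariantFlow hJ hc h0 hψ ht, exists_equivariant_flow,
    ?_, ricci_phiForm_basis, exists_ricci_derivation, isRicciSoliton_phiForm⟩
  · exact laplacian_of_closed isERP_phiForm.1
  · intro Γ M _ _ _ π hπ hs hΓ
    exact exists_quotient_flow Γ M π hπ hs hΓ
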